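/- Let $\beta_0,\beta_1>0$ and $\Gamma=\{z\in\mathbb C : |\Im z|\le \min(\beta_0\Re z,\beta_1),\ \Re z\ge 0\}$. Let $U_s$ be holomorphic on (a neighbourhood of) $\Gamma$, real valued and concave on $[0,\infty)$, with $U_s(0)=0$, $U_s'(0)\neq 0$, such that $U_s(y)$ converges exponentially fast to a constant $U_+>0$ as $y\to+\infty$ along $\mathbb R_+$, and $|U_s''(y)|\le C_\beta e^{-\beta\Re y}$ on $\Gamma$ for some $\beta>0$ and $C_\beta$. Let $c\in\mathbb C$, $c\ne U_+$, and let $y_c\in\Gamma$ be the only solution in $\Gamma$ of $U_s(y_c)=c$, with $U_s'(y_c)\ne0$. Set $\Gamma(y_c)=\Gamma\setminus (y_c-i\mathbb R_+)$, and let $\log$ be the determination of the logarithm that is holomorphic on $\mathbb C\setminus(-i\mathbb R_+)$ and real on $(0,\infty)$. For a power series $P(Y)=\sum_{n\ge0}a_nY^n$ and $\rho>0$ put $\|P\|_\rho=\sum_{n\ge0}|a_n|\rho^n$. For $\rho,\sigma>0$, let $Y_{\rho,\sigma}$ be the space of functions $f$, holomorphic on (a neighbourhood of every point of) $\Gamma(y_c)$,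 that are of the form $f(y)=P(y-y_c)+(y-y_c)\log(y-y_c)\,Q(y-y_c)$ for $y\in\Gamma(y_c)$ near $y_c$, and for which $$\|f\|_{Y_{\rho,\sigma}}=\sup_{y\in\Gamma(y_c)}|f(y)e^{\sigma y}|+\|P\|_\rho+\|Q\|_\rho<\infty .$$ For $\alpha>0$ let $Ray_{\alpha,c}\,\phi=(U_s-c)(\partial_y^2-\alpha^2)\phi-U_s''\phi$. Let $\sigma>\alpha>0$. Then there is $\rho_0>0$ such that for every $\rho\in(0,\rho_0)$ there is a constant $C$ with the following property. For every $f\in Y_{\rho,\sigma}$ there exists $\phi\in Y_{\rho,\alpha}$ with $$Ray_{\alpha,c}\,\phi=f\ \text{ on }\Gamma(y_c),\qquad \|\phi\|_{Y_{\rho,\alpha}}\le C\,\|f\|_{Y_{\rho,\sigma}},$$ and, if moreover $\sigma<\beta$, then $(U_s-c)(\partial_y^2-\alpha^2)\phi\in Y_{\rho,\sigma}$ and $$\|(U_s-c)(\partial_y^2-\alpha^2)\phi\|_{Y_{\rho,\sigma}}\le C\,\|f\|_{Y_{\rho,\sigma}} .$$ -/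

import Mathlib

open scoped ENNReal NNReal Topology

/-- The pencil-like neighbourhood
`Γ_{β₀,β₁} = {z : |Im z| ≤ min (β₀ Re z, β₁), Re z ≥ 0}` of the half line `[0, ∞)`. -/
def pencil (β₀ β₁ : ℝ) : Set ℂ :=
  {z : ℂ | |z.im| ≤ min (β₀ * z.re) β₁ ∧ 0 ≤ z.re}

/-- The closed vertical half line `y_c - i ℝ₊`. -/
def downRay (yc : ℂ) : Set ℂ :=
  {z : ℂ | ∃ t : ℝ, 0 ≤ t ∧ z = yc - Complex.I * (t : ℂ)}

/-- The slit pencil `Γ_{β₀,β₁}(y_c) = Γ_{β₀,β₁} ∖ (y_c - i ℝ₊)`. -/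
def slitPencil (β₀ β₁ : ℝ) (yc : ℂ) : Set ℂ :=
  pencil β₀ β₁ \ downRay yc

/-- The determination of the logarithm that is holomorphic off `-i ℝ₊` and real on the
positive half line (argument in `(-π/2, 3π/2]`). -/
noncomputable def slitLog (z : ℂ) : ℂ :=
  Complex.log (-Complex.I * z) + Complex.I * ((Real.pi / 2 : ℝ) : ℂ)

/-- Concave analytic shear layer profiles `U_s`: holomorphic on (a neighbourhood of every point
of) the pencil, real and concave on `[0, ∞)`, `U_s 0 = 0`, `U_s' 0 ≠ 0`, converging exponentially
fast to `U₊ > 0`, with `|U_s'' y| ≤ C exp (-β Re y)` on the pencil. -/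
structure IsShearProfile (β₀ β₁ : ℝ) (U : ℂ → ℂ) (Uplus β : ℝ) : Prop where
  analytic : AnalyticOnNhd ℂ U (pencil β₀ β₁)
  real : ∀ x : ℝ, 0 ≤ x → (U (x : ℂ)).im = 0
  concave : ConcaveOn ℝ (Set.Ici (0 : ℝ)) (fun x : ℝ => (U (x : ℂ)).re)
  map_zero : U 0 = 0
  deriv_zero : deriv U 0 ≠ 0
  limit_pos : 0 < Uplus
  tendsto : ∃ C γ : ℝ, 0 < γ ∧
    ∀ x : ℝ, 0 ≤ x → ‖U (x : ℂ) - (Uplus : ℂ)‖ ≤ C * Real.exp (-γ * x)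
  rate_pos : 0 < β
  decay : ∃ C : ℝ, ∀ y ∈ pencil β₀ β₁, ‖iteratedDeriv 2 U y‖ ≤ C * Real.exp (-β * y.re)

/-- `(U_s - c) (∂_y² φ - α² φ)`, i.e. `U_s - c` times the vorticity of the stream function `φ`. -/
noncomputable def vorticityTerm (U : ℂ → ℂ) (α : ℝ) (c : ℂ) (φ : ℂ → ℂ) (y : ℂ) : ℂ :=
  (U y - c) * (iteratedDeriv 2 φ y - (α : ℂ) ^ 2 * φ y)

/-- The Rayleigh operator `Ray_{α,c} φ = (U_s - c) (∂_y² - α²) φ - U_s'' φ`. -/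
noncomputable def rayleigh (U : ℂ → ℂ) (α : ℝ) (c : ℂ) (φ : ℂ → ℂ) (y : ℂ) : ℂ :=
  vorticityTerm U α c φ y - iteratedDeriv 2 U y * φ y

/-- `‖P‖_ρ = ∑ |aₙ| ρⁿ` for the power series `P(Y) = ∑ aₙ Yⁿ`, with value `∞` if the sum
diverges. -/
noncomputable def seriesNorm (ρ : ℝ) (a : ℕ → ℂ) : ℝ≥0∞ :=
  ∑' n, ‖a n‖ₑ * ENNReal.ofReal ρ ^ n

/-- Near `y_c` (in the slit pencil), `f = P(y - y_c) + (y - y_c) log (y - y_c) Q(y - y_c)` where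
`P(Y) = ∑ aₙ Yⁿ` and `Q(Y) = ∑ bₙ Yⁿ`. This is only used with `‖P‖_ρ` and `‖Q‖_ρ` finite, in
which case both series converge near `0`. -/
def HasLogForm (β₀ β₁ : ℝ) (yc : ℂ) (f : ℂ → ℂ) (a b : ℕ → ℂ) : Prop :=
  ∀ᶠ y in 𝓝[slitPencil β₀ β₁ yc] yc,
    f y = (∑' n, a n * (y - yc) ^ n)
      + (y - yc) * slitLog (y - yc) * ∑' n, b n * (y - yc) ^ n

/-- The weighted sup norm `sup |f(y) exp (σ y)|` over the slit pencil. -/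
noncomputable def weightedSupNorm (β₀ β₁ : ℝ) (yc : ℂ) (σ : ℝ) (f : ℂ → ℂ) : ℝ≥0∞ :=
  ⨆ y ∈ slitPencil β₀ β₁ yc, ‖f y * Complex.exp ((σ : ℂ) * y)‖ₑ

/-- The norm of `Y_{ρ,σ}`: the weighted sup norm plus `‖P‖_ρ + ‖Q‖_ρ`, with value `∞` outside
the space. The pair `(P, Q)` with `‖P‖_ρ + ‖Q‖_ρ < ∞` is determined by `f`, so that the infimum
just selects it. -/
noncomputable def yNorm (β₀ β₁ : ℝ) (yc : ℂ) (ρ σ : ℝ) (f : ℂ → ℂ) : ℝ≥0∞ :=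
  weightedSupNorm β₀ β₁ yc σ f
    + ⨅ (a : ℕ → ℂ) (b : ℕ → ℂ) (_ : HasLogForm β₀ β₁ yc f a b),
        (seriesNorm ρ a + seriesNorm ρ b)

/-- Membership in `Y_{ρ,σ}`: `f` is holomorphic on (a neighbourhood of every point of) the slit
pencil and its `Y_{ρ,σ}` norm is finite. -/
def MemY (β₀ β₁ : ℝ) (yc : ℂ) (ρ σ : ℝ) (f : ℂ → ℂ) : Prop :=
  AnalyticOnNhd ℂ f (slitPencil β₀ β₁ yc) ∧ yNorm β₀ β₁ yc ρ σ f < ∞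

/-! The divided difference `dslope U yc`, that is (U - c)/(y - yc) off yc, is analytic and nowhere
zero on the pencil. Dividing by it turns the Rayleigh equation, in Y = y - yc, into Y φ'' = W φ + k
f with W and k analytic and of at most linear growth. Thus yc is a regular singular point with
exponents 0 and 1, and solutions look like P + Y log Y Q. No boundary condition is imposed at y = 0,
so no spectral obstruction can occur: it suffices to pick, among all solutions, one that decays.

Near yc, comparing coefficients gives recursions for P and Q in which p₀ and p₁ are free and q₀ is
forced. They are solved in the norm ∑ |aₙ| ρⁿ once ρ is small (`exists_local_solution`).

Away from yc, the slit pencil is star-shaped about yc. After subtracting p₀ + p₁ Y + q₀ Y log Y, the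
substitution Y = exp (-ξ), u = Y w makes rays into yc horizontal rays to infinity and the equation
w'' - w' = (Y W) w + R. This is solved by successive approximations from infinity
(`exists_volterra_solution`), and the matching uniqueness statement
(`eq_zero_of_volterra_homogeneous`) identifies the result near yc with the series solution. The
outcome is `exists_solution_from_center`, with bounds on bounded parts of the domain only.

At infinity U - c stays away from 0 because c ≠ U₊. Writing φ = exp (-α y) w gives again a Volterra
equation, now w'' - 2α w' = V w + exp (α y) g, whose source decays since σ > α. This yields a
solution of size exp (-α Re y) on a half strip (`exists_solution_on_halfStrip`).

The two are glued in `exists_decaying_rayleigh_solution`. The homogeneous solutions with (p₀, p₁) =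
(0, 1) and (1, 0) are independent, so their Wronskian at a real point z₀ of the strip is nonzero. A
combination of them corrects a particular solution from yc so that its Cauchy data at z₀ are those
of the decaying solution. The vorticity term equals f + U'' φ and inherits its estimates from those
of f, φ and U''. -/

section

/-! ### Integrals along horizontal rays to infinity, controlled by a tail weight -/

open Filter Set MeasureTheory

/-- `μ` is a nonnegative nonincreasing weight on the line whose tail integral is `G`. -/
structure IsTailWeight (μ G : ℝ → ℝ) : Prop where
  antitone : Antitone μ
  nonneg : ∀ x, 0 ≤ μ x
  hasDerivAt : ∀ x, HasDerivAt G (-μ x) x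
  tendsto : Tendsto G atTop (𝓝 0)

namespace IsTailWeight

variable {μ G : ℝ → ℝ}

theorem hasDerivAt_shift (h : IsTailWeight μ G) (x t : ℝ) :
    HasDerivAt (fun t => G (x + t)) (-μ (x + t)) t := by
  simpa using (h.hasDerivAt (x + t)).comp_const_add x t

theorem tendsto_shift (h : IsTailWeight μ G) (x : ℝ) :
    Tendsto (fun t => G (x + t)) atTop (𝓝 0) :=
  h.tendsto.comp (tendsto_atTop_add_const_left _ _ tendsto_id)

theorem integrableOn_shift (h : IsTailWeight μ G) (x : ℝ) :
    IntegrableOn (fun t => μ (x + t)) (Ioi 0) := by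
  have := integrableOn_Ioi_deriv_of_nonpos' (a := 0) (fun t _ => h.hasDerivAt_shift x t)
    (fun t _ => neg_nonpos.2 (h.nonneg _)) (h.tendsto_shift x)
  simpa using this.neg

theorem integral_shift (h : IsTailWeight μ G) (x : ℝ) :
    ∫ t in Ioi (0 : ℝ), μ (x + t) = G x := by
  have := integral_Ioi_of_hasDerivAt_of_nonpos' (a := 0) (fun t _ => h.hasDerivAt_shift x t)
    (fun t _ => neg_nonpos.2 (h.nonneg _)) (h.tendsto_shift x)
  rw [integral_neg] at this
  simpa using this

theorem tail_nonneg (h : IsTailWeight μ G) (x : ℝ) : 0 ≤ G x := by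
  rw [← h.integral_shift x]
  exact integral_nonneg fun t => h.nonneg _

theorem tail_antitone (h : IsTailWeight μ G) : Antitone G :=
  antitone_of_hasDerivAt_nonpos (f' := fun x => -μ x) h.hasDerivAt
    (fun x => neg_nonpos.2 (h.nonneg x))

theorem const_mul (h : IsTailWeight μ G) {K : ℝ} (hK : 0 ≤ K) :
    IsTailWeight (fun x => K * μ x) (fun x => K * G x) where
  antitone := fun _ _ hxy => mul_le_mul_of_nonneg_left (h.antitone hxy) hK
  nonneg := fun x => mul_nonneg hK (h.nonneg x)
  hasDerivAt := fun x => by simpa using (h.hasDerivAt x).const_mul K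
  tendsto := by simpa using h.tendsto.const_mul K

/-- Since G' = -μ, the weight μ Gⁿ integrates exactly to Gⁿ⁺¹/(n + 1). Repeating this is the source
of the factorials in the Volterra iteration. -/
theorem pow (h : IsTailWeight μ G) (n : ℕ) :
    IsTailWeight (fun x => μ x * G x ^ n) (fun x => G x ^ (n + 1) / (n + 1)) where
  antitone := fun _ _ hxy => mul_le_mul (h.antitone hxy)
    (pow_le_pow_left₀ (h.tail_nonneg _) (h.tail_antitone hxy) n)
    (pow_nonneg (h.tail_nonneg _) n) (h.nonneg _)
  nonneg := fun x => mul_nonneg (h.nonneg x) (pow_nonneg (h.tail_nonneg x) n)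
  hasDerivAt := fun x => by
    have hn : (n : ℝ) + 1 ≠ 0 := by positivity
    refine (((h.hasDerivAt x).fun_pow (n + 1)).div_const ((n : ℝ) + 1)).congr_deriv ?_
    push_cast
    field_simp
  tendsto := by
    have := (h.tendsto.pow (n + 1)).div_const ((n : ℝ) + 1)
    simpa using this

end IsTailWeight

/-- Open sets invariant under translations to the right. -/
structure IsRightInvariant (D : Set ℂ) : Prop where
  isOpen : IsOpen D
  add_mem : ∀ ξ ∈ D, ∀ t : ℝ, 0 ≤ t → ξ + t ∈ D

/-- `∫₀^∞ exp (-b t) h (ξ + t) dt`. -/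
noncomputable def expTail (b : ℝ) (h : ℂ → ℂ) (ξ : ℂ) : ℂ :=
  ∫ t in Ioi (0 : ℝ), (Real.exp (-b * t) : ℂ) * h (ξ + t)

section ExpTail

variable {D : Set ℂ} {μ G : ℝ → ℝ} {h : ℂ → ℂ} {b : ℝ}

theorem norm_exp_neg_mul_le (hb : 0 ≤ b) {t : ℝ} (ht : 0 ≤ t) :
    ‖((Real.exp (-b * t) : ℝ) : ℂ)‖ ≤ 1 := by
  rw [Complex.norm_real, Real.norm_eq_abs, Real.abs_exp, Real.exp_le_one_iff]
  nlinarith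

theorem continuousOn_comp_add (hD : IsRightInvariant D) {k : ℂ → ℂ} (hk : ContinuousOn k D)
    {ξ : ℂ} (hξ : ξ ∈ D) : ContinuousOn (fun t : ℝ => k (ξ + t)) (Ici 0) :=
  hk.comp (by fun_prop) fun t ht => hD.add_mem ξ hξ t ht

theorem aestronglyMeasurable_exp_mul (hD : IsRightInvariant D) {k : ℂ → ℂ}
    (hk : ContinuousOn k D) {ξ : ℂ} (hξ : ξ ∈ D) :
    AEStronglyMeasurable (fun t : ℝ => (Real.exp (-b * t) : ℂ) * k (ξ + t))
      (volume.restrict (Ioi 0)) := by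
  refine ContinuousOn.aestronglyMeasurable ?_ measurableSet_Ioi
  exact ContinuousOn.mul (by fun_prop)
    ((continuousOn_comp_add hD hk hξ).mono Ioi_subset_Ici_self)

theorem norm_exp_mul_le (hD : IsRightInvariant D) (hb : 0 ≤ b)
    (hbd : ∀ ξ ∈ D, ‖h ξ‖ ≤ μ ξ.re) {ξ : ℂ} (hξ : ξ ∈ D) {t : ℝ} (ht : 0 ≤ t) :
    ‖(Real.exp (-b * t) : ℂ) * h (ξ + t)‖ ≤ μ (ξ.re + t) := by
  rw [norm_mul]
  have h1 := norm_exp_neg_mul_le hb ht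
  have h2 := hbd _ (hD.add_mem ξ hξ t ht)
  simp only [Complex.add_re, Complex.ofReal_re] at h2
  nlinarith [norm_nonneg (h (ξ + t)), norm_nonneg ((Real.exp (-b * t) : ℝ) : ℂ)]

theorem integrableOn_exp_mul (hD : IsRightInvariant D) (hw : IsTailWeight μ G) (hb : 0 ≤ b)
    (hh : ContinuousOn h D) (hbd : ∀ ξ ∈ D, ‖h ξ‖ ≤ μ ξ.re) {ξ : ℂ} (hξ : ξ ∈ D) :
    IntegrableOn (fun t : ℝ => (Real.exp (-b * t) : ℂ) * h (ξ + t)) (Ioi 0) :=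
  (hw.integrableOn_shift ξ.re).mono' (aestronglyMeasurable_exp_mul hD hh hξ)
    ((ae_restrict_iff' measurableSet_Ioi).2 (Eventually.of_forall fun _ ht =>
      norm_exp_mul_le hD hb hbd hξ (le_of_lt ht)))

theorem norm_expTail_le (hD : IsRightInvariant D) (hw : IsTailWeight μ G) (hb : 0 ≤ b)
    (hbd : ∀ ξ ∈ D, ‖h ξ‖ ≤ μ ξ.re) {ξ : ℂ} (hξ : ξ ∈ D) :
    ‖expTail b h ξ‖ ≤ G ξ.re := by
  rw [← hw.integral_shift ξ.re]
  exact norm_integral_le_of_norm_le (hw.integrableOn_shift ξ.re)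
    ((ae_restrict_iff' measurableSet_Ioi).2 (Eventually.of_forall fun _ ht =>
      norm_exp_mul_le hD hb hbd hξ (le_of_lt ht)))

/-- Cauchy's estimate. The circle reaches at most r to the left of ξ, and μ is nonincreasing. -/
theorem norm_deriv_le_of_closedBall_subset (hw : Antitone μ)
    (hh : DifferentiableOn ℂ h D) (hbd : ∀ ξ ∈ D, ‖h ξ‖ ≤ μ ξ.re) {ξ : ℂ} {r : ℝ} (hr : 0 < r)
    (hξ : Metric.closedBall ξ r ⊆ D) : ‖deriv h ξ‖ ≤ μ (ξ.re - r) / r := by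
  refine Complex.norm_deriv_le_of_forall_mem_sphere_norm_le hr
    (hh.diffContOnCl_ball hξ) fun z hz => ?_
  refine (hbd z (hξ (Metric.sphere_subset_closedBall hz))).trans (hw ?_)
  have := (Complex.abs_re_le_norm (z - ξ)).trans_eq (mem_sphere_iff_norm.1 hz)
  rw [Complex.sub_re] at this
  linarith [neg_abs_le (z.re - ξ.re)]

/-- Differentiation under the integral gives the integral of exp (-b t) h'(ξ + t). Integration by
parts in t trades h' for h, with boundary term -h ξ. -/
theorem hasDerivAt_expTail (hD : IsRightInvariant D) (hw : IsTailWeight μ G) (hb : 0 ≤ b)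
    (hh : DifferentiableOn ℂ h D) (hbd : ∀ ξ ∈ D, ‖h ξ‖ ≤ μ ξ.re) {ξ : ℂ} (hξ : ξ ∈ D) :
    HasDerivAt (expTail b h) (b * expTail b h ξ - h ξ) ξ := by
  -- With s = r/3, a disc of radius s about any point within s of ξ still lies in D. The dominating
  -- function below is therefore μ shifted by 2 s: one s for the base point, one for the Cauchy
  -- disc.
  obtain ⟨r, hr, hball⟩ := Metric.isOpen_iff.1 hD.isOpen ξ hξ
  set s := r / 3 with hs
  have hs0 : 0 < s := by positivity
  have hsub : ∀ z ∈ Metric.ball ξ s, ∀ t : ℝ, 0 ≤ t → Metric.closedBall (z + t) s ⊆ D := by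
    intro z hz t ht u hu
    have : u - t ∈ D := by
      apply hball
      rw [mem_ball_iff_norm] at hz ⊢
      rw [mem_closedBall_iff_norm] at hu
      calc ‖u - t - ξ‖ = ‖(u - (z + t)) + (z - ξ)‖ := by ring_nf
        _ ≤ s + s := (norm_add_le _ _).trans (add_le_add hu hz.le)
        _ < r := by rw [hs]; linarith
    simpa using hD.add_mem _ this t ht
  have hmem : ∀ z ∈ Metric.ball ξ s, z ∈ D := fun z hz => by
    have := hsub z hz 0 le_rfl
    simp only [Complex.ofReal_zero, add_zero] at this
    exact this (Metric.mem_closedBall_self hs0.le)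
  have hdd : DifferentiableOn ℂ (deriv h) D := hh.deriv hD.isOpen
  have key := hasDerivAt_integral_of_dominated_loc_of_deriv_le
    (μ := volume.restrict (Ioi (0 : ℝ)))
    (F := fun z t => (Real.exp (-b * t) : ℂ) * h (z + t))
    (F' := fun z t => (Real.exp (-b * t) : ℂ) * deriv h (z + t))
    (bound := fun t => μ ((ξ.re - 2 * s) + t) / s) (x₀ := ξ)
    (Metric.ball_mem_nhds ξ hs0)
    (by
      filter_upwards [Metric.ball_mem_nhds ξ hs0] with z hz
      exact aestronglyMeasurable_exp_mul hD hh.continuousOn (hmem z hz))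
    (integrableOn_exp_mul hD hw hb hh.continuousOn hbd hξ)
    (aestronglyMeasurable_exp_mul hD hdd.continuousOn hξ)
    ((ae_restrict_iff' measurableSet_Ioi).2 (Eventually.of_forall fun t ht z hz => by
      have ht0 : (0 : ℝ) ≤ t := le_of_lt ht
      rw [norm_mul]
      have h1 := norm_exp_neg_mul_le hb ht0
      have h2 := norm_deriv_le_of_closedBall_subset hw.antitone hh hbd hs0
        (hsub z hz t ht0)
      have h3 : μ ((z + t).re - s) ≤ μ ((ξ.re - 2 * s) + t) := by
        apply hw.antitone
        have := (Complex.abs_re_le_norm (z - ξ)).trans (mem_ball_iff_norm.1 hz).le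
        rw [Complex.sub_re] at this
        simp only [Complex.add_re, Complex.ofReal_re]
        linarith [neg_abs_le (z.re - ξ.re)]
      have h4 : μ ((z + t).re - s) / s ≤ μ ((ξ.re - 2 * s) + t) / s := by gcongr
      nlinarith [norm_nonneg (deriv h (z + t)), norm_nonneg ((Real.exp (-b * t) : ℝ) : ℂ)]))
    ((hw.integrableOn_shift _).div_const s)
    ((ae_restrict_iff' measurableSet_Ioi).2 (Eventually.of_forall fun t ht z hz => by
      have hzt := hD.add_mem z (hmem z hz) t (le_of_lt ht)
      have := (hh.differentiableAt (hD.isOpen.mem_nhds hzt)).hasDerivAt.comp_add_const z (t : ℂ)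
      exact this.const_mul _))
  obtain ⟨hint, hder⟩ := key
  have hint0 := integrableOn_exp_mul (b := b) hD hw hb hh.continuousOn hbd hξ
  -- The weight itself tends to 0: by the mean value theorem and monotonicity, μ x ≤ G (x - 1) - G
  -- x.
  have hlim : Tendsto (fun t : ℝ => (Real.exp (-b * t) : ℂ) * h (ξ + t)) atTop (𝓝 0) := by
    have hμ0 : Tendsto (fun t => G (ξ.re - 1 + t)) atTop (𝓝 0) := hw.tendsto_shift _
    refine squeeze_zero_norm' ?_ hμ0
    filter_upwards [eventually_ge_atTop (0 : ℝ)] with t ht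
    refine (norm_exp_mul_le hD hb hbd hξ ht).trans ?_
    have hG : μ (ξ.re + t) ≤ G (ξ.re - 1 + t) - G (ξ.re + t) := by
      obtain ⟨c, hc, hc'⟩ := exists_hasDerivAt_eq_slope G (fun x => -μ x)
        (show ξ.re - 1 + t < ξ.re + t by linarith)
        (fun x _ => (hw.hasDerivAt x).continuousAt.continuousWithinAt)
        (fun x _ => hw.hasDerivAt x)
      have h1 : μ (ξ.re + t) ≤ μ c := hw.antitone hc.2.le
      rw [show ξ.re + t - (ξ.re - 1 + t) = 1 by ring, div_one] at hc'
      linarith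
    linarith [hw.tail_nonneg (ξ.re + t)]
  have hder2 : ∀ t ∈ Ici (0 : ℝ), HasDerivAt (fun t : ℝ => (Real.exp (-b * t) : ℂ) * h (ξ + t))
      ((Real.exp (-b * t) : ℂ) * deriv h (ξ + t) - b * ((Real.exp (-b * t) : ℂ) * h (ξ + t))) t := by
    intro t ht
    have h1 : HasDerivAt (fun t : ℝ => ((Real.exp (-b * t) : ℝ) : ℂ))
        ((Real.exp (-b * t) * (-b * 1) : ℝ) : ℂ) t :=
      (((hasDerivAt_id t).const_mul (-b)).exp).ofReal_comp
    have h2 : HasDerivAt (fun t : ℝ => h (ξ + t)) (deriv h (ξ + t)) t := by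
      have h3 := (hh.differentiableAt
        (hD.isOpen.mem_nhds (hD.add_mem ξ hξ t ht))).hasDerivAt
      have h4 : HasDerivAt (fun z : ℂ => h (ξ + z)) (deriv h (ξ + t)) (t : ℂ) :=
        h3.comp_const_add ξ (t : ℂ)
      exact h4.comp_ofReal
    refine (h1.fun_mul h2).congr_deriv ?_
    push_cast
    ring
  have hIBP := integral_Ioi_of_hasDerivAt_of_tendsto' hder2
    (hint.sub (hint0.const_mul (b : ℂ))) hlim
  rw [integral_sub hint (hint0.const_mul (b : ℂ)), integral_const_mul] at hIBP
  have : (∫ t in Ioi (0 : ℝ), (Real.exp (-b * t) : ℂ) * deriv h (ξ + t))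
      = b * expTail b h ξ - h ξ := by
    simp only [mul_zero, Real.exp_zero, Complex.ofReal_one, Complex.ofReal_zero, add_zero,
      one_mul, zero_sub] at hIBP
    unfold expTail
    linear_combination hIBP
  rw [← this]
  exact hder

/-- The decaying solution `v` of `v'' - a v' = h`. -/
noncomputable def tailSolve (a : ℝ) (h : ℂ → ℂ) (ξ : ℂ) : ℂ :=
  (expTail 0 h ξ - expTail a h ξ) / a

variable {a : ℝ}

/-- The two boundary terms -h ξ cancel in the difference. Hence h reappears only at the second
derivative. -/
theorem hasDerivAt_tailSolve (hD : IsRightInvariant D) (hw : IsTailWeight μ G) (ha : 0 < a)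
    (hh : DifferentiableOn ℂ h D) (hbd : ∀ ξ ∈ D, ‖h ξ‖ ≤ μ ξ.re) {ξ : ℂ} (hξ : ξ ∈ D) :
    HasDerivAt (tailSolve a h) (-expTail a h ξ) ξ := by
  have h1 := hasDerivAt_expTail (b := 0) hD hw le_rfl hh hbd hξ
  have h2 := hasDerivAt_expTail (b := a) hD hw ha.le hh hbd hξ
  have ha' : (a : ℂ) ≠ 0 := by exact_mod_cast ha.ne'
  refine ((h1.fun_sub h2).div_const (a : ℂ)).congr_deriv ?_
  push_cast
  field_simp
  ring

theorem deriv_deriv_tailSolve (hD : IsRightInvariant D) (hw : IsTailWeight μ G) (ha : 0 < a)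
    (hh : DifferentiableOn ℂ h D) (hbd : ∀ ξ ∈ D, ‖h ξ‖ ≤ μ ξ.re) {ξ : ℂ} (hξ : ξ ∈ D) :
    deriv (deriv (tailSolve a h)) ξ = h ξ + a * deriv (tailSolve a h) ξ := by
  have h1 : deriv (tailSolve a h) =ᶠ[𝓝 ξ] fun z => -expTail a h z := by
    filter_upwards [hD.isOpen.mem_nhds hξ] with z hz
    exact (hasDerivAt_tailSolve hD hw ha hh hbd hz).deriv
  rw [h1.deriv_eq, h1.eq_of_nhds]
  rw [(hasDerivAt_expTail hD hw ha.le hh hbd hξ).fun_neg.deriv]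
  ring

theorem norm_tailSolve_le (hD : IsRightInvariant D) (hw : IsTailWeight μ G) (ha : 0 < a)
    (hbd : ∀ ξ ∈ D, ‖h ξ‖ ≤ μ ξ.re) {ξ : ℂ} (hξ : ξ ∈ D) :
    ‖tailSolve a h ξ‖ ≤ 2 / a * G ξ.re := by
  have h1 := norm_expTail_le (b := 0) hD hw le_rfl hbd hξ
  have h2 := norm_expTail_le (b := a) hD hw ha.le hbd hξ
  unfold tailSolve
  rw [norm_div, Complex.norm_real, Real.norm_eq_abs, abs_of_pos ha, div_mul_eq_mul_div]
  gcongr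
  linarith [norm_sub_le (expTail 0 h ξ) (expTail a h ξ)]

theorem differentiableOn_tailSolve (hD : IsRightInvariant D) (hw : IsTailWeight μ G)
    (ha : 0 < a) (hh : DifferentiableOn ℂ h D) (hbd : ∀ ξ ∈ D, ‖h ξ‖ ≤ μ ξ.re) :
    DifferentiableOn ℂ (tailSolve a h) D := fun _ hξ =>
  (hasDerivAt_tailSolve hD hw ha hh hbd hξ).differentiableAt.differentiableWithinAt

end ExpTail

end

/-! ### The Volterra equation w'' - a w' = q w + R from infinity -/

section

open Filter Set MeasureTheory

section Volterra

variable {D : Set ℂ} {μ G : ℝ → ℝ} {q R : ℂ → ℂ} {a K N : ℝ}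

/-- The source terms of the successive approximations of `w'' - a w' = q w + R`. -/
noncomputable def volterraSource (a : ℝ) (q R : ℂ → ℂ) : ℕ → ℂ → ℂ
  | 0 => R
  | n + 1 => fun ξ => q ξ * tailSolve a (volterraSource a q R n) ξ

/-- Each iteration applies `tailSolve`, which costs 2/a and turns μ Gⁿ into Gⁿ⁺¹/(n + 1), and then
multiplies by q, which costs K μ. -/
theorem volterraSource_bound (hD : IsRightInvariant D) (hw : IsTailWeight μ G) (ha : 0 < a)
    (hK : 0 ≤ K) (hN : 0 ≤ N) (hq : DifferentiableOn ℂ q D) (hR : DifferentiableOn ℂ R D)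
    (hqK : ∀ ξ ∈ D, ‖q ξ‖ ≤ K * μ ξ.re) (hRN : ∀ ξ ∈ D, ‖R ξ‖ ≤ N * μ ξ.re) (n : ℕ) :
    DifferentiableOn ℂ (volterraSource a q R n) D ∧
      ∀ ξ ∈ D, ‖volterraSource a q R n ξ‖
        ≤ N * (2 * K / a) ^ n / n.factorial * (μ ξ.re * G ξ.re ^ n) := by
  induction n with
  | zero => exact ⟨hR, by simpa [volterraSource] using hRN⟩
  | succ n ih =>
    have hC : 0 ≤ N * (2 * K / a) ^ n / n.factorial := by positivity
    have hwn := (hw.pow n).const_mul hC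
    refine ⟨hq.mul (differentiableOn_tailSolve hD hwn ha ih.1 ih.2), fun ξ hξ => ?_⟩
    have h1 := norm_tailSolve_le hD hwn ha ih.2 hξ
    have hμ := hw.nonneg ξ.re
    rw [volterraSource, norm_mul]
    refine (mul_le_mul (hqK ξ hξ) h1 (norm_nonneg _) (by positivity)).trans_eq ?_
    rw [Nat.factorial_succ, pow_succ (2 * K / a) n]
    push_cast
    field_simp

theorem summable_volterra_majorant (g : ℝ) :
    Summable fun n : ℕ => N * g * ((2 * K / a * g) ^ n / n.factorial) :=
  (Real.summable_pow_div_factorial _).mul_left _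

/-- Giving up the factor 1/(n + 1) and evaluating G further to the left yields a majorant uniform on
a half plane and summing to an exponential. -/
theorem volterra_majorant_le (hw : IsTailWeight μ G) (ha : 0 < a) (hK : 0 ≤ K) (hN : 0 ≤ N)
    {x y : ℝ} (hxy : x ≤ y) (n : ℕ) :
    N * (2 * K / a) ^ n / n.factorial * (G y ^ (n + 1) / (n + 1))
      ≤ N * G x * ((2 * K / a * G x) ^ n / n.factorial) := by
  have h0 := hw.tail_nonneg y
  have h1 := hw.tail_antitone hxy
  have h2 : G y ^ (n + 1) / (n + 1) ≤ G x ^ (n + 1) :=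
    (div_le_self (by positivity) (by linarith [n.cast_nonneg (α := ℝ)])).trans
      (pow_le_pow_left₀ h0 h1 _)
  calc _ ≤ N * (2 * K / a) ^ n / n.factorial * G x ^ (n + 1) := by gcongr
    _ = _ := by rw [mul_pow, pow_succ]; ring

/-- Solvability of `w'' - a w' = q w + R` from infinity. -/
theorem exists_volterra_solution (hD : IsRightInvariant D) (hw : IsTailWeight μ G) (ha : 0 < a)
    (hK : 0 ≤ K) (hN : 0 ≤ N) (hq : DifferentiableOn ℂ q D) (hR : DifferentiableOn ℂ R D)
    (hqK : ∀ ξ ∈ D, ‖q ξ‖ ≤ K * μ ξ.re) (hRN : ∀ ξ ∈ D, ‖R ξ‖ ≤ N * μ ξ.re) :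
    ∃ w : ℂ → ℂ, DifferentiableOn ℂ w D ∧
      (∀ ξ ∈ D, deriv (deriv w) ξ - a * deriv w ξ = q ξ * w ξ + R ξ) ∧
      ∀ ξ ∈ D, ‖w ξ‖ ≤ 2 / a * (N * G ξ.re * Real.exp (2 * K / a * G ξ.re)) := by
  set h := volterraSource a q R with hh
  have hb := volterraSource_bound hD hw ha hK hN hq hR hqK hRN
  have hwn : ∀ n : ℕ, IsTailWeight
      (fun x => N * (2 * K / a) ^ n / n.factorial * (μ x * G x ^ n))
      (fun x => N * (2 * K / a) ^ n / n.factorial * (G x ^ (n + 1) / (n + 1))) := fun n =>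
    (hw.pow n).const_mul (by positivity)
  have hJd : ∀ n, DifferentiableOn ℂ (tailSolve a (h n)) D := fun n =>
    differentiableOn_tailSolve hD (hwn n) ha (hb n).1 (hb n).2
  have hJb : ∀ n, ∀ ξ ∈ D, ∀ x ≤ ξ.re, ‖tailSolve a (h n) ξ‖
      ≤ 2 / a * (N * G x * ((2 * K / a * G x) ^ n / n.factorial)) := fun n ξ hξ x hx =>
    (norm_tailSolve_le hD (hwn n) ha (hb n).2 hξ).trans <| by
      have := volterra_majorant_le hw ha hK hN hx n
      gcongr
  have hEb : ∀ n, ∀ ξ ∈ D, ∀ x ≤ ξ.re, ‖deriv (tailSolve a (h n)) ξ‖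
      ≤ N * G x * ((2 * K / a * G x) ^ n / n.factorial) := fun n ξ hξ x hx => by
    rw [(hasDerivAt_tailSolve hD (hwn n) ha (hb n).1 (hb n).2 hξ).deriv, norm_neg]
    exact (norm_expTail_le hD (hwn n) ha.le (hb n).2 hξ).trans
      (volterra_majorant_le hw ha hK hN hx n)
  set w : ℂ → ℂ := fun ξ => ∑' n, tailSolve a (h n) ξ with hwdef
  -- G may be unbounded to the left, so the series is differentiated termwise only on the parts Re ξ
  -- > x of D.
  set V : ℝ → Set ℂ := fun x => D ∩ {ξ | x < ξ.re} with hV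
  have hVo : ∀ x, IsOpen (V x) := fun x =>
    hD.isOpen.inter (isOpen_lt continuous_const Complex.continuous_re)
  have hmem : ∀ ξ ∈ D, ξ ∈ V (ξ.re - 1) := fun ξ hξ => ⟨hξ, by simp⟩
  have hs : ∀ g : ℝ, Summable fun n : ℕ =>
      2 / a * (N * g * ((2 * K / a * g) ^ n / n.factorial)) := fun g =>
    (summable_volterra_majorant g).mul_left _
  have hd1 : ∀ x, ∀ ξ ∈ V x, HasSum (fun n => deriv (tailSolve a (h n)) ξ) (deriv w ξ) :=
    fun x ξ hξ => Complex.hasSum_deriv_of_summable_norm (hs (G x))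
      (fun n => (hJd n).mono inter_subset_left) (hVo x)
      (fun n z hz => hJb n z hz.1 x hz.2.le) hξ
  have hd2 : ∀ ξ ∈ D, HasSum (fun n => deriv (deriv (tailSolve a (h n))) ξ)
      (deriv (deriv w) ξ) := by
    intro ξ hξ
    have := Complex.hasSum_deriv_of_summable_norm (summable_volterra_majorant (G (ξ.re - 1)))
      (fun n => ((hJd n).deriv hD.isOpen).mono inter_subset_left) (hVo (ξ.re - 1))
      (fun n z hz => hEb n z hz.1 _ hz.2.le) (hmem ξ hξ)
    have he : (fun z => ∑' n, deriv (tailSolve a (h n)) z) =ᶠ[𝓝 ξ] deriv w := by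
      filter_upwards [(hVo _).mem_nhds (hmem ξ hξ)] with z hz
      exact (hd1 _ z hz).tsum_eq
    rwa [he.deriv_eq] at this
  have hwsum : ∀ ξ ∈ D, HasSum (fun n => tailSolve a (h n) ξ) (w ξ) := fun ξ hξ =>
    (Summable.of_norm_bounded (hs (G ξ.re)) fun n => hJb n ξ hξ _ le_rfl).hasSum
  refine ⟨w, fun ξ hξ => ?_, fun ξ hξ => ?_, fun ξ hξ => ?_⟩
  · have := Complex.differentiableOn_tsum_of_summable_norm (hs (G (ξ.re - 1)))
      (fun n => (hJd n).mono inter_subset_left) (hVo (ξ.re - 1))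
      (fun n z hz => hJb n z hz.1 _ hz.2.le)
    exact (this.differentiableAt ((hVo _).mem_nhds (hmem ξ hξ))).differentiableWithinAt
  · have h1 : HasSum (fun n => h n ξ) (deriv (deriv w) ξ - a * deriv w ξ) := by
      refine ((hd2 ξ hξ).sub ((hd1 _ ξ (hmem ξ hξ)).mul_left (a : ℂ))).congr_fun ?_
      intro n
      rw [deriv_deriv_tailSolve hD (hwn n) ha (hb n).1 (hb n).2 hξ]
      ring
    have h2 : HasSum (fun n => h n ξ) (q ξ * w ξ + R ξ) := by
      -- The zeroth source is R, and the later ones are q times the terms of the series for w.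
      rw [← hasSum_nat_add_iff' 1]
      simpa [hh, volterraSource] using (hwsum ξ hξ).mul_left (q ξ)
    exact h1.unique h2
  · have hexp : HasSum (fun n : ℕ => 2 / a * (N * G ξ.re * ((2 * K / a * G ξ.re) ^ n / n.factorial)))
        (2 / a * (N * G ξ.re * Real.exp (2 * K / a * G ξ.re))) := by
      refine HasSum.mul_left _ (HasSum.mul_left _ ?_)
      rw [Real.exp_eq_exp_ℝ]
      exact NormedSpace.expSeries_div_hasSum_exp _
    exact tsum_of_norm_bounded hexp fun n => hJb n ξ hξ _ le_rfl

/-- Solutions of the homogeneous equation that decay like the tail weight vanish. -/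
theorem eq_zero_of_volterra_homogeneous (hD : IsRightInvariant D) (hw : IsTailWeight μ G)
    (ha : 0 < a) (hK : 0 ≤ K) (hN : 0 ≤ N) (hq : DifferentiableOn ℂ q D)
    (hqK : ∀ ξ ∈ D, ‖q ξ‖ ≤ K * μ ξ.re) {d : ℂ → ℂ} (hd : DifferentiableOn ℂ d D)
    (hode : ∀ ξ ∈ D, deriv (deriv d) ξ - a * deriv d ξ = q ξ * d ξ)
    (hdN : ∀ ξ ∈ D, ‖d ξ‖ ≤ N * G ξ.re) : ∀ ξ ∈ D, d ξ = 0 := by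
  set h : ℂ → ℂ := fun ξ => q ξ * d ξ with hh
  have hhd : DifferentiableOn ℂ h D := hq.mul hd
  have hstep : ∀ C : ℝ, 0 ≤ C → ∀ n : ℕ, (∀ ξ ∈ D, ‖d ξ‖ ≤ C * G ξ.re ^ n) →
      ∀ ξ ∈ D, ‖h ξ‖ ≤ K * C * (μ ξ.re * G ξ.re ^ n) := fun C hC n hn ξ hξ => by
    rw [hh, norm_mul]
    have := hw.nonneg ξ.re
    calc ‖q ξ‖ * ‖d ξ‖ ≤ (K * μ ξ.re) * (C * G ξ.re ^ n) :=
          mul_le_mul (hqK ξ hξ) (hn ξ hξ) (norm_nonneg _) (by positivity)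
      _ = _ := by ring
  have hw1 := (hw.pow 1).const_mul (mul_nonneg hK hN)
  have hb1 := hstep N hN 1 (by simpa using hdN)
  -- The difference v satisfies v'' = a v' and tends to 0 along every ray; this leaves only v = 0.
  have hJ : ∀ ξ ∈ D, d ξ = tailSolve a h ξ := by
    set v : ℂ → ℂ := fun ξ => d ξ - tailSolve a h ξ with hv
    have hJd := differentiableOn_tailSolve hD hw1 ha hhd hb1
    have hvd : DifferentiableOn ℂ v D := hd.sub hJd
    have hvode : ∀ ξ ∈ D, deriv (deriv v) ξ = a * deriv v ξ := by
      intro ξ hξ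
      have hdv : ∀ z ∈ D, deriv v z = deriv d z - deriv (tailSolve a h) z := fun z hz =>
        deriv_fun_sub (hd.differentiableAt (hD.isOpen.mem_nhds hz))
          (hJd.differentiableAt (hD.isOpen.mem_nhds hz))
      have he : deriv v =ᶠ[𝓝 ξ] fun z => deriv d z - deriv (tailSolve a h) z := by
        filter_upwards [hD.isOpen.mem_nhds hξ] with z hz using hdv z hz
      rw [he.deriv_eq, hdv ξ hξ, deriv_fun_sub
        ((hd.deriv hD.isOpen).differentiableAt (hD.isOpen.mem_nhds hξ))
        ((hJd.deriv hD.isOpen).differentiableAt (hD.isOpen.mem_nhds hξ)),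
        deriv_deriv_tailSolve hD hw1 ha hhd hb1 hξ]
      linear_combination hode ξ hξ
    have hvb : ∀ ξ ∈ D, ‖v ξ‖ ≤ N * G ξ.re + 2 / a * (K * N * (G ξ.re ^ (1 + 1) / ((1 : ℕ) + 1))) :=
      fun ξ hξ => (norm_sub_le _ _).trans
        (add_le_add (hdN ξ hξ) (norm_tailSolve_le hD hw1 ha hb1 hξ))
    set B : ℝ → ℝ := fun x => N * G x + 2 / a * (K * N * (G x ^ (1 + 1) / ((1 : ℕ) + 1))) with hB
    have hBanti : Antitone B := fun x y hxy => by
      have h1 := hw.tail_antitone hxy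
      have h2 := hw1.tail_antitone hxy
      exact add_le_add (mul_le_mul_of_nonneg_left h1 hN)
        (mul_le_mul_of_nonneg_left h2 (by positivity))
    have hBlim : Tendsto B atTop (𝓝 0) := by
      have := (hw.tendsto.const_mul N).add (hw1.tendsto.const_mul (2 / a))
      simpa [hB] using this
    have hline : ∀ ξ : ℂ, Tendsto (fun t : ℝ => B (ξ.re + t)) atTop (𝓝 0) := fun ξ =>
      hBlim.comp (tendsto_atTop_add_const_left _ _ tendsto_id)
    have hat : ∀ k : ℂ → ℂ, DifferentiableOn ℂ k D → ∀ ξ ∈ D, ∀ t : ℝ, 0 ≤ t →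
        HasDerivAt (fun t : ℝ => k (ξ + t)) (deriv k (ξ + t)) t := fun k hk ξ hξ t ht => by
      have h3 := (hk.differentiableAt
        (hD.isOpen.mem_nhds (hD.add_mem ξ hξ t ht))).hasDerivAt
      have h4 : HasDerivAt (fun z : ℂ => k (ξ + z)) (deriv k (ξ + t)) (t : ℂ) :=
        h3.comp_const_add ξ (t : ℂ)
      exact h4.comp_ofReal
    have hvd0 : ∀ ξ ∈ D, deriv v ξ = 0 := by
      intro ξ hξ
      obtain ⟨r, hr, hball⟩ := Metric.isOpen_iff.1 hD.isOpen ξ hξ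
      -- Cauchy estimates with one fixed radius bound v' along the whole ray.
      have hbnd : ∀ t : ℝ, 0 ≤ t → ‖deriv v (ξ + t)‖ ≤ B (ξ.re - r / 2) / (r / 2) := by
        intro t ht
        have hsub : Metric.closedBall (ξ + t) (r / 2) ⊆ D := by
          intro u hu
          have : u - t ∈ D := by
            apply hball
            rw [mem_ball_iff_norm]
            rw [mem_closedBall_iff_norm] at hu
            calc ‖u - t - ξ‖ = ‖u - (ξ + t)‖ := by ring_nf
              _ < r := by linarith
          simpa using hD.add_mem _ this t ht
        refine (norm_deriv_le_of_closedBall_subset hBanti hvd hvb (by positivity) hsub).trans ?_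
        have : B ((ξ + t).re - r / 2) ≤ B (ξ.re - r / 2) := by
          apply hBanti
          simp only [Complex.add_re, Complex.ofReal_re]
          linarith
        gcongr
      -- This quantity is constant by the equation for v, and tends to 0 because v' is bounded.
      -- Hence v' vanishes at ξ.
      set e : ℝ → ℂ := fun t => (Real.exp (-a * t) : ℂ) * deriv v (ξ + t) with he
      have hed : ∀ t ∈ Ici (0 : ℝ), HasDerivAt e 0 t := by
        intro t ht
        have h1 : HasDerivAt (fun t : ℝ => ((Real.exp (-a * t) : ℝ) : ℂ))
            ((Real.exp (-a * t) * (-a * 1) : ℝ) : ℂ) t :=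
          (((hasDerivAt_id t).const_mul (-a)).exp).ofReal_comp
        refine (h1.fun_mul (hat _ (hvd.deriv hD.isOpen) ξ hξ t ht)).congr_deriv ?_
        rw [hvode _ (hD.add_mem ξ hξ t ht)]
        push_cast
        ring
      have hconst : ∀ t : ℝ, 0 ≤ t → e t = e 0 := fun t ht => by
        refine constant_of_has_deriv_right_zero (a := 0) (b := t)
          (fun x hx => (hed x hx.1).continuousAt.continuousWithinAt)
          (fun x hx => (hed x hx.1).hasDerivWithinAt) t ⟨ht, le_rfl⟩
      have hlim : Tendsto e atTop (𝓝 0) := by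
        have hexp : Tendsto (fun t : ℝ => Real.exp (-a * t) * (B (ξ.re - r / 2) / (r / 2)))
            atTop (𝓝 0) := by
          have : Tendsto (fun t : ℝ => Real.exp (-a * t)) atTop (𝓝 0) :=
            Real.tendsto_exp_atBot.comp (tendsto_id.const_mul_atTop_of_neg (by linarith))
          simpa using this.mul_const (B (ξ.re - r / 2) / (r / 2))
        refine squeeze_zero_norm' ?_ hexp
        filter_upwards [eventually_ge_atTop (0 : ℝ)] with t ht
        rw [he, norm_mul, Complex.norm_real, Real.norm_eq_abs, Real.abs_exp]
        exact mul_le_mul_of_nonneg_left (hbnd t ht) (Real.exp_pos _).le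
      have h0 : e 0 = 0 := by
        refine tendsto_nhds_unique (tendsto_const_nhds.congr' ?_) hlim
        filter_upwards [eventually_ge_atTop (0 : ℝ)] with t ht using (hconst t ht).symm
      simpa [he] using h0
    intro ξ hξ
    have hconst : ∀ t : ℝ, 0 ≤ t → v (ξ + t) = v (ξ + (0 : ℝ)) := fun t ht => by
      refine constant_of_has_deriv_right_zero (f := fun t : ℝ => v (ξ + t)) (a := 0) (b := t)
        (fun x hx => (hat v hvd ξ hξ x hx.1).continuousAt.continuousWithinAt)
        (fun x hx => ?_) t ⟨ht, le_rfl⟩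
      have := (hat v hvd ξ hξ x hx.1).hasDerivWithinAt (s := Ici x)
      rwa [hvd0 _ (hD.add_mem ξ hξ x hx.1)] at this
    have hlim : Tendsto (fun t : ℝ => v (ξ + t)) atTop (𝓝 0) := by
      refine squeeze_zero_norm' ?_ (hline ξ)
      filter_upwards [eventually_ge_atTop (0 : ℝ)] with t ht
      have := hvb _ (hD.add_mem ξ hξ t ht)
      simpa only [Complex.add_re, Complex.ofReal_re] using this
    have h0 : v ξ = 0 := by
      refine tendsto_nhds_unique (tendsto_const_nhds.congr' ?_) hlim
      filter_upwards [eventually_ge_atTop (0 : ℝ)] with t ht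
      simpa using (hconst t ht).symm
    exact sub_eq_zero.1 h0
  -- Feeding the bound into d = `tailSolve a (q d)` gains one power of G and one factor 1/(n + 1)
  -- each time, so d is smaller than every term of an exponential series.
  have hiter : ∀ n : ℕ, ∀ ξ ∈ D,
      ‖d ξ‖ ≤ N * (2 * K / a) ^ n / n.factorial * G ξ.re ^ (n + 1) := by
    intro n
    induction n with
    | zero => simpa using hdN
    | succ n ih =>
      intro ξ hξ
      have hC : 0 ≤ N * (2 * K / a) ^ n / n.factorial := by positivity
      have h0 := hstep _ hC (n + 1) ih
      have h1 := norm_tailSolve_le hD ((hw.pow (n + 1)).const_mul (mul_nonneg hK hC)) ha h0 hξ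
      rw [hJ ξ hξ]
      refine h1.trans ?_
      have hG := hw.tail_nonneg ξ.re
      rw [Nat.factorial_succ, pow_succ (2 * K / a) n]
      push_cast
      have : G ξ.re ^ (n + 1 + 1) / ((n : ℝ) + 1 + 1) ≤ G ξ.re ^ (n + 1 + 1) / ((n : ℝ) + 1) := by
        gcongr
        linarith
      calc _ ≤ 2 / a * (K * (N * (2 * K / a) ^ n / n.factorial)
            * (G ξ.re ^ (n + 1 + 1) / ((n : ℝ) + 1))) := by gcongr
        _ = _ := by field_simp
  intro ξ hξ
  have hlim : Tendsto (fun n : ℕ => N * G ξ.re * ((2 * K / a * G ξ.re) ^ n / n.factorial))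
      atTop (𝓝 0) := by
    simpa using (FloorSemiring.tendsto_pow_div_factorial_atTop
      (2 * K / a * G ξ.re)).const_mul (N * G ξ.re)
  have : ‖d ξ‖ ≤ 0 := ge_of_tendsto' hlim fun n => (hiter n ξ hξ).trans_eq (by
    rw [mul_pow, pow_succ]; ring)
  exact norm_le_zero_iff.1 this

end Volterra

end

/-! ### Power series in the weighted ℓ¹ norm and their recursions -/

section

open Filter

/-- `∑ ‖aₙ‖ ρⁿ` converges and is at most `N`. -/
def SeriesBound (ρ : ℝ) (a : ℕ → ℂ) (N : ℝ) : Prop :=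
  Summable (fun n => ‖a n‖ * ρ ^ n) ∧ ∑' n, ‖a n‖ * ρ ^ n ≤ N

/-- The sum of the power series with coefficients `a`. -/
noncomputable def powerSum (a : ℕ → ℂ) (z : ℂ) : ℂ := ∑' n, a n * z ^ n

/-- The coefficients of a product of power series. -/
def cauchyProd (a b : ℕ → ℂ) (n : ℕ) : ℂ :=
  ∑ kl ∈ Finset.HasAntidiagonal.antidiagonal n, a kl.1 * b kl.2

/-- The coefficients of the derivative of a power series. -/
def derivCoeff (a : ℕ → ℂ) (n : ℕ) : ℂ := (n + 1) * a (n + 1)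

namespace SeriesBound

variable {ρ M N : ℝ} {a b : ℕ → ℂ}

theorem nonneg (h : SeriesBound ρ a N) (hρ : 0 ≤ ρ) : 0 ≤ N :=
  (tsum_nonneg fun n => by positivity).trans h.2

theorem mono (h : SeriesBound ρ a N) (hN : N ≤ M) : SeriesBound ρ a M := ⟨h.1, h.2.trans hN⟩

theorem of_partial_sums (hρ : 0 ≤ ρ) (h : ∀ n, ∑ k ∈ Finset.range n, ‖a k‖ * ρ ^ k ≤ N) :
    SeriesBound ρ a N :=
  ⟨summable_of_sum_range_le (fun n => by positivity) h,
    Real.tsum_le_of_sum_range_le (fun n => by positivity) h⟩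

theorem norm_zero_le (h : SeriesBound ρ a N) (hρ : 0 ≤ ρ) : ‖a 0‖ ≤ N := by
  have := h.1.le_tsum 0 fun n _ => by positivity
  simp only [pow_zero, mul_one] at this
  exact this.trans h.2

theorem norm_term_le {z : ℂ} (hz : ‖z‖ ≤ ρ) (n : ℕ) : ‖a n * z ^ n‖ ≤ ‖a n‖ * ρ ^ n := by
  rw [norm_mul, norm_pow]
  gcongr

theorem summable (h : SeriesBound ρ a N) {z : ℂ} (hz : ‖z‖ ≤ ρ) :
    Summable fun n => a n * z ^ n :=
  Summable.of_norm_bounded h.1 (norm_term_le hz)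

theorem summable_norm (h : SeriesBound ρ a N) {z : ℂ} (hz : ‖z‖ ≤ ρ) :
    Summable fun n => ‖a n * z ^ n‖ :=
  Summable.of_nonneg_of_le (fun _ => norm_nonneg _) (norm_term_le hz) h.1

theorem norm_powerSum_le (h : SeriesBound ρ a N) {z : ℂ} (hz : ‖z‖ ≤ ρ) :
    ‖powerSum a z‖ ≤ N :=
  (tsum_of_norm_bounded h.1.hasSum (norm_term_le hz)).trans h.2

theorem add (ha : SeriesBound ρ a M) (hb : SeriesBound ρ b N) (hρ : 0 ≤ ρ) :
    SeriesBound ρ (fun n => a n + b n) (M + N) := by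
  have hle : ∀ n, ‖a n + b n‖ * ρ ^ n ≤ ‖a n‖ * ρ ^ n + ‖b n‖ * ρ ^ n := fun n => by
    rw [← add_mul]
    gcongr
    exact norm_add_le _ _
  have hs := Summable.of_nonneg_of_le (fun n => by positivity) hle (ha.1.add hb.1)
  refine ⟨hs, (hs.tsum_le_tsum hle (ha.1.add hb.1)).trans ?_⟩
  rw [ha.1.tsum_add hb.1]
  exact add_le_add ha.2 hb.2

theorem powerSum_add (ha : SeriesBound ρ a M) (hb : SeriesBound ρ b N) {z : ℂ} (hz : ‖z‖ ≤ ρ) :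
    powerSum (fun n => a n + b n) z = powerSum a z + powerSum b z := by
  unfold powerSum
  simp_rw [add_mul]
  exact (ha.summable hz).tsum_add (hb.summable hz)

theorem const_mul (ha : SeriesBound ρ a M) (k : ℂ) :
    SeriesBound ρ (fun n => k * a n) (‖k‖ * M) := by
  have : ∀ n, ‖k * a n‖ * ρ ^ n = ‖k‖ * (‖a n‖ * ρ ^ n) := fun n => by rw [norm_mul, mul_assoc]
  unfold SeriesBound
  simp_rw [this, tsum_mul_left]
  exact ⟨ha.1.mul_left _, mul_le_mul_of_nonneg_left ha.2 (norm_nonneg _)⟩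

theorem cauchyProd (ha : SeriesBound ρ a M) (hb : SeriesBound ρ b N) (hρ : 0 ≤ ρ) :
    SeriesBound ρ (cauchyProd a b) (M * N) := by
  have hle : ∀ n, ‖_root_.cauchyProd a b n‖ * ρ ^ n
      ≤ ∑ kl ∈ Finset.HasAntidiagonal.antidiagonal n, (‖a kl.1‖ * ρ ^ kl.1) * (‖b kl.2‖ * ρ ^ kl.2) := by
    intro n
    refine (mul_le_mul_of_nonneg_right (norm_sum_le _ _) (by positivity)).trans_eq ?_
    rw [Finset.sum_mul]
    refine Finset.sum_congr rfl fun kl hkl => ?_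
    rw [← Finset.HasAntidiagonal.mem_antidiagonal.1 hkl, norm_mul, pow_add]
    ring
  have hna : Summable fun n => ‖‖a n‖ * ρ ^ n‖ := ha.1.norm
  have hnb : Summable fun n => ‖‖b n‖ * ρ ^ n‖ := hb.1.norm
  have hs1 := (summable_norm_sum_mul_antidiagonal_of_summable_norm hna hnb).of_norm
  have hs := Summable.of_nonneg_of_le (fun n => by positivity) hle hs1
  refine ⟨hs, (hs.tsum_le_tsum hle hs1).trans ?_⟩
  rw [← tsum_mul_tsum_eq_tsum_sum_antidiagonal_of_summable_norm hna hnb]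
  exact mul_le_mul ha.2 hb.2 (tsum_nonneg fun n => by positivity) (ha.nonneg hρ)

theorem powerSum_cauchyProd (ha : SeriesBound ρ a M) (hb : SeriesBound ρ b N) {z : ℂ}
    (hz : ‖z‖ ≤ ρ) : powerSum (_root_.cauchyProd a b) z = powerSum a z * powerSum b z := by
  unfold powerSum
  rw [tsum_mul_tsum_eq_tsum_sum_antidiagonal_of_summable_norm (ha.summable_norm hz)
    (hb.summable_norm hz)]
  refine tsum_congr fun n => ?_
  unfold _root_.cauchyProd
  rw [Finset.sum_mul]
  refine Finset.sum_congr rfl fun kl hkl => ?_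
  rw [← Finset.HasAntidiagonal.mem_antidiagonal.1 hkl, pow_add]
  ring

theorem shift (h : SeriesBound ρ a N) (hρ : 0 < ρ) :
    SeriesBound ρ (fun n => a (n + 1)) (N / ρ) := by
  have hs : Summable fun n => ‖a (n + 1)‖ * ρ ^ (n + 1) :=
    (summable_nat_add_iff (f := fun n => ‖a n‖ * ρ ^ n) 1).2 h.1
  have he : ∀ n, ‖a (n + 1)‖ * ρ ^ n = ‖a (n + 1)‖ * ρ ^ (n + 1) / ρ := fun n => by
    rw [pow_succ]; field_simp
  unfold SeriesBound
  simp_rw [he]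
  refine ⟨hs.div_const _, ?_⟩
  rw [tsum_div_const]
  gcongr
  have h2 := h.2
  rw [h.1.tsum_eq_zero_add] at h2
  have : 0 ≤ ‖a 0‖ * ρ ^ 0 := by positivity
  linarith

theorem powerSum_eq_add (h : SeriesBound ρ a N) {z : ℂ} (hz : ‖z‖ ≤ ρ) :
    powerSum a z = a 0 + z * powerSum (fun n => a (n + 1)) z := by
  unfold powerSum
  rw [(h.summable hz).tsum_eq_zero_add, ← tsum_mul_left]
  simp only [pow_zero, mul_one]
  congr 1
  exact tsum_congr fun n => by ring

theorem norm_powerSum_sub_le (h : SeriesBound ρ a N) (hρ : 0 < ρ) {z : ℂ} (hz : ‖z‖ ≤ ρ) :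
    ‖powerSum a z - a 0‖ ≤ N / ρ * ‖z‖ := by
  rw [h.powerSum_eq_add hz, add_sub_cancel_left, norm_mul, mul_comm]
  exact mul_le_mul_of_nonneg_right ((h.shift hρ).norm_powerSum_le hz) (norm_nonneg _)

theorem hasSum_deriv (h : SeriesBound ρ a N) {z : ℂ} (hz : ‖z‖ < ρ) :
    HasSum (fun n => derivCoeff a n * z ^ n) (deriv (powerSum a) z) := by
  have := Complex.hasSum_deriv_of_summable_norm (U := Metric.ball 0 ρ) (z := z)
    (F := fun n z => a n * z ^ n) h.1 (fun n => by fun_prop) Metric.isOpen_ball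
    (fun n w hw => norm_term_le (mem_ball_zero_iff.1 hw).le n) (mem_ball_zero_iff.2 hz)
  rw [← hasSum_nat_add_iff' 1] at this
  have h0 : deriv (fun z : ℂ => a 0 * z ^ 0) z = 0 := by simp
  rw [Finset.sum_range_one, h0, sub_zero] at this
  refine this.congr_fun fun n => ?_
  rw [deriv_const_mul _ (by fun_prop), deriv_pow_field]
  unfold derivCoeff
  push_cast
  ring

theorem differentiableAt (h : SeriesBound ρ a N) {z : ℂ} (hz : ‖z‖ < ρ) :
    DifferentiableAt ℂ (powerSum a) z := by
  have := Complex.differentiableOn_tsum_of_summable_norm (U := Metric.ball 0 ρ)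
    (F := fun n z => a n * z ^ n) h.1 (fun n => by fun_prop) Metric.isOpen_ball
    (fun n w hw => norm_term_le (mem_ball_zero_iff.1 hw).le n)
  exact this.differentiableAt (Metric.isOpen_ball.mem_nhds (mem_ball_zero_iff.2 hz))

theorem hasDerivAt (h : SeriesBound ρ a N) {z : ℂ} (hz : ‖z‖ < ρ) :
    HasDerivAt (powerSum a) (powerSum (derivCoeff a) z) z := by
  unfold powerSum
  rw [(h.hasSum_deriv hz).tsum_eq]
  exact (h.differentiableAt hz).hasDerivAt

/-- The differentiated series converges absolutely at the real point r. A strictly smaller radius is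
the price of a derivative. -/
theorem derivCoeff (h : SeriesBound ρ a N) {r : ℝ} (hr : 0 ≤ r) (hrρ : r < ρ) :
    ∃ N', SeriesBound r (derivCoeff a) N' := by
  have hz : ‖(r : ℂ)‖ < ρ := by rwa [Complex.norm_real, Real.norm_of_nonneg hr]
  have := (h.hasSum_deriv hz).summable.norm
  refine ⟨_, ?_, le_rfl⟩
  refine this.congr fun n => ?_
  rw [norm_mul, norm_pow, Complex.norm_real, Real.norm_of_nonneg hr]

end SeriesBound

/-- A linear recursion `xₙ₊₁ = cₙ (∑ Wₙ₋ₖ xₖ) + eₙ`. -/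
theorem exists_recursion (F : (n : ℕ) → (ℕ → ℂ) → ℂ)
    (hF : ∀ n x y, (∀ k ≤ n, x k = y k) → F n x = F n y) (x₀ : ℂ) :
    ∃ x : ℕ → ℂ, x 0 = x₀ ∧ ∀ n, x (n + 1) = F n x := by
  -- The entries of `s n` up to index n are final; later updates touch only larger indices, so the
  -- diagonal solves the recursion.
  let s : ℕ → (ℕ → ℂ) := fun n => Nat.rec (fun _ => x₀)
    (fun n y => Function.update y (n + 1) (F n y)) n
  have hs : ∀ n, s (n + 1) = Function.update (s n) (n + 1) (F n (s n)) := fun n => rfl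
  have hst : ∀ m n k, k ≤ n → s (n + m) k = s n k := by
    intro m
    induction m with
    | zero => intro n k _; rfl
    | succ m ih =>
      intro n k hk
      rw [← add_assoc, hs, Function.update_of_ne (by omega), ih n k hk]
  refine ⟨fun n => s n n, rfl, fun n => ?_⟩
  show s (n + 1) (n + 1) = _
  rw [hs, Function.update_self]
  refine hF n _ _ fun k hk => ?_
  obtain ⟨m, rfl⟩ := Nat.exists_eq_add_of_le hk
  exact hst m k k le_rfl

theorem cauchyProd_congr {W x y : ℕ → ℂ} {n : ℕ} (h : ∀ k ≤ n, x k = y k) :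
    cauchyProd W x n = cauchyProd W y n :=
  Finset.sum_congr rfl fun kl hkl => by
    rw [h kl.2 (by have := Finset.HasAntidiagonal.mem_antidiagonal.1 hkl; omega)]

/-- The partial sums obey Sₙ₊₁ ≤ ‖x₀‖ + ρ M Sₙ + ρ N. With ρ M ≤ 1/2 the bound 2 (‖x₀‖ + ρ N)
reproduces itself, so smallness of ρ replaces any growth estimate on individual coefficients. -/
theorem exists_linear_recursion {ρ M N : ℝ} {W c e : ℕ → ℂ} (hρ : 0 < ρ)
    (hW : SeriesBound ρ W M) (hM : ρ * M ≤ 1 / 2) (hc : ∀ n, ‖c n‖ ≤ 1)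
    (he : SeriesBound ρ e N) (x₀ : ℂ) :
    ∃ x : ℕ → ℂ, x 0 = x₀ ∧ (∀ n, x (n + 1) = c n * cauchyProd W x n + e n) ∧
      SeriesBound ρ x (2 * (‖x₀‖ + ρ * N)) := by
  obtain ⟨x, hx0, hx⟩ := exists_recursion (fun n x => c n * cauchyProd W x n + e n)
    (fun n x y h => by rw [cauchyProd_congr h]) x₀
  refine ⟨x, hx0, hx, SeriesBound.of_partial_sums hρ.le fun n => ?_⟩
  induction n with
  | zero =>
    have := he.nonneg hρ.le
    simp only [Finset.range_zero, Finset.sum_empty]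
    positivity
  | succ n ih =>
    set S := ∑ k ∈ Finset.range n, ‖x k‖ * ρ ^ k with hS
    -- Truncation makes the Banach algebra bound available before x is known to be summable; the
    -- first n coefficients of the product are unaffected.
    let y : ℕ → ℂ := fun k => if k < n then x k else 0
    have hy : SeriesBound ρ y S := by
      have hf : ∀ k ∉ Finset.range n, ‖y k‖ * ρ ^ k = 0 := fun k hk => by
        simp only [Finset.mem_range] at hk
        simp [y, hk]
      refine ⟨summable_of_ne_finset_zero hf, ?_⟩
      rw [tsum_eq_sum hf]
      refine (Finset.sum_congr rfl fun k hk => ?_).le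
      simp only [Finset.mem_range] at hk
      simp [y, hk]
    have hWy := hW.cauchyProd hy hρ.le
    rw [Finset.sum_range_succ', hx0, pow_zero, mul_one]
    have hterm : ∀ k ∈ Finset.range n, ‖x (k + 1)‖ * ρ ^ (k + 1)
        ≤ ρ * (‖cauchyProd W y k‖ * ρ ^ k) + ρ * (‖e k‖ * ρ ^ k) := by
      intro k hk
      rw [Finset.mem_range] at hk
      rw [hx, cauchyProd_congr (y := y) fun j hj => by simp [y, lt_of_le_of_lt hj hk], pow_succ]
      have h1 : ‖c k * cauchyProd W y k + e k‖ ≤ ‖cauchyProd W y k‖ + ‖e k‖ := by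
        refine (norm_add_le _ _).trans ?_
        rw [norm_mul]
        nlinarith [hc k, norm_nonneg (cauchyProd W y k)]
      calc _ ≤ (‖cauchyProd W y k‖ + ‖e k‖) * (ρ ^ k * ρ) := by gcongr
        _ = _ := by ring
    refine (add_le_add_left (Finset.sum_le_sum hterm) _).trans ?_
    rw [Finset.sum_add_distrib, ← Finset.mul_sum, ← Finset.mul_sum]
    have h1 : ∑ k ∈ Finset.range n, ‖cauchyProd W y k‖ * ρ ^ k ≤ M * S :=
      (hWy.1.sum_le_tsum _ fun k _ => by positivity).trans hWy.2
    have h2 : ∑ k ∈ Finset.range n, ‖e k‖ * ρ ^ k ≤ N :=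
      (he.1.sum_le_tsum _ fun k _ => by positivity).trans he.2
    have hS0 : 0 ≤ S := Finset.sum_nonneg fun k _ => by positivity
    nlinarith

end

/-! ### The slit logarithm and series solutions at the singular point -/

section

open Filter

/-- The complement of `-i ℝ₊`. -/
def slitDomain : Set ℂ := {z | z.re ≠ 0 ∨ 0 < z.im}

theorem notMem_downRay_iff {yc z : ℂ} : z ∉ downRay yc ↔ z - yc ∈ slitDomain := by
  rw [downRay, slitDomain, Set.mem_ofPred_eq, Set.mem_ofPred_eq, not_iff_comm]
  constructor
  · intro h
    push Not at h
    refine ⟨yc.im - z.im, by simpa using h.2, ?_⟩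
    have := h.1
    apply Complex.ext <;> simp_all [sub_eq_zero]
  · rintro ⟨t, ht, rfl⟩
    simp [ht]

theorem isOpen_slitDomain : IsOpen slitDomain :=
  (isOpen_ne_fun Complex.continuous_re continuous_const).union
    (isOpen_lt continuous_const Complex.continuous_im)

theorem ne_zero_of_mem_slitDomain {z : ℂ} (hz : z ∈ slitDomain) : z ≠ 0 := by
  rintro rfl
  simp [slitDomain] at hz

theorem mul_mem_slitDomain {z : ℂ} (hz : z ∈ slitDomain) {t : ℝ} (ht : 0 < t) :
    (t : ℂ) * z ∈ slitDomain := by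
  rcases hz with h | h
  · left
    simpa [ht.ne'] using h
  · right
    simpa using mul_pos ht h

theorem neg_I_mul_mem_slitPlane {z : ℂ} (hz : z ∈ slitDomain) :
    -Complex.I * z ∈ Complex.slitPlane := by
  rw [Complex.mem_slitPlane_iff]
  rcases hz with h | h
  · right
    simpa using h
  · left
    simpa using h

theorem hasDerivAt_slitLog {z : ℂ} (hz : z ∈ slitDomain) : HasDerivAt slitLog z⁻¹ z := by
  have h1 : HasDerivAt (fun z : ℂ => -Complex.I * z) (-Complex.I * 1) z :=
    (hasDerivAt_id z).const_mul _
  have h2 := (h1.clog (neg_I_mul_mem_slitPlane hz)).add_const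
    (Complex.I * ((Real.pi / 2 : ℝ) : ℂ))
  refine h2.congr_deriv ?_
  have := ne_zero_of_mem_slitDomain hz
  have hI := Complex.I_ne_zero
  field_simp

theorem exp_slitLog {z : ℂ} (hz : z ≠ 0) : Complex.exp (slitLog z) = z := by
  unfold slitLog
  rw [Complex.exp_add, Complex.exp_log (mul_ne_zero (neg_ne_zero.2 Complex.I_ne_zero) hz)]
  have : Complex.exp (Complex.I * ((Real.pi / 2 : ℝ) : ℂ)) = Complex.I := by
    rw [mul_comm]
    push_cast
    exact Complex.exp_pi_div_two_mul_I
  rw [this]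
  linear_combination (-z) * Complex.I_mul_I

theorem slitLog_im (z : ℂ) : (slitLog z).im = (-Complex.I * z).arg + Real.pi / 2 := by
  simp [slitLog, Complex.log_im]

theorem slitLog_re (z : ℂ) : (slitLog z).re = Real.log ‖z‖ := by
  simp [slitLog, Complex.log_re]

theorem slitLog_im_mem {z : ℂ} (hz : z ∈ slitDomain) :
    -(Real.pi / 2) < (slitLog z).im ∧ (slitLog z).im < 3 * Real.pi / 2 := by
  have h1 := Complex.neg_pi_lt_arg (-Complex.I * z)
  have h2 := (Complex.arg_le_pi (-Complex.I * z)).lt_of_ne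
    (Complex.mem_slitPlane_iff_arg.1 (neg_I_mul_mem_slitPlane hz)).1
  rw [slitLog_im]
  constructor <;> linarith

theorem exp_mem_slitDomain {w : ℂ} (h1 : -(Real.pi / 2) < w.im) (h2 : w.im < 3 * Real.pi / 2) :
    Complex.exp w ∈ slitDomain := by
  have hpos := Real.exp_pos w.re
  rcases lt_trichotomy w.im (Real.pi / 2) with h | h | h
  · left
    rw [Complex.exp_re]
    exact mul_ne_zero hpos.ne' (Real.cos_pos_of_mem_Ioo ⟨h1, h⟩).ne'
  · right
    rw [Complex.exp_im, h, Real.sin_pi_div_two]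
    linarith
  · left
    rw [Complex.exp_re]
    refine mul_ne_zero hpos.ne' (Real.cos_neg_of_pi_div_two_lt_of_lt h ?_).ne
    linarith

/-- The argument is below 3π/2 < 5 in modulus. For r ≤ 1, r |log r| ≤ 2 √r by applying log x ≤ x - 1
to x = 1/√r; for r ≥ 1, r log r ≤ r². The constant is 7 = 2 + 5. -/
theorem norm_mul_slitLog_le {z : ℂ} (hz : z ∈ slitDomain) :
    ‖z‖ * ‖slitLog z‖ ≤ 7 * (√‖z‖ + ‖z‖ ^ 2) := by
  have hr : 0 < ‖z‖ := norm_pos_iff.2 (ne_zero_of_mem_slitDomain hz)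
  set r := ‖z‖ with hrdef
  have him := slitLog_im_mem hz
  have hL : ‖slitLog z‖ ≤ |Real.log r| + 5 := by
    refine (Complex.norm_le_abs_re_add_abs_im _).trans ?_
    rw [slitLog_re]
    have := Real.pi_lt_d2
    have : |(slitLog z).im| ≤ 5 := abs_le.2 ⟨by linarith, by linarith⟩
    linarith
  have hs : 0 < √r := Real.sqrt_pos.2 hr
  have hss : √r * √r = r := Real.mul_self_sqrt hr.le
  have hlog : r * |Real.log r| ≤ 2 * √r + r ^ 2 := by
    rcases le_total 1 r with h1 | h1
    · rw [abs_of_nonneg (Real.log_nonneg h1)]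
      have := Real.log_le_sub_one_of_pos hr
      nlinarith
    · rw [abs_of_nonpos (Real.log_nonpos hr.le h1)]
      have h2 : -Real.log r = 2 * Real.log (√r)⁻¹ := by
        rw [Real.log_inv, Real.log_sqrt hr.le]; ring
      have h3 := Real.log_le_sub_one_of_pos (inv_pos.2 hs)
      have h4 : r * (√r)⁻¹ = √r := by field_simp; nlinarith
      rw [h2]
      nlinarith [sq_nonneg r]
  have h5 : r ≤ √r + r ^ 2 := by
    rcases le_total 1 r with h1 | h1
    · nlinarith
    · have : √r ≤ 1 := Real.sqrt_le_one.2 h1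
      nlinarith [sq_nonneg r]
  nlinarith

section LocalSolution

variable {ρ : ℝ}

/-- The function `P(Y) + Y log Y Q(Y)`. -/
noncomputable def logSum (a b : ℕ → ℂ) (Y : ℂ) : ℂ :=
  powerSum a Y + Y * slitLog Y * powerSum b Y

theorem norm_logSum_sub_le {a b : ℕ → ℂ} {M N : ℝ} (hρ : 0 < ρ) (ha : SeriesBound ρ a M)
    (hb : SeriesBound ρ b N) {Y : ℂ} (hY : Y ∈ slitDomain) (hYρ : ‖Y‖ ≤ ρ) :
    ‖logSum a b Y - a 0‖ ≤ M / ρ * ‖Y‖ + 7 * N * (√‖Y‖ + ‖Y‖ ^ 2) := by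
  have h1 := ha.norm_powerSum_sub_le hρ hYρ
  have h2 := hb.norm_powerSum_le hYρ
  have h3 := norm_mul_slitLog_le hY
  have h4 : ‖Y * slitLog Y * powerSum b Y‖ ≤ 7 * (√‖Y‖ + ‖Y‖ ^ 2) * N := by
    rw [norm_mul, norm_mul]
    exact mul_le_mul h3 h2 (norm_nonneg _) (by positivity)
  have : logSum a b Y - a 0 = (powerSum a Y - a 0) + Y * slitLog Y * powerSum b Y := by
    unfold logSum; ring
  rw [this]
  refine (norm_add_le _ _).trans ?_
  linarith

theorem analyticAt_slitLog {Y : ℂ} (hY : Y ∈ slitDomain) : AnalyticAt ℂ slitLog Y := by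
  have : DifferentiableOn ℂ slitLog slitDomain := fun z hz =>
    (hasDerivAt_slitLog hz).differentiableAt.differentiableWithinAt
  exact this.analyticAt (isOpen_slitDomain.mem_nhds hY)

theorem SeriesBound.analyticAt {a : ℕ → ℂ} {N : ℝ} (h : SeriesBound ρ a N) {z : ℂ}
    (hz : ‖z‖ < ρ) : AnalyticAt ℂ (powerSum a) z := by
  have : DifferentiableOn ℂ (powerSum a) (Metric.ball 0 ρ) := fun w hw =>
    (h.differentiableAt (mem_ball_zero_iff.1 hw)).differentiableWithinAt
  exact this.analyticAt (Metric.isOpen_ball.mem_nhds (mem_ball_zero_iff.2 hz))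

theorem analyticAt_logSum {a b : ℕ → ℂ} {M N : ℝ} (ha : SeriesBound ρ a M)
    (hb : SeriesBound ρ b N) {Y : ℂ} (hY : Y ∈ slitDomain) (hYρ : ‖Y‖ < ρ) :
    AnalyticAt ℂ (logSum a b) Y :=
  (ha.analyticAt hYρ).add ((analyticAt_id.mul (analyticAt_slitLog hY)).mul (hb.analyticAt hYρ))

/-- The factor Y clears the pole of (Y log Y)''. The outcome is split into a part free of the
logarithm and a multiple of Y log Y, so the equation can be met by treating the two parts
separately. -/
theorem deriv_deriv_logSum {a b : ℕ → ℂ} {M N : ℝ} (ha : SeriesBound ρ a M)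
    (hb : SeriesBound ρ b N) {Y : ℂ} (hY : Y ∈ slitDomain) (hYρ : ‖Y‖ < ρ) :
    Y * deriv (deriv (logSum a b)) Y
      = Y * powerSum (derivCoeff (derivCoeff a)) Y + powerSum b Y
        + 2 * Y * powerSum (derivCoeff b) Y
        + Y * slitLog Y * (2 * powerSum (derivCoeff b) Y
            + Y * powerSum (derivCoeff (derivCoeff b)) Y) := by
  obtain ⟨r, hYr, hrρ⟩ := exists_between hYρ
  have hr0 : 0 ≤ r := (norm_nonneg _).trans hYr.le
  obtain ⟨M', ha'⟩ := ha.derivCoeff hr0 hrρ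
  obtain ⟨N', hb'⟩ := hb.derivCoeff hr0 hrρ
  have h1 : ∀ z ∈ slitDomain, ‖z‖ < r → HasDerivAt (logSum a b)
      (powerSum (derivCoeff a) z + ((slitLog z + 1) * powerSum b z
        + z * slitLog z * powerSum (derivCoeff b) z)) z := by
    intro z hz hzr
    have hz0 := ne_zero_of_mem_slitDomain hz
    have hA := ha.hasDerivAt (hzr.trans hrρ)
    have hB := hb.hasDerivAt (hzr.trans hrρ)
    have hL := (hasDerivAt_id z).fun_mul (hasDerivAt_slitLog hz)
    refine (hA.fun_add (hL.fun_mul hB)).congr_deriv ?_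
    simp only [id]
    field_simp
  have hev : deriv (logSum a b) =ᶠ[𝓝 Y] fun z =>
      powerSum (derivCoeff a) z + ((slitLog z + 1) * powerSum b z
        + z * slitLog z * powerSum (derivCoeff b) z) := by
    filter_upwards [isOpen_slitDomain.mem_nhds hY,
      Metric.isOpen_ball.mem_nhds (mem_ball_zero_iff.2 hYr)] with z hz hzr
    exact (h1 z hz (mem_ball_zero_iff.1 hzr)).deriv
  have hY0 := ne_zero_of_mem_slitDomain hY
  have hA' := ha'.hasDerivAt hYr
  have hB := hb.hasDerivAt hYρ
  have hB' := hb'.hasDerivAt hYr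
  have hL := hasDerivAt_slitLog hY
  have h2 := hA'.fun_add (((hL.add_const 1).fun_mul hB).fun_add
    (((hasDerivAt_id Y).fun_mul hL).fun_mul hB'))
  have h3 := h2.deriv
  rw [hev.deriv_eq]
  simp only [id] at h3
  rw [h3]
  field_simp
  ring

/-- Existence of local solutions of `Y φ'' = W φ + k f` of the form `P + Y log Y Q`. -/
theorem exists_local_solution {Wc kc : ℕ → ℂ} {Wb Kb : ℝ} (hρ : 0 < ρ)
    (hW : SeriesBound ρ Wc Wb) (hWb : ρ * Wb ≤ 1 / 2) (hk : SeriesBound ρ kc Kb) :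
    ∃ C : ℝ, 0 < C ∧ ∀ (N : ℝ) (a b : ℕ → ℂ), SeriesBound ρ a N → SeriesBound ρ b N →
      ∀ p₀ p₁ : ℂ, ‖p₀‖ ≤ N → ‖p₁‖ ≤ N → ∃ p q : ℕ → ℂ,
        p 0 = p₀ ∧ p 1 = p₁ ∧ q 0 = Wc 0 * p₀ + kc 0 * a 0 ∧
        SeriesBound ρ p (C * N) ∧ SeriesBound ρ q (C * N) ∧
        ∀ Y ∈ slitDomain, ‖Y‖ < ρ → Y * deriv (deriv (logSum p q)) Y
          = powerSum Wc Y * logSum p q Y + powerSum kc Y * logSum a b Y := by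
  have hWb0 := hW.nonneg hρ.le
  have hKb0 := hk.nonneg hρ.le
  set Cq : ℝ := 2 * ((Wb + Kb) + ρ * Kb) with hCq
  set Cp : ℝ := 2 * (1 + ρ * (Kb + 2 * Cq + 1)) with hCp
  have hCq0 : 0 ≤ Cq := by positivity
  have hCp0 : 0 ≤ Cp := by positivity
  refine ⟨Cq + Cp + 1, by positivity, fun N a b ha hb p₀ p₁ hp₀ hp₁ => ?_⟩
  have hN := ha.nonneg hρ.le
  have hA := hk.cauchyProd ha hρ.le
  have hB := hk.cauchyProd hb hρ.le
  have hscale : ∀ (c x : ℕ → ℂ) (M : ℝ), (∀ n, ‖c n‖ ≤ 1) → SeriesBound ρ x M →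
      SeriesBound ρ (fun n => c n * x n) M := fun c x M hc hx => by
    have hle : ∀ n, ‖c n * x n‖ * ρ ^ n ≤ ‖x n‖ * ρ ^ n := fun n => by
      rw [norm_mul]
      have := hc n
      have : ‖c n‖ * ‖x n‖ ≤ 1 * ‖x n‖ := by gcongr
      rw [one_mul] at this
      gcongr
    have hs := Summable.of_nonneg_of_le (fun n => by positivity) hle hx.1
    exact ⟨hs, (hs.tsum_le_tsum hle hx.1).trans hx.2⟩
  -- The Y log Y part reads (n + 1)(n + 2) qₙ₊₁ = (W q)ₙ + (k b)ₙ.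
  set c₁ : ℕ → ℂ := fun n => 1 / (((n : ℂ) + 1) * (n + 2)) with hc₁
  have hc₁n : ∀ n, ‖c₁ n‖ ≤ 1 := fun n => by
    have h : ‖((n : ℂ) + 1) * (n + 2)‖ = ((n : ℝ) + 1) * (n + 2) := by
      have : ((n : ℂ) + 1) * (n + 2) = (((n + 1) * (n + 2) : ℕ) : ℂ) := by push_cast; ring
      rw [this, Complex.norm_natCast]; push_cast; ring
    rw [hc₁]
    simp only
    rw [norm_div, norm_one, h]
    exact div_le_one_of_le₀ (by nlinarith [n.cast_nonneg (α := ℝ)]) (by positivity)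
  -- The value of q₀ is forced by the constant term of the logarithm-free part.
  obtain ⟨q, hq0, hq, hqb⟩ := exists_linear_recursion hρ hW hWb hc₁n
    (hscale c₁ _ _ hc₁n hB) (Wc 0 * p₀ + kc 0 * a 0)
  have hq0n : ‖Wc 0 * p₀ + kc 0 * a 0‖ ≤ (Wb + Kb) * N := by
    refine (norm_add_le _ _).trans ?_
    rw [norm_mul, norm_mul, add_mul]
    have h1 := hW.norm_zero_le hρ.le
    have h2 := hk.norm_zero_le hρ.le
    have h3 := ha.norm_zero_le hρ.le
    gcongr
  have hqb' : SeriesBound ρ q (Cq * N) := hqb.mono (by rw [hCq]; nlinarith)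
  -- The logarithm-free part reads n (n + 1) pₙ₊₁ + (2n + 1) qₙ = (W p)ₙ + (k a)ₙ. It says nothing
  -- about p₁ when n = 0, so the coefficients are set to 0 there and p₁ enters through `δ`.
  set c₂ : ℕ → ℂ := fun n => if n = 0 then 0 else 1 / ((n : ℂ) * (n + 1)) with hc₂
  have hc₂n : ∀ n, ‖c₂ n‖ ≤ 1 := fun n => by
    rcases n with _ | n
    · simp [hc₂]
    · have := hc₁n n
      simp only [hc₂, hc₁, Nat.add_eq_zero_iff, one_ne_zero, and_false, if_false] at this ⊢
      push_cast
      convert this using 4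
      ring
  -- At n = 1 the quotient (2n + 1)/(n (n + 1)) is 3/2; halving keeps it at most 1, and the factor
  -- -2 below restores it.
  set c₃ : ℕ → ℂ := fun n => if n = 0 then 0 else (2 * n + 1) / ((n : ℂ) * (n + 1)) / 2 with hc₃
  have hc₃n : ∀ n, ‖c₃ n‖ ≤ 1 := fun n => by
    rcases n with _ | n
    · simp [hc₃]
    · have h : c₃ (n + 1) = (((2 * (n + 1) + 1 : ℕ) : ℂ)) / (((n + 1) * (n + 2) : ℕ) : ℂ) / 2 := by
        simp only [hc₃, Nat.add_eq_zero_iff, one_ne_zero, and_false, if_false]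
        push_cast
        ring
      rw [h, norm_div, norm_div, Complex.norm_natCast, Complex.norm_natCast, Complex.norm_ofNat,
        div_div]
      refine div_le_one_of_le₀ ?_ (by positivity)
      push_cast
      nlinarith [n.cast_nonneg (α := ℝ)]
  set δ : ℕ → ℂ := fun n => if n = 0 then p₁ else 0 with hδ
  have hδb : SeriesBound ρ δ N := by
    have hf : ∀ k ∉ Finset.range 1, ‖δ k‖ * ρ ^ k = 0 := fun k hk => by
      simp only [Finset.mem_range, Nat.lt_one_iff] at hk
      simp [hδ, hk]
    refine ⟨summable_of_ne_finset_zero hf, ?_⟩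
    rw [tsum_eq_sum hf]
    simpa [hδ] using hp₁
  have hqs := (hscale c₃ _ _ hc₃n hqb').const_mul (-2)
  have he := ((hscale c₂ _ _ hc₂n hA).add hqs hρ.le).add hδb hρ.le
  obtain ⟨p, hp0, hp, hpb⟩ := exists_linear_recursion hρ hW hWb hc₂n he p₀
  have hpb' : SeriesBound ρ p (Cp * N) := by
    refine hpb.mono ?_
    rw [norm_neg, Complex.norm_ofNat, hCp]
    nlinarith
  refine ⟨p, q, hp0, ?_, hq0, hpb'.mono (by nlinarith), hqb'.mono (by nlinarith), ?_⟩
  · have := hp 0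
    simpa [hc₂, hc₃, hδ] using this
  intro Y hY hYρ
  have hqrec : ∀ n : ℕ, ((n : ℂ) + 1) * (n + 2) * q (n + 1)
      = cauchyProd Wc q n + cauchyProd kc b n := fun n => by
    have h1 : (n : ℂ) + 1 ≠ 0 := by exact_mod_cast n.succ_ne_zero
    have h2 : (n : ℂ) + 2 ≠ 0 := by exact_mod_cast (n + 1).succ_ne_zero
    rw [hq n]
    simp only [hc₁]
    field_simp
  have hprec : ∀ n : ℕ, (n : ℂ) * (n + 1) * p (n + 1) + (2 * n + 1) * q n
      = cauchyProd Wc p n + cauchyProd kc a n := fun n => by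
    rcases n with _ | n
    · simp [cauchyProd, hq0, hp0]
    · have h1 : (n : ℂ) + 1 ≠ 0 := by exact_mod_cast n.succ_ne_zero
      have h2 : (n : ℂ) + 1 + 1 ≠ 0 := by exact_mod_cast (n + 1).succ_ne_zero
      rw [hp (n + 1)]
      simp only [hc₂, hc₃, hδ, Nat.add_eq_zero_iff, one_ne_zero, and_false, if_false]
      push_cast
      field_simp
      ring
  -- Two derivatives cost two successive losses of radius.
  obtain ⟨r, hYr, hrρ⟩ := exists_between hYρ
  have hr0 : 0 ≤ r := (norm_nonneg _).trans hYr.le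
  obtain ⟨r', hrr', hr'ρ⟩ := exists_between hrρ
  have hr'0 : 0 ≤ r' := hr0.trans hrr'.le
  obtain ⟨_, hp1⟩ := hpb'.derivCoeff hr'0 hr'ρ
  obtain ⟨_, hp2⟩ := hp1.derivCoeff hr0 hrr'
  obtain ⟨_, hq1⟩ := hqb'.derivCoeff hr'0 hr'ρ
  obtain ⟨_, hq2⟩ := hq1.derivCoeff hr0 hrr'
  have hYr' := hYr.trans hrr'
  have hmulY : ∀ (x : ℕ → ℂ) (R M : ℝ), SeriesBound R x M → ‖Y‖ ≤ R →
      HasSum (fun n => (if n = 0 then 0 else x (n - 1)) * Y ^ n) (Y * powerSum x Y) := by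
    intro x R M hx hYR
    rw [← hasSum_nat_add_iff' 1]
    have := ((hx.summable hYR).hasSum).mul_left Y
    simpa [powerSum, pow_succ, mul_assoc, mul_comm, mul_left_comm] using this
  have hser : ∀ (x : ℕ → ℂ) (R M : ℝ), SeriesBound R x M → ‖Y‖ ≤ R →
      HasSum (fun n => x n * Y ^ n) (powerSum x Y) := fun x R M hx hYR =>
    (hx.summable hYR).hasSum
  have hQ : 2 * powerSum (derivCoeff q) Y + Y * powerSum (derivCoeff (derivCoeff q)) Y
      = powerSum Wc Y * powerSum q Y + powerSum kc Y * powerSum b Y := by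
    rw [← hW.powerSum_cauchyProd hqb' hYρ.le, ← hk.powerSum_cauchyProd hb hYρ.le]
    refine (((hser _ _ _ hq1 hYr'.le).mul_left 2).add (hmulY _ _ _ hq2 hYr.le)).unique ?_
    refine ((hser _ _ _ (hW.cauchyProd hqb' hρ.le) hYρ.le).add
      (hser _ _ _ hB hYρ.le)).congr_fun fun n => ?_
    rw [← add_mul, ← hqrec]
    rcases n with _ | n
    · simp [derivCoeff]
    · simp only [derivCoeff, Nat.add_eq_zero_iff, one_ne_zero, and_false, if_false,
        Nat.add_sub_cancel]
      push_cast
      ring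
  have hP : Y * powerSum (derivCoeff (derivCoeff p)) Y + powerSum q Y
        + 2 * Y * powerSum (derivCoeff q) Y
      = powerSum Wc Y * powerSum p Y + powerSum kc Y * powerSum a Y := by
    rw [← hW.powerSum_cauchyProd hpb' hYρ.le, ← hk.powerSum_cauchyProd ha hYρ.le, mul_assoc]
    refine (((hmulY _ _ _ hp2 hYr.le).add (hser _ _ _ hqb' hYρ.le)).add
      ((hmulY _ _ _ hq1 hYr'.le).mul_left 2)).unique ?_
    refine ((hser _ _ _ (hW.cauchyProd hpb' hρ.le) hYρ.le).add
      (hser _ _ _ hA hYρ.le)).congr_fun fun n => ?_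
    rw [← add_mul (cauchyProd Wc p n), ← hprec]
    rcases n with _ | n
    · simp
    · simp only [derivCoeff, Nat.add_eq_zero_iff, one_ne_zero, and_false, if_false,
        Nat.add_sub_cancel]
      push_cast
      ring
  rw [deriv_deriv_logSum hpb' hqb' hY hYρ]
  unfold logSum
  linear_combination hP + Y * slitLog Y * hQ

end LocalSolution

end

/-! ### From the singular point to infinity by ξ = -log Y -/

section

open Filter

/-- The weight `√r + r⁴`. -/
noncomputable def radialWeight (r : ℝ) : ℝ := √r + r ^ 4

/-- The majorant `2 √r + r⁴ / 4` of `∫₀^r radialWeight s / s ds`. -/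
noncomputable def radialTail (r : ℝ) : ℝ := 2 * √r + r ^ 4 / 4

/-- In r = exp (-x) the derivative in x is -r d/dr, which takes 2 √r + r⁴/4 to -(√r + r⁴). The term
√r absorbs Y log Y near the centre, and r⁴ the polynomial growth far away. -/
theorem isTailWeight_radial :
    IsTailWeight (fun x => radialWeight (Real.exp (-x))) (fun x => radialTail (Real.exp (-x))) := by
  have hs : ∀ x : ℝ, √(Real.exp (-x)) = Real.exp (-x / 2) := fun x => by
    rw [Real.exp_half]
  have hp : ∀ x : ℝ, Real.exp (-x) ^ 4 = Real.exp (-4 * x) := fun x => by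
    rw [← Real.exp_nat_mul]; congr 1; push_cast; ring
  have hx : Tendsto (fun x : ℝ => Real.exp (-x)) atTop (𝓝 0) :=
    Real.tendsto_exp_neg_atTop_nhds_zero
  refine ⟨fun x y hxy => ?_, fun x => by unfold radialWeight; positivity, fun x => ?_, ?_⟩
  · have : Real.exp (-y) ≤ Real.exp (-x) := Real.exp_le_exp.2 (by linarith)
    simp only [radialWeight]
    gcongr
  · simp only [radialWeight, radialTail, hs, hp]
    have h1 : HasDerivAt (fun x : ℝ => Real.exp (-x / 2)) (Real.exp (-x / 2) * (-1 / 2)) x :=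
      (((hasDerivAt_id x).neg).div_const 2).exp
    have h2 : HasDerivAt (fun x : ℝ => Real.exp (-4 * x)) (Real.exp (-4 * x) * (-4 * 1)) x :=
      ((hasDerivAt_id x).const_mul (-4)).exp
    refine ((h1.const_mul 2).fun_add (h2.div_const 4)).congr_deriv ?_
    ring
  · have h1 : Tendsto (fun x : ℝ => √(Real.exp (-x))) atTop (𝓝 0) := by
      simpa using hx.sqrt
    have := (h1.const_mul 2).add ((hx.pow 4).div_const 4)
    simpa [radialTail] using this

theorem norm_exp_neg (ξ : ℂ) : ‖Complex.exp (-ξ)‖ = Real.exp (-ξ.re) := by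
  rw [Complex.norm_exp, Complex.neg_re]

theorem exp_neg_add_ofReal (ξ : ℂ) (t : ℝ) :
    Complex.exp (-(ξ + t)) = (Real.exp (-t) : ℂ) * Complex.exp (-ξ) := by
  rw [neg_add, Complex.exp_add, mul_comm]
  push_cast
  rfl

/-- The domain of the variable `ξ = -log Y`, for `Y` in `D`. -/
def logDomain (D : Set ℂ) : Set ℂ :=
  {ξ | -(3 * Real.pi / 2) < ξ.im ∧ ξ.im < Real.pi / 2 ∧ Complex.exp (-ξ) ∈ D}

/-- Moving ξ to the right by t multiplies Y by exp (-t), so star-shapedness about 0 becomes right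
invariance. -/
theorem isRightInvariant_logDomain {D : Set ℂ} (hD : IsOpen D)
    (hstar : ∀ Y ∈ D, ∀ t : ℝ, 0 < t → t ≤ 1 → (t : ℂ) * Y ∈ D) :
    IsRightInvariant (logDomain D) where
  isOpen := by
    refine (isOpen_lt continuous_const Complex.continuous_im).inter
      ((isOpen_lt Complex.continuous_im continuous_const).inter (hD.preimage ?_))
    fun_prop
  add_mem := fun ξ hξ t ht => by
    refine ⟨by simpa using hξ.1, by simpa using hξ.2.1, ?_⟩
    rw [exp_neg_add_ofReal]
    exact hstar _ hξ.2.2 _ (Real.exp_pos _) (Real.exp_le_one_iff.2 (by linarith))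

theorem exp_neg_mem_slitDomain {D : Set ℂ} {ξ : ℂ} (hξ : ξ ∈ logDomain D) :
    Complex.exp (-ξ) ∈ slitDomain := by
  refine exp_mem_slitDomain ?_ ?_ <;> rw [Complex.neg_im] <;> linarith [hξ.1, hξ.2.1]

theorem neg_slitLog_mem_logDomain {D : Set ℂ} {Y : ℂ} (hY : Y ∈ slitDomain) (hYD : Y ∈ D) :
    -slitLog Y ∈ logDomain D := by
  have h := slitLog_im_mem hY
  refine ⟨?_, ?_, ?_⟩
  · rw [Complex.neg_im]; linarith
  · rw [Complex.neg_im]; linarith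
  · rwa [neg_neg, exp_slitLog (ne_zero_of_mem_slitDomain hY)]

/-- For u = Y w(-log Y) one has Y u'' = w'' - w'. The singular equation for u thereby becomes the
Volterra equation for w with a = 1. -/
theorem hasDerivAt_mul_comp_neg_slitLog {D' : Set ℂ} (hD' : IsOpen D') {w : ℂ → ℂ}
    (hw : DifferentiableOn ℂ w D') {Y : ℂ} (hY : Y ∈ slitDomain) (hYD : -slitLog Y ∈ D') :
    HasDerivAt (fun Y => Y * w (-slitLog Y)) (w (-slitLog Y) - deriv w (-slitLog Y)) Y ∧
    deriv (deriv fun Y => Y * w (-slitLog Y)) Y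
      = (deriv (deriv w) (-slitLog Y) - deriv w (-slitLog Y)) / Y := by
  have hcomp : ∀ (k : ℂ → ℂ), DifferentiableOn ℂ k D' → ∀ z ∈ slitDomain, -slitLog z ∈ D' →
      HasDerivAt (fun z => k (-slitLog z)) (deriv k (-slitLog z) * -z⁻¹) z :=
    fun k hk z hz hzD => HasDerivAt.comp z
      (hk.differentiableAt (hD'.mem_nhds hzD)).hasDerivAt (hasDerivAt_slitLog hz).fun_neg
  have h1 : ∀ z ∈ slitDomain, -slitLog z ∈ D' → HasDerivAt (fun Y => Y * w (-slitLog Y))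
      (w (-slitLog z) - deriv w (-slitLog z)) z := fun z hz hzD => by
    have hz0 := ne_zero_of_mem_slitDomain hz
    refine ((hasDerivAt_id z).fun_mul (hcomp w hw z hz hzD)).congr_deriv ?_
    simp only [id]
    field_simp
    ring
  refine ⟨h1 Y hY hYD, ?_⟩
  have hev : deriv (fun Y => Y * w (-slitLog Y)) =ᶠ[𝓝 Y]
      fun z => w (-slitLog z) - deriv w (-slitLog z) := by
    have hc : ContinuousAt (fun z => -slitLog z) Y := (hasDerivAt_slitLog hY).fun_neg.continuousAt
    filter_upwards [isOpen_slitDomain.mem_nhds hY, hc.preimage_mem_nhds (hD'.mem_nhds hYD)]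
      with z hz hzD using (h1 z hz hzD).deriv
  rw [hev.deriv_eq, ((hcomp w hw Y hY hYD).fun_sub
    (hcomp _ (hw.deriv hD') Y hY hYD)).deriv]
  have hY0 := ne_zero_of_mem_slitDomain hY
  field_simp
  ring

/-- The set T need not be open, while the Volterra theory needs an open right-invariant domain. T is
therefore enlarged first, and the equation is then transported by ξ = -log Y. -/
theorem exists_star_solution {T : Set ℂ} {ε : ℝ} (hε : 0 < ε) (hT : T ⊆ slitDomain)
    (hstar : ∀ Y ∈ T, ∀ t : ℝ, 0 < t → t ≤ 1 → (t : ℂ) * Y ∈ T)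
    (hball : ∀ Y ∈ slitDomain, ‖Y‖ < ε → Y ∈ T) {W R : ℂ → ℂ} {K N : ℝ} (hK : 0 < K) (hN : 0 < N)
    (hW : AnalyticOnNhd ℂ W T) (hR : AnalyticOnNhd ℂ R T)
    (hWK : ∀ Y ∈ T, ‖Y * W Y‖ ≤ K * radialWeight ‖Y‖)
    (hRN : ∀ Y ∈ T, ‖R Y‖ ≤ N * radialWeight ‖Y‖) :
    ∃ u : ℂ → ℂ, AnalyticOnNhd ℂ u T ∧
      (∀ Y ∈ T, Y * deriv (deriv u) Y = W Y * u Y + R Y) ∧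
      ∀ Y ∈ T, ‖u Y‖ ≤ N * (4 * ‖Y‖ * radialTail ‖Y‖ * Real.exp (4 * K * radialTail ‖Y‖)) := by
  have hrw : Continuous fun Y : ℂ => radialWeight ‖Y‖ := by unfold radialWeight; fun_prop
  -- An open neighbourhood of T where the bounds survive with doubled constants; the room comes from
  -- the positivity of K, N and the weight.
  set Ω : Set ℂ := interior {Y | Y ∈ slitDomain ∧ AnalyticAt ℂ W Y ∧ AnalyticAt ℂ R Y ∧
    ‖Y * W Y‖ ≤ 2 * K * radialWeight ‖Y‖ ∧ ‖R Y‖ ≤ 2 * N * radialWeight ‖Y‖} with hΩ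
  have hTΩ : T ⊆ Ω := fun Y hY => by
    have hY0 : 0 < ‖Y‖ := norm_pos_iff.2 (ne_zero_of_mem_slitDomain (hT hY))
    have hm : 0 < radialWeight ‖Y‖ := by unfold radialWeight; positivity
    rw [hΩ, mem_interior_iff_mem_nhds]
    have h1 : ∀ᶠ Z in 𝓝 Y, ‖Z * W Z‖ < 2 * K * radialWeight ‖Z‖ := by
      refine ContinuousAt.eventually_lt ?_ ?_ (by nlinarith [hWK Y hY])
      · exact (continuousAt_id.mul (hW Y hY).continuousAt).norm
      · exact (continuous_const.mul hrw).continuousAt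
    have h2 : ∀ᶠ Z in 𝓝 Y, ‖R Z‖ < 2 * N * radialWeight ‖Z‖ := by
      refine ContinuousAt.eventually_lt ?_ ?_ (by nlinarith [hRN Y hY])
      · exact (hR Y hY).continuousAt.norm
      · exact (continuous_const.mul hrw).continuousAt
    filter_upwards [isOpen_slitDomain.mem_nhds (hT hY), (hW Y hY).eventually_analyticAt,
      (hR Y hY).eventually_analyticAt, h1, h2] with Z a1 a2 a3 a4 a5
    exact ⟨a1, a2, a3, a4.le, a5.le⟩
  -- Points whose whole segment to 0 stays in Ω or in the small disc: star-shaped by construction,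
  -- open by compactness of [0, 1]. The disc is there because 0 is not in Ω.
  set D : Set ℂ := {Y | Y ∈ slitDomain ∧
    ∀ t ∈ Set.Icc (0 : ℝ) 1, (t : ℂ) * Y ∈ Ω ∪ Metric.ball 0 ε} with hD
  have hDopen : IsOpen D := by
    refine isOpen_iff_mem_nhds.2 fun Y hY => ?_
    have h1 : ∀ᶠ Z in 𝓝 Y, ∀ t ∈ Set.Icc (0 : ℝ) 1, (t : ℂ) * Z ∈ Ω ∪ Metric.ball 0 ε := by
      refine isCompact_Icc.eventually_forall_of_forall_eventually fun t ht => ?_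
      have hc : Continuous fun z : ℂ × ℝ => (z.2 : ℂ) * z.1 := by fun_prop
      exact hc.continuousAt.preimage_mem_nhds
        ((isOpen_interior.union Metric.isOpen_ball).mem_nhds (hY.2 t ht))
    filter_upwards [isOpen_slitDomain.mem_nhds hY.1, h1] with Z a1 a2 using ⟨a1, a2⟩
  have hDΩ : D ⊆ Ω := fun Y hY => by
    have := hY.2 1 ⟨zero_le_one, le_rfl⟩
    rw [Complex.ofReal_one, one_mul] at this
    rcases this with h | h
    · exact h
    · exact hTΩ (hball Y hY.1 (mem_ball_zero_iff.1 h))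
  have hTD : T ⊆ D := fun Y hY => by
    refine ⟨hT hY, fun t ht => ?_⟩
    rcases ht.1.eq_or_lt with h | h
    · right
      rw [← h]
      simpa using hε
    · exact Or.inl (hTΩ (hstar Y hY t h ht.2))
  have hDstar : ∀ Y ∈ D, ∀ t : ℝ, 0 < t → t ≤ 1 → (t : ℂ) * Y ∈ D := fun Y hY t ht ht1 => by
    refine ⟨mul_mem_slitDomain hY.1 ht, fun s hs => ?_⟩
    rw [← mul_assoc, ← Complex.ofReal_mul]
    exact hY.2 _ ⟨mul_nonneg hs.1 ht.le, mul_le_one₀ hs.2 ht.le ht1⟩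
  have hright := isRightInvariant_logDomain hDopen hDstar
  have hprop := fun {Y : ℂ} (hY : Y ∈ D) => interior_subset (hDΩ hY)
  have hcomp : ∀ k : ℂ → ℂ, (∀ Y ∈ D, AnalyticAt ℂ k Y) →
      DifferentiableOn ℂ (fun ξ => k (Complex.exp (-ξ))) (logDomain D) := fun k hk ξ hξ => by
    have h1 := (hk _ hξ.2.2).differentiableAt
    have h2 : DifferentiableAt ℂ (fun ξ : ℂ => Complex.exp (-ξ)) ξ := by fun_prop
    exact (DifferentiableAt.comp (f := fun ξ : ℂ => Complex.exp (-ξ)) ξ h1 h2).differentiableWithinAt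
  obtain ⟨w, hwd, hwode, hwb⟩ := exists_volterra_solution (a := 1) (K := 2 * K) (N := 2 * N)
    (q := fun ξ => Complex.exp (-ξ) * W (Complex.exp (-ξ)))
    (R := fun ξ => R (Complex.exp (-ξ))) hright isTailWeight_radial one_pos (by positivity)
    (by positivity) (hcomp (fun Y => Y * W Y) fun Y hY => analyticAt_id.mul (hprop hY).2.1)
    (hcomp R fun Y hY => (hprop hY).2.2.1)
    (fun ξ hξ => by simpa only [norm_exp_neg] using (hprop hξ.2.2).2.2.2.1)
    (fun ξ hξ => by simpa only [norm_exp_neg] using (hprop hξ.2.2).2.2.2.2)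
  refine ⟨fun Y => Y * w (-slitLog Y), fun Y hY => ?_, fun Y hY => ?_, fun Y hY => ?_⟩
  · have : DifferentiableOn ℂ (fun Y => Y * w (-slitLog Y)) D := fun Z hZ =>
      (hasDerivAt_mul_comp_neg_slitLog hright.isOpen hwd hZ.1
        (neg_slitLog_mem_logDomain hZ.1 hZ)).1.differentiableAt.differentiableWithinAt
    exact this.analyticAt (hDopen.mem_nhds (hTD hY))
  · have hYs := hT hY
    have hYD := neg_slitLog_mem_logDomain hYs (hTD hY)
    have hY0 := ne_zero_of_mem_slitDomain hYs
    rw [(hasDerivAt_mul_comp_neg_slitLog hright.isOpen hwd hYs hYD).2]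
    have := hwode _ hYD
    simp only [neg_neg, exp_slitLog hY0, Complex.ofReal_one, one_mul] at this
    rw [this]
    field_simp
  · have hYs := hT hY
    have hYD := neg_slitLog_mem_logDomain hYs (hTD hY)
    have hY0 : 0 < ‖Y‖ := norm_pos_iff.2 (ne_zero_of_mem_slitDomain hYs)
    have := hwb _ hYD
    rw [Complex.neg_re, neg_neg, slitLog_re, Real.exp_log hY0] at this
    rw [norm_mul]
    refine (mul_le_mul_of_nonneg_left this (norm_nonneg _)).trans_eq ?_
    ring_nf

/-- In the variable ξ = -log Y, the quotient d/Y solves the homogeneous Volterra equation and is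
O(√|Y|), hence controlled by the tail weight. The order |Y|^(3/2) is what excludes the free
coefficients p₀ and p₁. -/
theorem eq_zero_of_small_of_local_ode {ε K N : ℝ} (hK : 0 ≤ K) (hN : 0 ≤ N) {W d : ℂ → ℂ}
    (hW : ∀ Y ∈ slitDomain, ‖Y‖ < ε → AnalyticAt ℂ W Y)
    (hd : ∀ Y ∈ slitDomain, ‖Y‖ < ε → AnalyticAt ℂ d Y)
    (hWK : ∀ Y ∈ slitDomain, ‖Y‖ < ε → ‖Y * W Y‖ ≤ K * radialWeight ‖Y‖)
    (hode : ∀ Y ∈ slitDomain, ‖Y‖ < ε → Y * deriv (deriv d) Y = W Y * d Y)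
    (hdN : ∀ Y ∈ slitDomain, ‖Y‖ < ε → ‖d Y‖ ≤ N * (‖Y‖ * √‖Y‖)) :
    ∀ Y ∈ slitDomain, ‖Y‖ < ε → d Y = 0 := by
  have hright := isRightInvariant_logDomain (D := Metric.ball 0 ε) Metric.isOpen_ball
    (fun Y hY t ht ht1 => by
      rw [mem_ball_zero_iff] at hY ⊢
      rw [norm_mul, Complex.norm_real, Real.norm_of_nonneg ht.le]
      nlinarith [norm_nonneg Y])
  have hexp : ∀ ξ : ℂ, HasDerivAt (fun ξ : ℂ => Complex.exp (-ξ)) (-Complex.exp (-ξ)) ξ :=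
    fun ξ => ((hasDerivAt_id ξ).fun_neg.cexp).congr_deriv (by simp)
  have hexp' : ∀ ξ : ℂ, HasDerivAt (fun ξ : ℂ => Complex.exp ξ) (Complex.exp ξ) ξ :=
    Complex.hasDerivAt_exp
  have hee : ∀ ξ : ℂ, Complex.exp (-ξ) * Complex.exp ξ = 1 := fun ξ => by
    rw [← Complex.exp_add]; simp
  have hcomp : ∀ k : ℂ → ℂ, (∀ Y ∈ slitDomain, ‖Y‖ < ε → AnalyticAt ℂ k Y) →
      ∀ ξ ∈ logDomain (Metric.ball 0 ε), HasDerivAt (fun ξ => k (Complex.exp (-ξ)))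
        (deriv k (Complex.exp (-ξ)) * -Complex.exp (-ξ)) ξ := fun k hk ξ hξ =>
    HasDerivAt.comp ξ (hk _ (exp_neg_mem_slitDomain hξ)
      (mem_ball_zero_iff.1 hξ.2.2)).differentiableAt.hasDerivAt (hexp ξ)
  set δ : ℂ → ℂ := fun ξ => d (Complex.exp (-ξ)) * Complex.exp ξ with hδ
  have hδ1 : ∀ ξ ∈ logDomain (Metric.ball 0 ε),
      HasDerivAt δ (δ ξ - deriv d (Complex.exp (-ξ))) ξ := fun ξ hξ => by
    refine ((hcomp d hd ξ hξ).fun_mul (hexp' ξ)).congr_deriv ?_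
    simp only [hδ]
    linear_combination (-deriv d (Complex.exp (-ξ))) * hee ξ
  have hδ2 : ∀ ξ ∈ logDomain (Metric.ball 0 ε), deriv (deriv δ) ξ
      = deriv δ ξ + Complex.exp (-ξ) * deriv (deriv d) (Complex.exp (-ξ)) := fun ξ hξ => by
    have hev : deriv δ =ᶠ[𝓝 ξ] fun ξ => δ ξ - deriv d (Complex.exp (-ξ)) := by
      filter_upwards [hright.isOpen.mem_nhds hξ] with z hz using (hδ1 z hz).deriv
    rw [hev.deriv_eq, ((hδ1 ξ hξ).fun_sub
      (hcomp _ (fun Y hY hYε => (hd Y hY hYε).deriv) ξ hξ)).deriv, (hδ1 ξ hξ).deriv]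
    ring
  have hzero := eq_zero_of_volterra_homogeneous (a := 1) (K := K) (N := N) (d := δ)
    (q := fun ξ => Complex.exp (-ξ) * W (Complex.exp (-ξ))) hright isTailWeight_radial one_pos hK hN
    (fun ξ hξ => (HasDerivAt.fun_mul (hexp ξ) (hcomp W hW ξ
      hξ)).differentiableAt.differentiableWithinAt)
    (fun ξ hξ => by
      simpa only [norm_exp_neg] using
        hWK _ (exp_neg_mem_slitDomain hξ) (mem_ball_zero_iff.1 hξ.2.2))
    (fun ξ hξ => (hδ1 ξ hξ).differentiableAt.differentiableWithinAt)
    (fun ξ hξ => by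
      rw [hδ2 ξ hξ, hode _ (exp_neg_mem_slitDomain hξ) (mem_ball_zero_iff.1 hξ.2.2)]
      simp only [hδ, Complex.ofReal_one]
      linear_combination (-(W (Complex.exp (-ξ)) * d (Complex.exp (-ξ)))) * hee ξ)
    (fun ξ hξ => by
      have h := hdN _ (exp_neg_mem_slitDomain hξ) (mem_ball_zero_iff.1 hξ.2.2)
      rw [norm_exp_neg] at h
      rw [hδ, norm_mul, Complex.norm_exp]
      refine (mul_le_mul_of_nonneg_right h (Real.exp_pos _).le).trans ?_
      have h1 : Real.exp (-ξ.re) * Real.exp ξ.re = 1 := by rw [← Real.exp_add]; simp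
      have h2 : √(Real.exp (-ξ.re)) ≤ radialTail (Real.exp (-ξ.re)) := by
        unfold radialTail
        have := Real.sqrt_nonneg (Real.exp (-ξ.re))
        have : 0 ≤ Real.exp (-ξ.re) ^ 4 / 4 := by positivity
        linarith
      calc _ = N * √(Real.exp (-ξ.re)) * (Real.exp (-ξ.re) * Real.exp ξ.re) := by ring
        _ = N * √(Real.exp (-ξ.re)) := by rw [h1, mul_one]
        _ ≤ _ := mul_le_mul_of_nonneg_left h2 hN)
  intro Y hY hYε
  have h := hzero _ (neg_slitLog_mem_logDomain hY (mem_ball_zero_iff.2 hYε))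
  have hY0 := ne_zero_of_mem_slitDomain hY
  simp only [hδ, neg_neg, exp_slitLog hY0] at h
  exact (mul_eq_zero.1 h).resolve_right (Complex.exp_ne_zero _)

end

/-! ### Propagation along rays, elementary bounds, and the singular part -/

section

open Filter

theorem deriv_deriv_add {f g : ℂ → ℂ} {z : ℂ} (hf : AnalyticAt ℂ f z) (hg : AnalyticAt ℂ g z) :
    deriv (deriv fun z => f z + g z) z = deriv (deriv f) z + deriv (deriv g) z := by
  have hev : deriv (fun z => f z + g z) =ᶠ[𝓝 z] fun z => deriv f z + deriv g z := by
    filter_upwards [hf.eventually_analyticAt, hg.eventually_analyticAt] with w h1 h2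
    exact deriv_fun_add h1.differentiableAt h2.differentiableAt
  rw [hev.deriv_eq, deriv_fun_add hf.deriv.differentiableAt hg.deriv.differentiableAt]

theorem deriv_deriv_const_mul {f : ℂ → ℂ} {z : ℂ} (c : ℂ) (hf : AnalyticAt ℂ f z) :
    deriv (deriv fun z => c * f z) z = c * deriv (deriv f) z := by
  have hev : deriv (fun z => c * f z) =ᶠ[𝓝 z] fun z => c * deriv f z := by
    filter_upwards [hf.eventually_analyticAt] with w h1
    exact deriv_const_mul c h1.differentiableAt
  rw [hev.deriv_eq, deriv_const_mul c hf.deriv.differentiableAt]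

theorem deriv_deriv_sub {f g : ℂ → ℂ} {z : ℂ} (hf : AnalyticAt ℂ f z) (hg : AnalyticAt ℂ g z) :
    deriv (deriv fun z => f z - g z) z = deriv (deriv f) z - deriv (deriv g) z := by
  have hev : deriv (fun z => f z - g z) =ᶠ[𝓝 z] fun z => deriv f z - deriv g z := by
    filter_upwards [hf.eventually_analyticAt, hg.eventually_analyticAt] with w h1 h2
    exact deriv_fun_sub h1.differentiableAt h2.differentiableAt
  rw [hev.deriv_eq, deriv_fun_sub hf.deriv.differentiableAt hg.deriv.differentiableAt]

/-- Identity theorem along rays ending at `0`. -/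
theorem eventuallyEq_of_eventuallyEq_nhdsWithin_zero {S : Set ℂ} {ρ : ℝ}
    (hS : S ⊆ slitDomain) (hstar : ∀ Y ∈ S, ∀ t : ℝ, 0 < t → t ≤ 1 → (t : ℂ) * Y ∈ S)
    {f g : ℂ → ℂ} (hf : AnalyticOnNhd ℂ f S) (hg : ∀ Y ∈ S, ‖Y‖ < ρ → AnalyticAt ℂ g Y)
    (hfg : ∀ᶠ Y in 𝓝[S] 0, f Y = g Y) {Y : ℂ} (hY : Y ∈ S) (hYρ : ‖Y‖ < ρ) :
    f =ᶠ[𝓝 Y] g := by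
  have hY0 := ne_zero_of_mem_slitDomain (hS hY)
  have hYn : 0 < ‖Y‖ := norm_pos_iff.2 hY0
  set seg : Set ℂ := (fun t : ℝ => (t : ℂ) * Y) '' Set.Ioc 0 1 with hseg
  have hcont : Continuous fun t : ℝ => (t : ℂ) * Y := by fun_prop
  have hpre : IsPreconnected seg := isPreconnected_Ioc.image _ hcont.continuousOn
  have hsegS : seg ⊆ S := by
    rintro _ ⟨t, ht, rfl⟩
    exact hstar Y hY t ht.1 ht.2
  have hsegρ : ∀ z ∈ seg, ‖z‖ < ρ := by
    rintro _ ⟨t, ht, rfl⟩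
    simp only [norm_mul, Complex.norm_real, Real.norm_of_nonneg ht.1.le]
    nlinarith [ht.2]
  have htend : ∀ t₀ : ℝ, Tendsto (fun t : ℝ => (t : ℂ) * Y) (𝓝[≠] t₀) (𝓝[≠] ((t₀ : ℂ) * Y)) := by
    intro t₀
    refine tendsto_nhdsWithin_iff.2 ⟨hcont.continuousAt.tendsto.mono_left nhdsWithin_le_nhds, ?_⟩
    filter_upwards [self_mem_nhdsWithin] with t ht h
    exact ht (by exact_mod_cast mul_right_cancel₀ hY0 h)
  obtain ⟨r, hr, hrS⟩ := Metric.mem_nhdsWithin_iff.1 hfg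
  set t₀ : ℝ := min (r / (2 * ‖Y‖)) (1 / 2) with ht₀
  have ht₀0 : 0 < t₀ := by positivity
  have ht₀1 : t₀ < 1 := (min_le_right _ _).trans_lt (by norm_num)
  have ht₀r : t₀ * ‖Y‖ < r := by
    have : t₀ ≤ r / (2 * ‖Y‖) := min_le_left _ _
    calc t₀ * ‖Y‖ ≤ r / (2 * ‖Y‖) * ‖Y‖ := by gcongr
      _ = r / 2 := by field_simp
      _ < r := by linarith
  have hevt : ∀ᶠ t : ℝ in 𝓝[≠] t₀, f ((t : ℂ) * Y) = g ((t : ℂ) * Y) := by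
    have hc : ContinuousAt (fun t : ℝ => t * ‖Y‖) t₀ := by fun_prop
    filter_upwards [nhdsWithin_le_nhds (Ioo_mem_nhds ht₀0 ht₀1),
      nhdsWithin_le_nhds (hc.eventually (gt_mem_nhds ht₀r))] with t ht htr
    refine hrS ⟨?_, hstar Y hY t ht.1 ht.2.le⟩
    rwa [mem_ball_zero_iff, norm_mul, Complex.norm_real, Real.norm_of_nonneg ht.1.le]
  -- S is not open, so the identity theorem is applied on the half-open segment from 0 to Y,
  -- starting at an interior parameter close to 0.
  have heq : Set.EqOn f g seg :=
    AnalyticOnNhd.eqOn_of_preconnected_of_frequently_eq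
      (fun z hz => hf z (hsegS hz)) (fun z hz => hg z (hsegS hz) (hsegρ z hz)) hpre ⟨t₀, ⟨ht₀0, ht₀1.le⟩, rfl⟩
      ((htend t₀).frequently hevt.frequently)
  -- Points of the segment accumulate at Y, which upgrades equality on it to equality in a full
  -- neighbourhood of Y.
  refine ((hf Y hY).frequently_eq_iff_eventually_eq (hg Y hY hYρ)).1 ?_
  have h1 := htend 1
  rw [Complex.ofReal_one, one_mul] at h1
  refine (h1.mono_left (nhdsWithin_mono _ (fun t (ht : t < 1) => ht.ne) :
    𝓝[<] (1 : ℝ) ≤ 𝓝[≠] 1)).frequently (Eventually.frequently ?_)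
  filter_upwards [Ioo_mem_nhdsLT (zero_lt_one (α := ℝ))] with t ht
  exact heq ⟨t, ⟨ht.1, ht.2.le⟩, rfl⟩

theorem self_le_sqrt_add_sq {r : ℝ} (hr : 0 ≤ r) : r ≤ √r + r ^ 2 := by
  have hss := Real.mul_self_sqrt hr
  rcases le_total 1 r with h | h
  · nlinarith [Real.sqrt_nonneg r]
  · nlinarith [Real.sqrt_le_one.2 h, Real.sqrt_nonneg r]

/-- Coefficients grow linearly and the singular part is bounded through √r + r²; their product fits
under the weight thanks to r⁴. -/
theorem one_add_mul_le_radialWeight {r : ℝ} (hr : 0 ≤ r) :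
    (1 + r) * (√r + r ^ 2) ≤ 4 * radialWeight r := by
  have hss := Real.mul_self_sqrt hr
  have hs := Real.sqrt_nonneg r
  unfold radialWeight
  rcases le_total 1 r with h | h
  · have h1 : √r ≤ r ^ 2 := by nlinarith [Real.one_le_sqrt.2 h]
    have h2 : r ^ 3 ≤ r ^ 4 := pow_le_pow_right₀ h (by norm_num)
    nlinarith
  · have h0 := Real.sqrt_le_one.2 h
    have h1 : r ≤ √r := by nlinarith
    have h2 : r ^ 2 ≤ √r := by nlinarith
    have h3 : 0 ≤ r ^ 4 := by positivity
    nlinarith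

theorem sqrt_add_sq_le {r ε : ℝ} (hr : 0 ≤ r) (hrε : r ≤ ε) :
    √r + r ^ 2 ≤ (1 + √ε * ε) * √r := by
  have hss := Real.mul_self_sqrt hr
  have hs := Real.sqrt_nonneg r
  have h1 : √r ≤ √ε := Real.sqrt_le_sqrt hrε
  have : r ^ 2 = √r * (√r * r) := by rw [← mul_assoc, hss]; ring
  have h2 : √r * r ≤ √ε * ε := by gcongr
  nlinarith

theorem radialTail_le {r ε : ℝ} (hr : 0 ≤ r) (hrε : r ≤ ε) :
    radialTail r ≤ (2 + √ε * ε ^ 3) * √r := by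
  have hss := Real.mul_self_sqrt hr
  have hs := Real.sqrt_nonneg r
  have h1 : √r ≤ √ε := Real.sqrt_le_sqrt hrε
  have : r ^ 4 = √r * (√r * r ^ 3) := by rw [← mul_assoc, hss]; ring
  have h2 : √r * r ^ 3 ≤ √ε * ε ^ 3 := by gcongr
  have h3 : 0 ≤ √r * r ^ 3 := by positivity
  unfold radialTail
  nlinarith

theorem radialTail_mono {r L : ℝ} (hr : 0 ≤ r) (hrL : r ≤ L) : radialTail r ≤ radialTail L := by
  unfold radialTail
  gcongr

/-- The singular part `p₀ + p₁ Y + q₀ Y log Y`. -/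
noncomputable def singularPart (p₀ p₁ q₀ : ℂ) (Y : ℂ) : ℂ := p₀ + p₁ * Y + q₀ * (Y * slitLog Y)

theorem hasDerivAt_singularPart (p₀ p₁ q₀ : ℂ) {Y : ℂ} (hY : Y ∈ slitDomain) :
    HasDerivAt (singularPart p₀ p₁ q₀) (p₁ + q₀ * (slitLog Y + 1)) Y := by
  have hY0 := ne_zero_of_mem_slitDomain hY
  refine ((((hasDerivAt_id Y).const_mul p₁).const_add p₀).fun_add
    (((hasDerivAt_id Y).fun_mul (hasDerivAt_slitLog hY)).const_mul q₀)).congr_deriv ?_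
  simp only [id]
  field_simp

theorem analyticAt_singularPart (p₀ p₁ q₀ : ℂ) {Y : ℂ} (hY : Y ∈ slitDomain) :
    AnalyticAt ℂ (singularPart p₀ p₁ q₀) Y := by
  have : DifferentiableOn ℂ (singularPart p₀ p₁ q₀) slitDomain := fun z hz =>
    (hasDerivAt_singularPart p₀ p₁ q₀ hz).differentiableAt.differentiableWithinAt
  exact this.analyticAt (isOpen_slitDomain.mem_nhds hY)

theorem deriv_deriv_singularPart (p₀ p₁ q₀ : ℂ) {Y : ℂ} (hY : Y ∈ slitDomain) :
    Y * deriv (deriv (singularPart p₀ p₁ q₀)) Y = q₀ := by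
  have hev : deriv (singularPart p₀ p₁ q₀) =ᶠ[𝓝 Y] fun z => p₁ + q₀ * (slitLog z + 1) := by
    filter_upwards [isOpen_slitDomain.mem_nhds hY] with z hz
      using (hasDerivAt_singularPart p₀ p₁ q₀ hz).deriv
  have hY0 := ne_zero_of_mem_slitDomain hY
  rw [hev.deriv_eq, ((((hasDerivAt_slitLog hY).add_const 1).const_mul q₀).const_add p₁).deriv]
  field_simp

theorem norm_singularPart_sub_le {p₀ p₁ q₀ : ℂ} {M N : ℝ} (h₁ : ‖p₁‖ ≤ N) (hq : ‖q₀‖ ≤ M)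
    {Y : ℂ} (hY : Y ∈ slitDomain) :
    ‖singularPart p₀ p₁ q₀ Y - p₀‖ ≤ (N + 7 * M) * (√‖Y‖ + ‖Y‖ ^ 2) := by
  have hM : 0 ≤ M := (norm_nonneg _).trans hq
  have hN : 0 ≤ N := (norm_nonneg _).trans h₁
  have h1 := norm_mul_slitLog_le hY
  have h2 := self_le_sqrt_add_sq (norm_nonneg Y)
  have : singularPart p₀ p₁ q₀ Y - p₀ = p₁ * Y + q₀ * (Y * slitLog Y) := by
    unfold singularPart; ring
  rw [this]
  refine (norm_add_le _ _).trans ?_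
  rw [norm_mul, norm_mul, norm_mul]
  calc _ ≤ N * (√‖Y‖ + ‖Y‖ ^ 2) + M * (7 * (√‖Y‖ + ‖Y‖ ^ 2)) := by gcongr
    _ = _ := by ring

/-- What remains has a factor Y² in P and Y² log Y in Q, hence order |Y|^(3/2), as the local
uniqueness lemma demands. -/
theorem norm_logSum_sub_singularPart_le {p q : ℕ → ℂ} {ρ M : ℝ} (hρ : 0 < ρ)
    (hp : SeriesBound ρ p M) (hq : SeriesBound ρ q M) {Y : ℂ} (hY : Y ∈ slitDomain)
    (hYρ : ‖Y‖ ≤ ρ) :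
    ‖logSum p q Y - singularPart (p 0) (p 1) (q 0) Y‖
      ≤ (M / ρ / ρ + 7 * (M / ρ)) * (‖Y‖ * (√‖Y‖ + ‖Y‖ ^ 2)) := by
  have hM := hp.nonneg hρ.le
  have h1 := (hp.shift hρ).norm_powerSum_sub_le hρ hYρ
  have h2 := hq.norm_powerSum_sub_le hρ hYρ
  have h3 := norm_mul_slitLog_le hY
  have h4 := self_le_sqrt_add_sq (norm_nonneg Y)
  have : logSum p q Y - singularPart (p 0) (p 1) (q 0) Y
      = Y * (powerSum (fun n => p (n + 1)) Y - p (0 + 1))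
        + Y * slitLog Y * (powerSum q Y - q 0) := by
    unfold logSum singularPart
    rw [hp.powerSum_eq_add hYρ]
    ring
  rw [this]
  refine (norm_add_le _ _).trans ?_
  rw [norm_mul, norm_mul, norm_mul]
  calc _ ≤ ‖Y‖ * (M / ρ / ρ * (√‖Y‖ + ‖Y‖ ^ 2))
        + 7 * (√‖Y‖ + ‖Y‖ ^ 2) * (M / ρ * ‖Y‖) := by
        gcongr
        exact h1.trans (by gcongr)
    _ = _ := by ring

end

/-! ### Solutions issued from the singular point -/

section

open Filter

section Remainder

variable {ρ K N : ℝ} {Wc kc a b : ℕ → ℂ} {p₀ p₁ q₀ : ℂ}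

/-- Subtracting the singular part leaves a source whose constant term cancels exactly because q₀ =
W₀ p₀ + k₀ a₀. The rest is O(√|Y|). -/
theorem norm_remainder_le_of_norm_lt (hρ : 0 < ρ) (hW : SeriesBound ρ Wc K)
    (hk : SeriesBound ρ kc K) (ha : SeriesBound ρ a N) (hb : SeriesBound ρ b N)
    (hp₀ : ‖p₀‖ ≤ N) (hp₁ : ‖p₁‖ ≤ N) (hq₀ : q₀ = Wc 0 * p₀ + kc 0 * a 0)
    (hqn : ‖q₀‖ ≤ 2 * K * N) {Y : ℂ} (hY : Y ∈ slitDomain) (hYρ : ‖Y‖ ≤ ρ) :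
    ‖powerSum Wc Y * singularPart p₀ p₁ q₀ Y + powerSum kc Y * logSum a b Y - q₀‖
      ≤ N * (4 * (K / ρ + K * (1 + 14 * K) + K / ρ + K * (1 / ρ + 7))) * radialWeight ‖Y‖ := by
  have hN := ha.nonneg hρ.le
  have hK := hW.nonneg hρ.le
  set s := √‖Y‖ + ‖Y‖ ^ 2 with hs
  have hs0 : 0 ≤ s := by positivity
  have hrs : ‖Y‖ ≤ s := self_le_sqrt_add_sq (norm_nonneg Y)
  have h1 : ‖powerSum Wc Y - Wc 0‖ ≤ K / ρ * s :=
    (hW.norm_powerSum_sub_le hρ hYρ).trans (by gcongr)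
  have h2 : ‖powerSum kc Y - kc 0‖ ≤ K / ρ * s :=
    (hk.norm_powerSum_sub_le hρ hYρ).trans (by gcongr)
  have h3 : ‖singularPart p₀ p₁ q₀ Y - p₀‖ ≤ (N + 7 * (2 * K * N)) * s :=
    norm_singularPart_sub_le hp₁ hqn hY
  have h4 : ‖logSum a b Y - a 0‖ ≤ N / ρ * s + 7 * N * s :=
    (norm_logSum_sub_le hρ ha hb hY hYρ).trans (by gcongr)
  have h5 := hW.norm_powerSum_le hYρ
  have h6 := hk.norm_powerSum_le hYρ
  have h7 := ha.norm_zero_le hρ.le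
  have he : powerSum Wc Y * singularPart p₀ p₁ q₀ Y + powerSum kc Y * logSum a b Y - q₀
      = (powerSum Wc Y - Wc 0) * p₀ + powerSum Wc Y * (singularPart p₀ p₁ q₀ Y - p₀)
        + (powerSum kc Y - kc 0) * a 0 + powerSum kc Y * (logSum a b Y - a 0) := by
    rw [hq₀]; ring
  have hm := one_add_mul_le_radialWeight (norm_nonneg Y)
  rw [← hs] at hm
  have hsm : s ≤ 4 * radialWeight ‖Y‖ := by nlinarith [norm_nonneg Y]
  rw [he]
  calc _ ≤ ‖(powerSum Wc Y - Wc 0) * p₀‖ + ‖powerSum Wc Y * (singularPart p₀ p₁ q₀ Y - p₀)‖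
        + ‖(powerSum kc Y - kc 0) * a 0‖ + ‖powerSum kc Y * (logSum a b Y - a 0)‖ := norm_add₄_le
    _ ≤ K / ρ * s * N + K * ((N + 7 * (2 * K * N)) * s) + K / ρ * s * N
        + K * (N / ρ * s + 7 * N * s) := by
        simp only [norm_mul]
        gcongr
    _ = N * (K / ρ + K * (1 + 14 * K) + K / ρ + K * (1 / ρ + 7)) * s := by ring
    _ ≤ N * (K / ρ + K * (1 + 14 * K) + K / ρ + K * (1 / ρ + 7)) * (4 * radialWeight ‖Y‖) := by
        gcongr
    _ = _ := by ring

/-- Away from the centre no cancellation is needed: √|Y| ≥ √ε makes constants multiples of the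
weight. -/
theorem norm_remainder_le_of_le_norm {ε : ℝ} (hε : 0 < ε) (hK : 1 ≤ K) (hp₀ : ‖p₀‖ ≤ N)
    (hp₁ : ‖p₁‖ ≤ N) (hqn : ‖q₀‖ ≤ 2 * K * N) {Y W k f : ℂ} (hY : Y ∈ slitDomain)
    (hYε : ε ≤ ‖Y‖) (hW : ‖W‖ ≤ K * (1 + ‖Y‖)) (hk : ‖k‖ ≤ K * (1 + ‖Y‖)) (hf : ‖f‖ ≤ N) :
    ‖W * singularPart p₀ p₁ q₀ Y + k * f - q₀‖
      ≤ N * (4 * (K * (4 / √ε + (1 + 14 * K)))) * radialWeight ‖Y‖ := by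
  have hN : 0 ≤ N := (norm_nonneg _).trans hp₀
  set s := √‖Y‖ + ‖Y‖ ^ 2 with hs
  have hs0 : 0 ≤ s := by positivity
  have hεs : 0 < √ε := Real.sqrt_pos.2 hε
  have h1 : 1 ≤ s / √ε := by
    rw [le_div_iff₀ hεs, one_mul]
    have : √ε ≤ √‖Y‖ := Real.sqrt_le_sqrt hYε
    have : 0 ≤ ‖Y‖ ^ 2 := by positivity
    linarith
  have h3 : ‖singularPart p₀ p₁ q₀ Y - p₀‖ ≤ (N + 7 * (2 * K * N)) * s :=
    norm_singularPart_sub_le hp₁ hqn hY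
  have h4 : ‖singularPart p₀ p₁ q₀ Y‖ ≤ N + (N + 7 * (2 * K * N)) * s := by
    have := norm_add_le (singularPart p₀ p₁ q₀ Y - p₀) p₀
    rw [sub_add_cancel] at this
    linarith
  have hr := norm_nonneg Y
  have hm := one_add_mul_le_radialWeight hr
  rw [← hs] at hm
  calc _ ≤ ‖W * singularPart p₀ p₁ q₀ Y‖ + ‖k * f‖ + ‖q₀‖ :=
        (norm_sub_le _ _).trans (add_le_add_left (norm_add_le _ _) _)
    _ ≤ K * (1 + ‖Y‖) * (N + (N + 7 * (2 * K * N)) * s) + K * (1 + ‖Y‖) * N + 2 * K * N := by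
        simp only [norm_mul]
        gcongr
    _ ≤ K * (1 + ‖Y‖) * (N + (N + 7 * (2 * K * N)) * s) + K * (1 + ‖Y‖) * N
        + 2 * K * N * (1 + ‖Y‖) := by
        have : 0 ≤ 2 * K * N * ‖Y‖ := by positivity
        linarith
    _ = N * K * (4 * 1 + (1 + 14 * K) * s) * (1 + ‖Y‖) := by ring
    _ ≤ N * K * (4 * (s / √ε) + (1 + 14 * K) * s) * (1 + ‖Y‖) := by gcongr
    _ = N * (K * (4 / √ε + (1 + 14 * K))) * ((1 + ‖Y‖) * s) := by ring
    _ ≤ N * (K * (4 / √ε + (1 + 14 * K))) * (4 * radialWeight ‖Y‖) := by gcongr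
    _ = _ := by ring

end Remainder

/-- Solvability of `Y φ'' = W φ + k f` on a star-shaped slit domain, with prescribed `p₀` and `p₁`
in the expansion `φ = p₀ + p₁ Y + q₀ Y log Y + ⋯` at the centre. -/
theorem exists_solution_from_center {S : Set ℂ} (hS : S ⊆ slitDomain)
    (hstar : ∀ Y ∈ S, ∀ t : ℝ, 0 < t → t ≤ 1 → (t : ℂ) * Y ∈ S) {ρ K : ℝ} (hρ : 0 < ρ)
    (hK : 1 ≤ K) (hρK : ρ * K ≤ 1 / 2) {Wc kc : ℕ → ℂ} (hWc : SeriesBound ρ Wc K)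
    (hkc : SeriesBound ρ kc K) {W k : ℂ → ℂ} (hW : AnalyticOnNhd ℂ W S)
    (hk : AnalyticOnNhd ℂ k S) (hWeq : ∀ Y, ‖Y‖ < ρ → W Y = powerSum Wc Y)
    (hkeq : ∀ Y, ‖Y‖ < ρ → k Y = powerSum kc Y) (hWK : ∀ Y ∈ S, ‖W Y‖ ≤ K * (1 + ‖Y‖))
    (hkK : ∀ Y ∈ S, ‖k Y‖ ≤ K * (1 + ‖Y‖)) (L : ℝ) :
    ∃ C : ℝ, 0 < C ∧ ∀ (f : ℂ → ℂ) (N : ℝ) (a b : ℕ → ℂ), 0 < N → AnalyticOnNhd ℂ f S →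
      (∀ Y ∈ S, ‖f Y‖ ≤ N) → (∀ᶠ Y in 𝓝[S] 0, f Y = logSum a b Y) →
      SeriesBound ρ a N → SeriesBound ρ b N → ∀ p₀ p₁ : ℂ, ‖p₀‖ ≤ N → ‖p₁‖ ≤ N →
      ∃ (φ : ℂ → ℂ) (p q : ℕ → ℂ), AnalyticOnNhd ℂ φ S ∧
        (∀ Y ∈ S, Y * deriv (deriv φ) Y = W Y * φ Y + k Y * f Y) ∧
        (∀ᶠ Y in 𝓝[S] 0, φ Y = logSum p q Y) ∧ p 0 = p₀ ∧ p 1 = p₁ ∧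
        q 0 = Wc 0 * p₀ + kc 0 * a 0 ∧ SeriesBound ρ p (C * N) ∧ SeriesBound ρ q (C * N) ∧
        ∀ Y ∈ S, ‖Y‖ ≤ L → ‖φ Y‖ ≤ C * N := by
  obtain ⟨C₁, hC₁, hloc⟩ := exists_local_solution hρ hWc hρK hkc
  set ε := ρ / 2 with hε
  have hε0 : 0 < ε := by positivity
  have hερ : ε < ρ := by rw [hε]; linarith
  set A : ℝ := 4 * (K / ρ + K * (1 + 14 * K) + K / ρ + K * (1 / ρ + 7))
    + 4 * (K * (4 / √ε + (1 + 14 * K))) with hA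
  have hA0 : 0 < A := by positivity
  set L' := max L 0 with hL'
  have hL'0 : 0 ≤ L' := le_max_right _ _
  set C₂ : ℝ := A * (4 * L' * radialTail L' * Real.exp (4 * (4 * K) * radialTail L'))
    + (1 + 15 * K * (√L' + L' ^ 2)) with hC₂
  have hrT : ∀ r : ℝ, 0 ≤ r → 0 ≤ radialTail r := fun r hr => by unfold radialTail; positivity
  have hC₂0 : 0 ≤ C₂ := by have := hrT L' hL'0; positivity
  refine ⟨C₁ + C₂, by positivity, fun f N a b hN hf hfN hfab ha hb p₀ p₁ hp₀ hp₁ => ?_⟩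
  obtain ⟨p, q, hp0, hp1, hq0, hp, hq, hpq⟩ := hloc N a b ha hb p₀ p₁ hp₀ hp₁
  set q₀ := q 0 with hq₀
  have hqn : ‖q₀‖ ≤ 2 * K * N := by
    rw [hq0]
    refine (norm_add_le _ _).trans ?_
    rw [norm_mul, norm_mul]
    have h1 := hWc.norm_zero_le hρ.le
    have h2 := hkc.norm_zero_le hρ.le
    have h3 := ha.norm_zero_le hρ.le
    calc _ ≤ K * N + K * N := by gcongr
      _ = _ := by ring
  -- The expansion of f is assumed only near 0; analyticity along rays carries it to all of S in the
  -- disc of radius ρ.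
  have hfF : ∀ Y ∈ S, ‖Y‖ < ρ → f =ᶠ[𝓝 Y] logSum a b := fun Y hY hYρ =>
    eventuallyEq_of_eventuallyEq_nhdsWithin_zero hS hstar hf
      (fun Y hY hYρ => analyticAt_logSum ha hb (hS hY) hYρ) hfab hY hYρ
  -- S need not contain a slit disc about 0, since yc may lie on the boundary of the pencil. The
  -- disc is adjoined, with f continued there by its expansion.
  set T : Set ℂ := S ∪ {Y | Y ∈ slitDomain ∧ ‖Y‖ < ε} with hT
  have hTs : T ⊆ slitDomain := Set.union_subset hS fun Y hY => hY.1
  have hTstar : ∀ Y ∈ T, ∀ t : ℝ, 0 < t → t ≤ 1 → (t : ℂ) * Y ∈ T := by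
    rintro Y (hY | hY) t ht ht1
    · exact Or.inl (hstar Y hY t ht ht1)
    · refine Or.inr ⟨mul_mem_slitDomain hY.1 ht, ?_⟩
      rw [norm_mul, Complex.norm_real, Real.norm_of_nonneg ht.le]
      nlinarith [norm_nonneg Y, hY.2]
  classical
  set g : ℂ → ℂ := fun Y => if ‖Y‖ < ε then logSum a b Y else f Y with hg
  have hgball : ∀ Y, ‖Y‖ < ε → g =ᶠ[𝓝 Y] logSum a b := fun Y hY => by
    filter_upwards [Metric.isOpen_ball.mem_nhds (mem_ball_zero_iff.2 hY)] with Z hZ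
    exact if_pos (mem_ball_zero_iff.1 hZ)
  -- The gap ε < ρ lets the two definitions overlap, so g is analytic across |Y| = ε.
  have hgS : ∀ Y ∈ S, g =ᶠ[𝓝 Y] f := fun Y hY => by
    rcases lt_or_ge ‖Y‖ ρ with h | h
    · filter_upwards [hfF Y hY h] with Z hZ
      simp [hg, hZ]
    · have : ∀ᶠ Z in 𝓝 Y, ε < ‖Z‖ :=
        continuous_norm.continuousAt.eventually (lt_mem_nhds (hερ.trans_le h))
      filter_upwards [this] with Z hZ
      exact if_neg hZ.not_gt
  have hgT : AnalyticOnNhd ℂ g T := by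
    rintro Y (hY | hY)
    · exact (hf Y hY).congr (hgS Y hY).symm
    · exact (analyticAt_logSum ha hb hY.1 (hY.2.trans hερ)).congr (hgball Y hY.2).symm
  have hser : ∀ (h : ℂ → ℂ) (c : ℕ → ℂ), SeriesBound ρ c K →
      (∀ Y, ‖Y‖ < ρ → h Y = powerSum c Y) → ∀ Y, ‖Y‖ < ρ → AnalyticAt ℂ h Y :=
    fun h c hc hh Y hY => (hc.analyticAt hY).congr <| by
      filter_upwards [Metric.isOpen_ball.mem_nhds (mem_ball_zero_iff.2 hY)] with Z hZ
      exact (hh Z (mem_ball_zero_iff.1 hZ)).symm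
  have hWT : AnalyticOnNhd ℂ W T := by
    rintro Y (hY | hY)
    · exact hW Y hY
    · exact hser W Wc hWc hWeq Y (hY.2.trans hερ)
  have hkT : AnalyticOnNhd ℂ k T := by
    rintro Y (hY | hY)
    · exact hk Y hY
    · exact hser k kc hkc hkeq Y (hY.2.trans hερ)
  have hWKT : ∀ Y ∈ T, ‖W Y‖ ≤ K * (1 + ‖Y‖) := by
    rintro Y (hY | hY)
    · exact hWK Y hY
    · rw [hWeq Y (hY.2.trans hερ)]
      have := hWc.norm_powerSum_le (hY.2.trans hερ).le
      nlinarith [norm_nonneg Y]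
  have hYW : ∀ Y ∈ T, ‖Y * W Y‖ ≤ 4 * K * radialWeight ‖Y‖ := fun Y hY => by
    have h1 := hWKT Y hY
    have h2 := one_add_mul_le_radialWeight (norm_nonneg Y)
    have h3 := self_le_sqrt_add_sq (norm_nonneg Y)
    rw [norm_mul]
    calc ‖Y‖ * ‖W Y‖ ≤ (√‖Y‖ + ‖Y‖ ^ 2) * (K * (1 + ‖Y‖)) := by gcongr
      _ = K * ((1 + ‖Y‖) * (√‖Y‖ + ‖Y‖ ^ 2)) := by ring
      _ ≤ K * (4 * radialWeight ‖Y‖) := by gcongr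
      _ = _ := by ring
  set χ := singularPart p₀ p₁ q₀ with hχ
  set R : ℂ → ℂ := fun Y => W Y * χ Y + k Y * g Y - q₀ with hR
  have hχT : AnalyticOnNhd ℂ χ T := fun Y hY => analyticAt_singularPart _ _ _ (hTs hY)
  have hRT : AnalyticOnNhd ℂ R T := fun Y hY =>
    (((hWT Y hY).mul (hχT Y hY)).add ((hkT Y hY).mul (hgT Y hY))).sub analyticAt_const
  have hRN : ∀ Y ∈ T, ‖R Y‖ ≤ N * A * radialWeight ‖Y‖ := by
    intro Y hY
    have hm : 0 ≤ radialWeight ‖Y‖ := by unfold radialWeight; positivity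
    rcases lt_or_ge ‖Y‖ ε with h | h
    · have hYρ := h.trans hερ
      have hgY : g Y = logSum a b Y := if_pos h
      have := norm_remainder_le_of_norm_lt hρ hWc hkc ha hb hp₀ hp₁ hq0 hqn (hTs hY) hYρ.le
      simp only [hR, hWeq Y hYρ, hkeq Y hYρ, hgY]
      refine this.trans ?_
      gcongr
      rw [hA]
      have : 0 ≤ 4 * (K * (4 / √ε + (1 + 14 * K))) := by positivity
      linarith
    · have hYS : Y ∈ S := hY.resolve_right fun h' => h.not_gt h'.2
      have hgY : g Y = f Y := if_neg h.not_gt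
      have := norm_remainder_le_of_le_norm hε0 hK hp₀ hp₁ hqn (hTs hY) h (hWK Y hYS)
        (hkK Y hYS) (hfN Y hYS)
      simp only [hR, hgY]
      refine this.trans ?_
      gcongr
      rw [hA]
      have : 0 ≤ 4 * (K / ρ + K * (1 + 14 * K) + K / ρ + K * (1 / ρ + 7)) := by positivity
      linarith
  obtain ⟨u, hu, huode, hub⟩ := exists_star_solution (T := T) (K := 4 * K) (N := N * A) hε0 hTs
    hTstar (fun Y hY hYε => Or.inr ⟨hY, hYε⟩) (by positivity) (by positivity) hWT hRT hYW hRN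
  set φ : ℂ → ℂ := fun Y => χ Y + u Y with hφ
  have hφT : AnalyticOnNhd ℂ φ T := fun Y hY => (hχT Y hY).add (hu Y hY)
  have hφode : ∀ Y ∈ T, Y * deriv (deriv φ) Y = W Y * φ Y + k Y * g Y := fun Y hY => by
    rw [hφ, deriv_deriv_add (hχT Y hY) (hu Y hY), mul_add, huode Y hY,
      deriv_deriv_singularPart _ _ _ (hTs hY)]
    simp only [hR]
    ring
  -- φ and the series solution satisfy the same equation and share the singular part χ up to
  -- O(|Y|^(3/2)), so they coincide.
  have hφloc : ∀ Y ∈ slitDomain, ‖Y‖ < ε → φ Y = logSum p q Y := by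
    have hmemT : ∀ Y ∈ slitDomain, ‖Y‖ < ε → Y ∈ T := fun Y hY hYε => Or.inr ⟨hY, hYε⟩
    have hlocA : ∀ Y ∈ slitDomain, ‖Y‖ < ε → AnalyticAt ℂ (logSum p q) Y := fun Y hY hYε =>
      analyticAt_logSum hp hq hY (hYε.trans hερ)
    set cR : ℝ := 4 * (N * A) * (2 + √ε * ε ^ 3) * Real.exp (4 * (4 * K) * radialTail ε) with hcR
    set cL : ℝ := (C₁ * N / ρ / ρ + 7 * (C₁ * N / ρ)) * (1 + √ε * ε) with hcL
    have hzero := eq_zero_of_small_of_local_ode (ε := ε) (K := 4 * K) (N := cR + cL) (W := W)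
      (d := fun Y => φ Y - logSum p q Y) (by positivity)
      (by positivity) (fun Y hY hYε => hWT Y (hmemT Y hY hYε))
      (fun Y hY hYε => (hφT Y (hmemT Y hY hYε)).sub (hlocA Y hY hYε))
      (fun Y hY hYε => hYW Y (hmemT Y hY hYε))
      (fun Y hY hYε => by
        rw [deriv_deriv_sub (hφT Y (hmemT Y hY hYε)) (hlocA Y hY hYε), mul_sub,
          hφode Y (hmemT Y hY hYε), hpq Y hY (hYε.trans hερ), hWeq Y (hYε.trans hερ),
          hkeq Y (hYε.trans hερ), (hgball Y hYε).eq_of_nhds]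
        ring)
      (fun Y hY hYε => by
        have hr := norm_nonneg Y
        have h1 := hub Y (hmemT Y hY hYε)
        have h2 := norm_logSum_sub_singularPart_le hρ hp hq hY (hYε.trans hερ).le
        rw [hp0, hp1] at h2
        have h3 := radialTail_le hr hYε.le
        have h4 := sqrt_add_sq_le hr hYε.le
        have h5 := radialTail_mono hr hYε.le
        have h6 := hrT _ hr
        have he : φ Y - logSum p q Y = u Y - (logSum p q Y - χ Y) := by
          simp only [hφ]; ring
        rw [he]
        refine (norm_sub_le _ _).trans ?_
        have h7 : N * A * (4 * ‖Y‖ * radialTail ‖Y‖ * Real.exp (4 * (4 * K) * radialTail ‖Y‖))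
            ≤ N * A * (4 * ‖Y‖ * ((2 + √ε * ε ^ 3) * √‖Y‖)
              * Real.exp (4 * (4 * K) * radialTail ε)) := by gcongr
        have h8 : (C₁ * N / ρ / ρ + 7 * (C₁ * N / ρ)) * (‖Y‖ * (√‖Y‖ + ‖Y‖ ^ 2))
            ≤ (C₁ * N / ρ / ρ + 7 * (C₁ * N / ρ)) * (‖Y‖ * ((1 + √ε * ε) * √‖Y‖)) := by gcongr
        calc _ ≤ _ := add_le_add (h1.trans h7) (h2.trans h8)
          _ = _ := by rw [hcR, hcL]; ring)
    intro Y hY hYε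
    exact sub_eq_zero.1 (hzero Y hY hYε)
  refine ⟨φ, p, q, fun Y hY => hφT Y (Or.inl hY), fun Y hY => ?_, ?_, hp0, hp1, hq0,
    hp.mono (mul_le_mul_of_nonneg_right (by linarith) hN.le),
    hq.mono (mul_le_mul_of_nonneg_right (by linarith) hN.le), fun Y hY hYL => ?_⟩
  · rw [hφode Y (Or.inl hY), (hgS Y hY).eq_of_nhds]
  · filter_upwards [self_mem_nhdsWithin,
      nhdsWithin_le_nhds (Metric.ball_mem_nhds (0 : ℂ) hε0)] with Y hY hYε
    exact hφloc Y (hS hY) (mem_ball_zero_iff.1 hYε)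
  · have hr := norm_nonneg Y
    have hrL : ‖Y‖ ≤ L' := hYL.trans (le_max_left _ _)
    have h1 := hub Y (Or.inl hY)
    have h2 := norm_singularPart_sub_le (p₀ := p₀) hp₁ hqn (hS hY)
    have h3 := radialTail_mono hr hrL
    have h4 := hrT _ hr
    have h4' := hrT _ hL'0
    have h5 : ‖χ Y‖ ≤ ‖χ Y - p₀‖ + ‖p₀‖ := by
      have := norm_add_le (χ Y - p₀) p₀
      rwa [sub_add_cancel] at this
    have h6 : (N + 7 * (2 * K * N)) * (√‖Y‖ + ‖Y‖ ^ 2) ≤ 15 * K * N * (√L' + L' ^ 2) := by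
      have : N + 7 * (2 * K * N) ≤ 15 * K * N := by nlinarith
      gcongr
    have h7 : N * A * (4 * ‖Y‖ * radialTail ‖Y‖ * Real.exp (4 * (4 * K) * radialTail ‖Y‖))
        ≤ N * A * (4 * L' * radialTail L' * Real.exp (4 * (4 * K) * radialTail L')) := by gcongr
    have h8 : ‖φ Y‖ ≤ ‖χ Y‖ + ‖u Y‖ := norm_add_le _ _
    have h9 : C₂ * N ≤ (C₁ + C₂) * N := mul_le_mul_of_nonneg_right (by linarith) hN.le
    have h10 : C₂ * N = N * A * (4 * L' * radialTail L' * Real.exp (4 * (4 * K) * radialTail L'))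
        + (N + 15 * K * N * (√L' + L' ^ 2)) := by rw [hC₂]; ring
    linarith

end

/-! ### Geometry of the pencil and properties of the profile -/

section

open Filter

theorem iteratedDeriv_two_eq (f : ℂ → ℂ) : iteratedDeriv 2 f = deriv (deriv f) := by
  rw [iteratedDeriv_succ, iteratedDeriv_one]

section Pencil

variable {β₀ β₁ : ℝ}

theorem convex_pencil (β₀ β₁ : ℝ) : Convex ℝ (pencil β₀ β₁) := by
  intro x hx y hy a b ha hb hab
  have h1 := le_min_iff.1 hx.1
  have h2 := le_min_iff.1 hy.1
  have him : (a • x + b • y).im = a * x.im + b * y.im := by simp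
  have hre : (a • x + b • y).re = a * x.re + b * y.re := by simp
  have habs : |a * x.im + b * y.im| ≤ a * |x.im| + b * |y.im| := by
    refine (abs_add_le _ _).trans_eq ?_
    rw [abs_mul, abs_mul, abs_of_nonneg ha, abs_of_nonneg hb]
  refine ⟨?_, ?_⟩
  · rw [him, hre]
    refine le_min ?_ ?_
    · nlinarith
    · have h3 := mul_le_mul_of_nonneg_left h1.2 ha
      have h4 := mul_le_mul_of_nonneg_left h2.2 hb
      have h5 : a * β₁ + b * β₁ = β₁ := by rw [← add_mul, hab, one_mul]
      linarith
  · rw [hre]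
    exact add_nonneg (mul_nonneg ha hx.2) (mul_nonneg hb hy.2)

theorem isClosed_pencil (β₀ β₁ : ℝ) : IsClosed (pencil β₀ β₁) := by
  refine IsClosed.inter (s₁ := {z : ℂ | |z.im| ≤ min (β₀ * z.re) β₁}) ?_ ?_
  · exact isClosed_le (by fun_prop) (by fun_prop)
  · exact isClosed_le continuous_const Complex.continuous_re

theorem ofReal_mem_pencil (hβ₀ : 0 < β₀) (hβ₁ : 0 < β₁) {x : ℝ} (hx : 0 ≤ x) :
    (x : ℂ) ∈ pencil β₀ β₁ := by
  refine ⟨?_, by simpa using hx⟩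
  simp only [Complex.ofReal_im, abs_zero, Complex.ofReal_re]
  exact le_min (by positivity) hβ₁.le

theorem isCompact_pencil_inter (β₀ β₁ M : ℝ) :
    IsCompact (pencil β₀ β₁ ∩ {z | z.re ≤ M}) := by
  refine Metric.isCompact_of_isClosed_isBounded
    ((isClosed_pencil β₀ β₁).inter (isClosed_le Complex.continuous_re continuous_const)) ?_
  refine (Metric.isBounded_closedBall (x := (0 : ℂ)) (r := M + β₁)).subset fun z hz => ?_
  rw [mem_closedBall_zero_iff]
  refine (Complex.norm_le_abs_re_add_abs_im z).trans ?_
  rw [abs_of_nonneg hz.1.2]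
  exact add_le_add hz.2 (hz.1.1.trans (min_le_right _ _))

/-- The pencil is convex and contains yc, and the complement of the slit is stable under positive
dilations about yc. -/
theorem slitPencil_star {yc : ℂ} (hyc : yc ∈ pencil β₀ β₁) {Y : ℂ}
    (hY : yc + Y ∈ slitPencil β₀ β₁ yc) {t : ℝ} (ht : 0 < t) (ht1 : t ≤ 1) :
    yc + t * Y ∈ slitPencil β₀ β₁ yc := by
  refine ⟨?_, ?_⟩
  · have := (convex_pencil β₀ β₁) hyc hY.1 (sub_nonneg.2 ht1) ht.le (by ring)
    convert this using 1
    simp only [Complex.real_smul]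
    push_cast
    ring
  · have h := notMem_downRay_iff.1 hY.2
    rw [add_sub_cancel_left] at h
    rw [notMem_downRay_iff, add_sub_cancel_left]
    exact mul_mem_slitDomain h ht

end Pencil

section Profile

variable {U : ℂ → ℂ}

theorem norm_taylor_le {s : Set ℂ} {B : ℝ} {w z : ℂ} (hseg : segment ℝ w z ⊆ s)
    (hU : AnalyticOnNhd ℂ U s) (hB : ∀ y ∈ segment ℝ w z, ‖deriv (deriv U) y‖ ≤ B) :
    ‖U z - U w - deriv U w * (z - w)‖ ≤ B * ‖z - w‖ ^ 2 := by
  have hw := left_mem_segment ℝ w z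
  have hz := right_mem_segment ℝ w z
  have hB0 : 0 ≤ B := (norm_nonneg _).trans (hB w hw)
  have h1 : ∀ y ∈ segment ℝ w z, ‖deriv U y - deriv U w‖ ≤ B * ‖z - w‖ := fun y hy => by
    refine ((convex_segment w z).norm_image_sub_le_of_norm_hasDerivWithin_le
      (fun x hx => ((hU x (hseg hx)).deriv.differentiableAt.hasDerivAt).hasDerivWithinAt)
      hB hw hy).trans ?_
    gcongr
    exact norm_sub_le_of_mem_segment hy
  have h2 := (convex_segment w z).norm_image_sub_le_of_norm_hasDerivWithin_le
    (f := fun y => U y - deriv U w * y) (f' := fun y => deriv U y - deriv U w)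
    (fun x hx => by
      have h := (hU x (hseg hx)).differentiableAt.hasDerivAt.fun_sub
        ((hasDerivAt_id x).const_mul (deriv U w))
      rw [mul_one] at h
      exact h.hasDerivWithinAt) h1 hw hz
  calc ‖U z - U w - deriv U w * (z - w)‖
      = ‖(U z - deriv U w * z) - (U w - deriv U w * w)‖ := by congr 1; ring
    _ ≤ B * ‖z - w‖ * ‖z - w‖ := h2
    _ = _ := by ring

/-- Away from the origin a shear profile stays away from every `c ≠ U₊`. -/
theorem IsShearProfile.exists_le_norm_sub {β₀ β₁ Uplus β : ℝ} (hβ₀ : 0 < β₀) (hβ₁ : 0 < β₁)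
    (hU : IsShearProfile β₀ β₁ U Uplus β) {c : ℂ} (hc : c ≠ (Uplus : ℂ)) :
    ∃ M c₁ : ℝ, 0 < c₁ ∧ ∀ y ∈ pencil β₀ β₁, M ≤ y.re → c₁ ≤ ‖U y - c‖ := by
  obtain ⟨C, hC⟩ := hU.decay
  obtain ⟨C', γ, hγ, hC'⟩ := hU.tendsto
  have hβ := hU.rate_pos
  rw [iteratedDeriv_two_eq] at hC
  have hexp : ∀ x x' : ℝ, x ≤ x' → ∀ b : ℝ, 0 < b → Real.exp (-b * x') ≤ Real.exp (-b * x) :=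
    fun x x' h b hb => Real.exp_le_exp.2 (by nlinarith)
  have hC0 : 0 ≤ C := by
    have := (norm_nonneg _).trans (hC 0 (by simpa using ofReal_mem_pencil hβ₀ hβ₁ le_rfl))
    simpa using this
  have hC'0 : 0 ≤ C' := by
    have := (norm_nonneg _).trans (hC' 0 le_rfl)
    simpa using this
  -- A Taylor step of length 1 expresses U'(x) through U(x + 1) - U(x) and U'', all of which decay.
  have hd : ∀ x : ℝ, 0 ≤ x → ‖deriv U x‖
      ≤ C * Real.exp (-β * x) + 2 * (C' * Real.exp (-γ * x)) := by
    intro x hx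
    have hsub : segment ℝ (x : ℂ) ((x + 1 : ℝ) : ℂ) ⊆ pencil β₀ β₁ :=
      (convex_pencil β₀ β₁).segment_subset (ofReal_mem_pencil hβ₀ hβ₁ hx)
        (ofReal_mem_pencil hβ₀ hβ₁ (by linarith))
    have hre : ∀ y ∈ segment ℝ (x : ℂ) ((x + 1 : ℝ) : ℂ), x ≤ y.re := by
      rintro y ⟨a, b, ha, hb, hab, rfl⟩
      simp
      nlinarith
    have h1 := norm_taylor_le (B := C * Real.exp (-β * x)) hsub hU.analytic fun y hy =>
      (hC y (hsub hy)).trans (mul_le_mul_of_nonneg_left (hexp _ _ (hre y hy) β hβ) hC0)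
    have h2 : (((x + 1 : ℝ) : ℂ) - x) = 1 := by push_cast; ring
    rw [h2, norm_one, mul_one, one_pow, mul_one] at h1
    have h3 := hC' x hx
    have h4 := (hC' (x + 1) (by linarith)).trans
      (mul_le_mul_of_nonneg_left (hexp x (x + 1) (by linarith) γ hγ) hC'0)
    have he : deriv U x = (U ((x + 1 : ℝ) : ℂ) - Uplus) - (U x - Uplus)
        - (U ((x + 1 : ℝ) : ℂ) - U x - deriv U x) := by ring
    rw [he]
    refine (norm_sub_le _ _).trans ?_
    linarith [norm_sub_le (U ((x + 1 : ℝ) : ℂ) - Uplus) (U x - Uplus)]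
  set Bd : ℝ → ℝ := fun x => C * Real.exp (-β * x) * β₁ ^ 2
    + (C * Real.exp (-β * x) + 2 * (C' * Real.exp (-γ * x))) * β₁ + C' * Real.exp (-γ * x) with hBd
  -- Convergence is assumed on the real line only. A vertical Taylor step, of length at most β₁,
  -- carries it to the whole pencil.
  have hUy : ∀ y ∈ pencil β₀ β₁, ‖U y - Uplus‖ ≤ Bd y.re := by
    intro y hy
    have hx := ofReal_mem_pencil hβ₀ hβ₁ hy.2
    have hsub : segment ℝ ((y.re : ℝ) : ℂ) y ⊆ pencil β₀ β₁ :=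
      (convex_pencil β₀ β₁).segment_subset hx hy
    have hre : ∀ z ∈ segment ℝ ((y.re : ℝ) : ℂ) y, y.re ≤ z.re := by
      rintro z ⟨a, b, ha, hb, hab, rfl⟩
      simp [← add_mul, hab]
    have h1 := norm_taylor_le (B := C * Real.exp (-β * y.re)) hsub hU.analytic fun z hz =>
      (hC z (hsub hz)).trans (mul_le_mul_of_nonneg_left (hexp _ _ (hre z hz) β hβ) hC0)
    have h2 : ‖y - (y.re : ℂ)‖ ≤ β₁ := by
      have : y - (y.re : ℂ) = y.im * Complex.I := by
        apply Complex.ext <;> simp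
      rw [this, norm_mul, Complex.norm_I, mul_one, Complex.norm_real]
      exact hy.1.trans (min_le_right _ _)
    have h3 := hd y.re hy.2
    have h4 := hC' y.re hy.2
    have h5 : C * Real.exp (-β * y.re) * ‖y - (y.re : ℂ)‖ ^ 2
        ≤ C * Real.exp (-β * y.re) * β₁ ^ 2 := by gcongr
    have h6 : ‖deriv U y.re * (y - (y.re : ℂ))‖
        ≤ (C * Real.exp (-β * y.re) + 2 * (C' * Real.exp (-γ * y.re))) * β₁ := by
      rw [norm_mul]
      gcongr
    have he : U y - Uplus = (U y - U y.re - deriv U y.re * (y - (y.re : ℂ)))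
        + deriv U y.re * (y - (y.re : ℂ)) + (U y.re - Uplus) := by ring
    rw [he]
    refine (norm_add₃_le).trans ?_
    simp only [hBd]
    linarith
  have hlimexp : ∀ b : ℝ, 0 < b → Tendsto (fun x : ℝ => Real.exp (-b * x)) atTop (𝓝 0) :=
    fun b hb => Real.tendsto_exp_atBot.comp (tendsto_id.const_mul_atTop_of_neg (by linarith))
  have hlim : Tendsto Bd atTop (𝓝 0) := by
    have h1 := (hlimexp β hβ).const_mul C
    have h2 := (hlimexp γ hγ).const_mul C'
    have := ((h1.mul_const (β₁ ^ 2)).add ((h1.add (h2.const_mul 2)).mul_const β₁)).add h2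
    simpa [hBd] using this
  have hpos : 0 < ‖(Uplus : ℂ) - c‖ / 2 := by
    have : 0 < ‖(Uplus : ℂ) - c‖ := norm_pos_iff.2 (sub_ne_zero.2 hc.symm)
    positivity
  obtain ⟨M, hM⟩ := eventually_atTop.1 (hlim.eventually (gt_mem_nhds hpos))
  refine ⟨M, _, hpos, fun y hy hyM => ?_⟩
  have h1 := (hUy y hy).trans (hM y.re hyM).le
  have h2 := norm_sub_norm_le ((Uplus : ℂ) - c) ((Uplus : ℂ) - U y)
  have h3 : (Uplus : ℂ) - c - (Uplus - U y) = U y - c := by ring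
  rw [h3, norm_sub_rev (Uplus : ℂ) (U y)] at h2
  linarith

/-- The singularity at yc is removable; this is what makes the coefficients of the reduced equation
analytic there. -/
theorem analyticOnNhd_dslope {s : Set ℂ} {yc : ℂ} (hU : AnalyticOnNhd ℂ U s) :
    AnalyticOnNhd ℂ (dslope U yc) s := by
  intro y hy
  rw [Complex.analyticAt_iff_eventually_differentiableAt]
  rcases eq_or_ne y yc with rfl | hne
  · obtain ⟨r, hr, hball⟩ := Metric.eventually_nhds_iff_ball.1 (hU y hy).eventually_analyticAt
    have hd : DifferentiableOn ℂ U (Metric.ball y r) := fun z hz =>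
      (hball z hz).differentiableAt.differentiableWithinAt
    have := (Complex.differentiableOn_dslope (Metric.ball_mem_nhds y hr)).2 hd
    filter_upwards [Metric.ball_mem_nhds y hr] with z hz
    exact this.differentiableAt (Metric.isOpen_ball.mem_nhds hz)
  · filter_upwards [(hU y hy).eventually_analyticAt, isOpen_ne.mem_nhds hne] with z hz hzne
    exact (differentiableAt_dslope_of_ne hzne).2 hz.differentiableAt

theorem exists_powerSum_of_analyticAt {h : ℂ → ℂ} {yc : ℂ} (hh : AnalyticAt ℂ h yc) :
    ∃ r : ℝ, 0 < r ∧ ∃ (c : ℕ → ℂ) (N : ℝ), SeriesBound r c N ∧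
      ∀ Y, ‖Y‖ < r → h (yc + Y) = powerSum c Y := by
  obtain ⟨p, R, hp⟩ := hh
  obtain ⟨r, hr0, hrR⟩ := ENNReal.lt_iff_exists_nnreal_btwn.1 hp.r_pos
  refine ⟨r, by exact_mod_cast hr0, p.coeff, _, ⟨?_, le_rfl⟩, fun Y hY => ?_⟩
  · simpa using p.summable_norm_mul_pow (hrR.trans_le hp.r_le)
  · have hmem : Y ∈ Metric.eball (0 : ℂ) R := by
      rw [Metric.mem_eball, edist_zero_right]
      refine lt_trans ?_ hrR
      rw [← ofReal_norm, ENNReal.ofReal_lt_coe_iff (norm_nonneg _)]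
      exact hY
    have := hp.hasSum hmem
    rw [← this.tsum_eq]
    refine tsum_congr fun n => ?_
    rw [FormalMultilinearSeries.apply_eq_pow_smul_coeff, smul_eq_mul, mul_comm]

theorem SeriesBound.mono_radius {r ρ N : ℝ} {a : ℕ → ℂ} (h : SeriesBound r a N) (hρ : 0 ≤ ρ)
    (hρr : ρ ≤ r) : SeriesBound ρ a N := by
  have hle : ∀ n, ‖a n‖ * ρ ^ n ≤ ‖a n‖ * r ^ n := fun n => by gcongr
  have hs := Summable.of_nonneg_of_le (fun n => by positivity) hle h.1
  exact ⟨hs, (hs.tsum_le_tsum hle h.1).trans h.2⟩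

end Profile

end

/-! ### The Rayleigh equation near the critical point -/

section

open Filter

theorem AnalyticAt.comp_const_add {f : ℂ → ℂ} {a z : ℂ} (h : AnalyticAt ℂ f (a + z)) :
    AnalyticAt ℂ (fun z => f (a + z)) z :=
  AnalyticAt.comp (f := fun z : ℂ => a + z) h (analyticAt_const.add analyticAt_id)

theorem AnalyticAt.comp_sub_const {f : ℂ → ℂ} {a z : ℂ} (h : AnalyticAt ℂ f (z - a)) :
    AnalyticAt ℂ (fun z => f (z - a)) z :=
  AnalyticAt.comp (f := fun z : ℂ => z - a) h (analyticAt_id.sub analyticAt_const)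

theorem deriv_deriv_comp_sub_const (f : ℂ → ℂ) (a z : ℂ) :
    deriv (deriv fun z => f (z - a)) z = deriv (deriv f) (z - a) := by
  have : (deriv fun z => f (z - a)) = fun z => deriv f (z - a) := by
    funext z
    exact deriv_comp_sub_const f a z
  rw [this, deriv_comp_sub_const]

theorem dslope_mul_sub {U : ℂ → ℂ} {yc c : ℂ} (hc : U yc = c) (y : ℂ) :
    dslope U yc y * (y - yc) = U y - c := by
  have := sub_smul_dslope U yc y
  rw [smul_eq_mul, hc] at this
  rw [mul_comm, this]

section Center

variable {β₀ β₁ : ℝ} {U : ℂ → ℂ} {Uplus β : ℝ} {c yc : ℂ}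

theorem dslope_ne_zero (hcrit : ∀ y ∈ pencil β₀ β₁, U y = c ↔ y = yc)
    (hyc : yc ∈ pencil β₀ β₁) (hsimple : deriv U yc ≠ 0) {y : ℂ} (hy : y ∈ pencil β₀ β₁) :
    dslope U yc y ≠ 0 := by
  intro h
  have h1 := dslope_mul_sub ((hcrit yc hyc).2 rfl) y
  rw [h, zero_mul] at h1
  have h2 := (hcrit y hy).1 (sub_eq_zero.1 h1.symm)
  rw [h2, dslope_same] at h
  exact hsimple h

/-- The bounded part of the pencil is compact. Further out the inverse is (y - yc)/(U - c) with U -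
c bounded below, whence the linear growth. -/
theorem exists_norm_inv_dslope_le (hβ₀ : 0 < β₀) (hβ₁ : 0 < β₁)
    (hU : IsShearProfile β₀ β₁ U Uplus β) (hyc : yc ∈ pencil β₀ β₁)
    (hcrit : ∀ y ∈ pencil β₀ β₁, U y = c ↔ y = yc) (hsimple : deriv U yc ≠ 0)
    (hc : c ≠ (Uplus : ℂ)) :
    ∃ K : ℝ, 0 < K ∧ ∀ y ∈ pencil β₀ β₁, ‖(dslope U yc y)⁻¹‖ ≤ K * (1 + ‖y - yc‖) := by
  obtain ⟨M, c₁, hc₁, hM⟩ := hU.exists_le_norm_sub hβ₀ hβ₁ hc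
  have hcont : ContinuousOn (fun y => (dslope U yc y)⁻¹) (pencil β₀ β₁ ∩ {z | z.re ≤ M}) :=
    fun y hy => ((analyticOnNhd_dslope hU.analytic y hy.1).continuousAt.inv₀
      (dslope_ne_zero hcrit hyc hsimple hy.1)).continuousWithinAt
  obtain ⟨B, hB⟩ := (isCompact_pencil_inter β₀ β₁ M).exists_bound_of_continuousOn hcont
  refine ⟨max B 0 + 1 / c₁, by positivity, fun y hy => ?_⟩
  have hr := norm_nonneg (y - yc)
  have hB0 : 0 ≤ max B 0 := le_max_right _ _
  have hc0 : 0 < 1 / c₁ := by positivity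
  rcases le_total y.re M with h | h
  · have := (hB y ⟨hy, h⟩).trans (le_max_left B 0)
    nlinarith
  · have h1 := hM y hy h
    have hne := dslope_ne_zero hcrit hyc hsimple hy
    rw [← dslope_mul_sub ((hcrit yc hyc).2 rfl) y, norm_mul] at h1
    have hpos : 0 < ‖dslope U yc y‖ := norm_pos_iff.2 hne
    have h2 : ‖(dslope U yc y)⁻¹‖ ≤ 1 / c₁ * ‖y - yc‖ := by
      rw [norm_inv, inv_le_iff_one_le_mul₀ hpos]
      rw [← one_le_div₀ hc₁] at h1
      exact h1.trans_eq (by ring)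
    nlinarith

theorem norm_le_of_decay (hβ : 0 < β) {C : ℝ}
    (hC : ∀ y ∈ pencil β₀ β₁, ‖iteratedDeriv 2 U y‖ ≤ C * Real.exp (-β * y.re)) {y : ℂ}
    (hy : y ∈ pencil β₀ β₁) : ‖iteratedDeriv 2 U y‖ ≤ C := by
  have h1 := hC y hy
  have h2 : Real.exp (-β * y.re) ≤ 1 := Real.exp_le_one_iff.2 (by nlinarith [hy.2])
  have h3 := Real.exp_pos (-β * y.re)
  have h4 : 0 ≤ C := by
    by_contra hneg
    push Not at hneg
    nlinarith [norm_nonneg (iteratedDeriv 2 U y)]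
  nlinarith

theorem hasLogForm_iff {f : ℂ → ℂ} {a b : ℕ → ℂ} :
    HasLogForm β₀ β₁ yc f a b ↔
      ∀ᶠ y in 𝓝[slitPencil β₀ β₁ yc] yc, f y = logSum a b (y - yc) := Iff.rfl

theorem tendsto_add_slitPencil : Tendsto (fun Y => yc + Y)
    (𝓝[{Y | yc + Y ∈ slitPencil β₀ β₁ yc}] 0) (𝓝[slitPencil β₀ β₁ yc] yc) := by
  refine tendsto_nhdsWithin_iff.2 ⟨?_, self_mem_nhdsWithin⟩
  have : ContinuousAt (fun Y => yc + Y) 0 := by fun_prop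
  have := this.tendsto.mono_left
    (nhdsWithin_le_nhds (s := {Y | yc + Y ∈ slitPencil β₀ β₁ yc}))
  rwa [add_zero] at this

theorem tendsto_sub_slitPencil : Tendsto (fun y => y - yc) (𝓝[slitPencil β₀ β₁ yc] yc)
    (𝓝[{Y | yc + Y ∈ slitPencil β₀ β₁ yc}] 0) := by
  refine tendsto_nhdsWithin_iff.2 ⟨?_, ?_⟩
  · have : ContinuousAt (fun y => y - yc) yc := by fun_prop
    have := this.tendsto.mono_left (nhdsWithin_le_nhds (s := slitPencil β₀ β₁ yc))
    rwa [sub_self] at this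
  · filter_upwards [self_mem_nhdsWithin] with y hy
    simpa using hy

/-- Solutions of the Rayleigh equation on the slit pencil with prescribed behaviour at `yc`. -/
theorem exists_rayleigh_solution_from_center (hβ₀ : 0 < β₀) (hβ₁ : 0 < β₁)
    (hU : IsShearProfile β₀ β₁ U Uplus β) (hyc : yc ∈ pencil β₀ β₁)
    (hcrit : ∀ y ∈ pencil β₀ β₁, U y = c ↔ y = yc) (hsimple : deriv U yc ≠ 0)
    (hc : c ≠ (Uplus : ℂ)) (α : ℝ) :
    ∃ ρ₀ : ℝ, 0 < ρ₀ ∧ ∀ ρ : ℝ, 0 < ρ → ρ < ρ₀ →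
      (∃ (u : ℕ → ℂ) (M : ℝ), SeriesBound ρ u M ∧
        ∀ Y, ‖Y‖ < ρ → iteratedDeriv 2 U (yc + Y) = powerSum u Y) ∧
      ∀ L : ℝ, ∃ C : ℝ, 0 < C ∧ ∀ (f : ℂ → ℂ) (N : ℝ) (a b : ℕ → ℂ), 0 < N →
        AnalyticOnNhd ℂ f (slitPencil β₀ β₁ yc) → (∀ y ∈ slitPencil β₀ β₁ yc, ‖f y‖ ≤ N) →
        HasLogForm β₀ β₁ yc f a b → SeriesBound ρ a N → SeriesBound ρ b N →
        ∀ p₀ p₁ : ℂ, ‖p₀‖ ≤ N → ‖p₁‖ ≤ N → ∃ (φ : ℂ → ℂ) (p q : ℕ → ℂ),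
          AnalyticOnNhd ℂ φ (slitPencil β₀ β₁ yc) ∧
          (∀ y ∈ slitPencil β₀ β₁ yc, rayleigh U α c φ y = f y) ∧
          HasLogForm β₀ β₁ yc φ p q ∧ p 0 = p₀ ∧ p 1 = p₁ ∧
          (a 0 = 0 → p₀ = 0 → q 0 = 0) ∧
          SeriesBound ρ p (C * N) ∧ SeriesBound ρ q (C * N) ∧
          ∀ y ∈ slitPencil β₀ β₁ yc, ‖y - yc‖ ≤ L → ‖φ y‖ ≤ C * N := by
  obtain ⟨K₁, hK₁, hkK⟩ := exists_norm_inv_dslope_le hβ₀ hβ₁ hU hyc hcrit hsimple hc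
  obtain ⟨C₀, hC₀⟩ := hU.decay
  have hU2 : ∀ y ∈ pencil β₀ β₁, ‖iteratedDeriv 2 U y‖ ≤ C₀ := fun y hy =>
    norm_le_of_decay hU.rate_pos hC₀ hy
  have hC₀0 : 0 ≤ C₀ := (norm_nonneg _).trans (hU2 yc hyc)
  have hU2a : ∀ y ∈ pencil β₀ β₁, AnalyticAt ℂ (iteratedDeriv 2 U) y := fun y hy => by
    rw [iteratedDeriv_two_eq]
    exact (hU.analytic y hy).deriv.deriv
  have hka : ∀ y ∈ pencil β₀ β₁, AnalyticAt ℂ (fun y => (dslope U yc y)⁻¹) y := fun y hy =>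
    (analyticOnNhd_dslope hU.analytic y hy).inv (dslope_ne_zero hcrit hyc hsimple hy)
  -- Coefficient of φ in (y - yc) φ'' = w φ + f/`dslope U yc`.
  set w : ℂ → ℂ := fun y => (α : ℂ) ^ 2 * (y - yc) + iteratedDeriv 2 U y * (dslope U yc y)⁻¹
    with hw
  have hwa : ∀ y ∈ pencil β₀ β₁, AnalyticAt ℂ w y := fun y hy =>
    (analyticAt_const.mul (analyticAt_id.sub analyticAt_const)).add ((hU2a y hy).mul (hka y hy))
  have hwK : ∀ y ∈ pencil β₀ β₁, ‖w y‖ ≤ (α ^ 2 + C₀ * K₁) * (1 + ‖y - yc‖) := fun y hy => by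
    refine (norm_add_le _ _).trans ?_
    rw [norm_mul, norm_mul, norm_pow, Complex.norm_real, Real.norm_eq_abs, sq_abs]
    have h1 := hkK y hy
    have h2 := hU2 y hy
    have h3 := norm_nonneg (y - yc)
    calc _ ≤ α ^ 2 * ‖y - yc‖ + C₀ * (K₁ * (1 + ‖y - yc‖)) := by gcongr
      _ ≤ _ := by nlinarith [sq_nonneg α]
  obtain ⟨r₁, hr₁, Wc, N₁, hWc, hWeq⟩ := exists_powerSum_of_analyticAt (hwa yc hyc)
  obtain ⟨r₂, hr₂, kc, N₂, hkc, hkeq⟩ := exists_powerSum_of_analyticAt (hka yc hyc)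
  obtain ⟨r₃, hr₃, uc, N₃, huc, hueq⟩ := exists_powerSum_of_analyticAt (hU2a yc hyc)
  have hN₁ := hWc.nonneg hr₁.le
  have hN₂ := hkc.nonneg hr₂.le
  set K : ℝ := 1 + (α ^ 2 + C₀ * K₁) + K₁ + N₁ + N₂ with hK
  have hα2 := sq_nonneg α
  have hCK : 0 ≤ C₀ * K₁ := by positivity
  have hK1 : 1 ≤ K := by rw [hK]; linarith
  -- Three radii of convergence, and 1/(2K) to make the coefficient recursions contract.
  refine ⟨min (min r₁ r₂) (min r₃ (1 / (2 * K))), by positivity, fun ρ hρ hρlt => ?_⟩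
  obtain ⟨⟨h1, h2⟩, h3, h4⟩ : (ρ < r₁ ∧ ρ < r₂) ∧ ρ < r₃ ∧ ρ < 1 / (2 * K) := by
    simpa only [lt_min_iff] using hρlt
  refine ⟨⟨uc, N₃, huc.mono_radius hρ.le h3.le, fun Y hY => hueq Y (hY.trans h3)⟩, fun L => ?_⟩
  set S : Set ℂ := {Y | yc + Y ∈ slitPencil β₀ β₁ yc} with hS
  have hSs : S ⊆ slitDomain := fun Y hY => by
    simpa using notMem_downRay_iff.1 hY.2
  have hstar : ∀ Y ∈ S, ∀ t : ℝ, 0 < t → t ≤ 1 → (t : ℂ) * Y ∈ S := fun Y hY t ht ht1 =>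
    slitPencil_star hyc hY ht ht1
  have hρK : ρ * K ≤ 1 / 2 := by
    rw [lt_div_iff₀ (by positivity)] at h4
    linarith
  obtain ⟨C, hC, hmain⟩ := exists_solution_from_center hSs hstar hρ hK1 hρK
    ((hWc.mono_radius hρ.le h1.le).mono (by rw [hK]; linarith))
    ((hkc.mono_radius hρ.le h2.le).mono (by rw [hK]; linarith))
    (W := fun Y => w (yc + Y)) (k := fun Y => (dslope U yc (yc + Y))⁻¹)
    (fun Y hY => (hwa _ hY.1).comp_const_add) (fun Y hY => (hka _ hY.1).comp_const_add)
    (fun Y hY => hWeq Y (hY.trans h1)) (fun Y hY => hkeq Y (hY.trans h2))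
    (fun Y hY => (hwK _ hY.1).trans (by rw [add_sub_cancel_left]; gcongr; rw [hK]; linarith))
    (fun Y hY => (hkK _ hY.1).trans (by rw [add_sub_cancel_left]; gcongr; rw [hK]; linarith)) L
  refine ⟨C, hC, fun f N a b hN hf hfN hfab ha hb p₀ p₁ hp₀ hp₁ => ?_⟩
  obtain ⟨Φ, p, q, hΦ, hode, hpq, hp0, hp1, hq0, hp, hq, hΦL⟩ := hmain (fun Y => f (yc + Y)) N a b
    hN (fun Y hY => (hf _ hY).comp_const_add) (fun Y hY => hfN _ hY)
    (by
      filter_upwards [tendsto_add_slitPencil.eventually (hasLogForm_iff.1 hfab)] with Y hY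
      rwa [add_sub_cancel_left] at hY)
    ha hb p₀ p₁ hp₀ hp₁
  have hmem : ∀ y ∈ slitPencil β₀ β₁ yc, y - yc ∈ S := fun y hy => by
    simpa [hS] using hy
  refine ⟨fun y => Φ (y - yc), p, q, fun y hy => (hΦ _ (hmem y hy)).comp_sub_const,
    fun y hy => ?_, tendsto_sub_slitPencil.eventually hpq, hp0, hp1, fun ha0 hp₀0 => ?_, hp, hq,
    fun y hy hyL => hΦL _ (hmem y hy) hyL⟩
  · have h := hode _ (hmem y hy)
    have hne := dslope_ne_zero hcrit hyc hsimple hy.1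
    have hY0 := ne_zero_of_mem_slitDomain (hSs (hmem y hy))
    have hs := dslope_mul_sub ((hcrit yc hyc).2 rfl) y
    have hinv := mul_inv_cancel₀ hne
    simp only [add_sub_cancel, hw] at h
    simp only [rayleigh, vorticityTerm, iteratedDeriv_two_eq, deriv_deriv_comp_sub_const] at h ⊢
    rw [← hs]
    linear_combination (dslope U yc y) * h
      + (deriv (deriv U) y * Φ (y - yc) + f y) * hinv
  · rw [hq0, ha0, hp₀0]
    simp

end Center

end

/-! ### Cauchy uniqueness, decaying solutions on a half strip, reading off coefficients -/

section

open Filter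

/-- Uniqueness for the analytic Cauchy problem `d'' = V d`. -/
theorem eqOn_zero_of_cauchy_data {S : Set ℂ} (hS : IsPreconnected S) {d V : ℂ → ℂ} {z₀ : ℂ}
    (hz₀ : z₀ ∈ S) (hd : AnalyticOnNhd ℂ d S) (hV : ContinuousAt V z₀)
    (hode : ∀ᶠ z in 𝓝 z₀, deriv (deriv d) z = V z * d z) (h0 : d z₀ = 0)
    (h1 : deriv d z₀ = 0) : Set.EqOn d 0 S := by
  refine hd.eqOn_zero_of_preconnected_of_eventuallyEq_zero hS hz₀ ?_
  set B := ‖V z₀‖ + 1 with hB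
  have hBpos : 0 < B := by positivity
  have hVB : ∀ᶠ z in 𝓝 z₀, ‖V z‖ < B := hV.norm.eventually (gt_mem_nhds (by rw [hB]; linarith))
  obtain ⟨r, hr, hball⟩ := Metric.eventually_nhds_iff_ball.1
    (hode.and (hVB.and (hd z₀ hz₀).eventually_analyticAt))
  -- As B ≥ 1, this choice gives B s² < 1, the contraction factor.
  set s := min (r / 2) (1 / (2 * B)) with hs
  have hs0 : 0 < s := by positivity
  have hsr : Metric.closedBall z₀ s ⊆ Metric.ball z₀ r :=
    Metric.closedBall_subset_ball ((min_le_left _ _).trans_lt (by linarith))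
  have hsB : B * s ^ 2 < 1 ∨ 1 ≤ s := by
    rcases lt_or_ge s 1 with h | h
    · left
      have h2 : s ≤ 1 / (2 * B) := min_le_right _ _
      have h3 : B * s ≤ 1 / 2 := by
        calc B * s ≤ B * (1 / (2 * B)) := by gcongr
          _ = 1 / 2 := by field_simp
      nlinarith
    · exact Or.inr h
  have hBs : B * s ^ 2 < 1 := hsB.resolve_right fun h => by
    have h2 : s ≤ 1 / (2 * B) := min_le_right _ _
    have h3 : 1 / (2 * B) ≤ 1 / 2 := by
      apply one_div_le_one_div_of_le <;> [norm_num; skip]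
      rw [hB]; linarith [norm_nonneg (V z₀)]
    linarith
  have hcont : ContinuousOn (fun z => ‖d z‖) (Metric.closedBall z₀ s) := fun z hz =>
    (hball z (hsr hz)).2.2.continuousAt.norm.continuousWithinAt
  -- At a maximum m of |d| on the disc, Taylor's formula with zero Cauchy data gives |d m| ≤ B s² |d
  -- m|.
  obtain ⟨m, hm, hmax⟩ := (isCompact_closedBall z₀ s).exists_isMaxOn
    ⟨z₀, Metric.mem_closedBall_self hs0.le⟩ hcont
  have hseg : segment ℝ z₀ m ⊆ Metric.closedBall z₀ s :=
    (convex_closedBall z₀ s).segment_subset (Metric.mem_closedBall_self hs0.le) hm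
  have ht := norm_taylor_le (U := d) (B := B * ‖d m‖) (hseg.trans hsr)
    (fun z hz => (hball z hz).2.2) fun z hz => by
      have hz' := hball z (hsr (hseg hz))
      rw [hz'.1, norm_mul]
      exact mul_le_mul hz'.2.1.le (hmax (hseg hz)) (norm_nonneg _) hBpos.le
  rw [h0, h1, zero_mul, sub_zero, sub_zero] at ht
  have hm0 : ‖d m‖ ≤ 0 := by
    have h2 : ‖m - z₀‖ ^ 2 ≤ s ^ 2 := by
      gcongr
      exact mem_closedBall_iff_norm.1 hm
    have h3 := norm_nonneg (d m)
    have h4 : B * ‖d m‖ * ‖m - z₀‖ ^ 2 ≤ B * ‖d m‖ * s ^ 2 := by gcongr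
    nlinarith
  filter_upwards [Metric.closedBall_mem_nhds z₀ hs0] with z hz
  exact norm_le_zero_iff.1 ((hmax hz).trans hm0)

/-- The open half strip `Re z > M`, `|Im z| < β₁`. -/
def halfStrip (β₁ M : ℝ) : Set ℂ := {z | M < z.re ∧ |z.im| < β₁}

theorem isRightInvariant_halfStrip (β₁ M : ℝ) : IsRightInvariant (halfStrip β₁ M) where
  isOpen := (isOpen_lt continuous_const Complex.continuous_re).inter
    (isOpen_lt (continuous_abs.comp Complex.continuous_im) continuous_const)
  add_mem := fun ξ hξ t ht => by
    refine ⟨?_, by simpa using hξ.2⟩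
    have := hξ.1
    simp only [Complex.add_re, Complex.ofReal_re]
    linarith

theorem convex_halfStrip (β₁ M : ℝ) : Convex ℝ (halfStrip β₁ M) := by
  intro x hx y hy a b ha hb hab
  have him : (a • x + b • y).im = a * x.im + b * y.im := by simp
  have hre : (a • x + b • y).re = a * x.re + b * y.re := by simp
  have hx' := abs_lt.1 hx.2
  have hy' := abs_lt.1 hy.2
  have h1 := (convex_Ioi M) hx.1 hy.1 ha hb hab
  have h2 := (convex_Ioo (-β₁) β₁) hx' hy' ha hb hab
  simp only [smul_eq_mul] at h1 h2
  refine ⟨by rw [hre]; exact h1, ?_⟩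
  rw [him]
  exact abs_lt.2 h2

theorem isTailWeight_exp {δ : ℝ} (hδ : 0 < δ) :
    IsTailWeight (fun x => Real.exp (-δ * x)) (fun x => Real.exp (-δ * x) / δ) where
  antitone := fun x y hxy => Real.exp_le_exp.2 (by nlinarith)
  nonneg := fun x => (Real.exp_pos _).le
  hasDerivAt := fun x => by
    refine (((hasDerivAt_id x).const_mul (-δ)).exp.div_const δ).congr_deriv ?_
    simp only [id]
    field_simp
  tendsto := by
    have : Tendsto (fun x : ℝ => Real.exp (-δ * x)) atTop (𝓝 0) :=
      Real.tendsto_exp_atBot.comp (tendsto_id.const_mul_atTop_of_neg (by linarith))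
    simpa using this.div_const δ

/-- Decaying solutions of `φ'' = (α² + V) φ + g` on a half strip. -/
theorem exists_solution_on_halfStrip {α σ β β₁ M K : ℝ} (hα : 0 < α) (hσ : α < σ) (hβ : 0 < β)
    (hM : 0 ≤ M) (hK : 0 ≤ K) {V : ℂ → ℂ} (hV : DifferentiableOn ℂ V (halfStrip β₁ M))
    (hVK : ∀ y ∈ halfStrip β₁ M, ‖V y‖ ≤ K * Real.exp (-β * y.re)) :
    ∃ C : ℝ, 0 < C ∧ ∀ (g : ℂ → ℂ) (N : ℝ), 0 ≤ N → DifferentiableOn ℂ g (halfStrip β₁ M) →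
      (∀ y ∈ halfStrip β₁ M, ‖g y‖ ≤ N * Real.exp (-σ * y.re)) →
      ∃ φ : ℂ → ℂ, DifferentiableOn ℂ φ (halfStrip β₁ M) ∧
        (∀ y ∈ halfStrip β₁ M, deriv (deriv φ) y = ((α : ℂ) ^ 2 + V y) * φ y + g y) ∧
        ∀ y ∈ halfStrip β₁ M, ‖φ y‖ ≤ C * N * Real.exp (-α * y.re) := by
  set H := halfStrip β₁ M with hH
  have hHr := isRightInvariant_halfStrip β₁ M
  -- Rate common to the potential V and to the source exp (α y) g of the equation for w = exp (α y)
  -- φ.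
  set δ := min β (σ - α) with hδ
  have hδ0 : 0 < δ := lt_min hβ (by linarith)
  refine ⟨2 / (2 * α) * (1 / δ * Real.exp (2 * K / (2 * α) * (1 / δ))), by positivity,
    fun g N hN hg hgN => ?_⟩
  have hexp : ∀ b : ℝ, ∀ y : ℂ, ‖Complex.exp ((b : ℂ) * y)‖ = Real.exp (b * y.re) := fun b y => by
    rw [Complex.norm_exp, Complex.re_ofReal_mul]
  have hd : ∀ b : ℝ, ∀ y : ℂ, HasDerivAt (fun y : ℂ => Complex.exp ((b : ℂ) * y))
      (Complex.exp ((b : ℂ) * y) * b) y := fun b y => by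
    simpa using ((hasDerivAt_id y).const_mul (b : ℂ)).cexp
  have hle : ∀ b : ℝ, δ ≤ b → ∀ y ∈ H, Real.exp (-b * y.re) ≤ Real.exp (-δ * y.re) :=
    fun b hb y hy => Real.exp_le_exp.2 (by
      have : 0 < y.re := hM.trans_lt hy.1
      nlinarith)
  obtain ⟨w, hwd, hode, hwb⟩ := exists_volterra_solution (a := 2 * α) (K := K) (N := N) (q := V)
    (R := fun y => Complex.exp ((α : ℂ) * y) * g y) hHr (isTailWeight_exp hδ0) (by positivity)
    hK hN hV
    (DifferentiableOn.mul (fun y _ => (hd α y).differentiableAt.differentiableWithinAt) hg)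
    (fun y hy => (hVK y hy).trans
      (mul_le_mul_of_nonneg_left (hle β (min_le_left _ _) y hy) hK))
    (fun y hy => by
      rw [norm_mul, hexp]
      have h1 := hgN y hy
      have h2 := hle (σ - α) (min_le_right _ _) y hy
      calc Real.exp (α * y.re) * ‖g y‖ ≤ Real.exp (α * y.re) * (N * Real.exp (-σ * y.re)) := by
            gcongr
        _ = N * Real.exp (-(σ - α) * y.re) := by
            rw [mul_left_comm, ← Real.exp_add]
            ring_nf
        _ ≤ _ := by gcongr)
  set φ : ℂ → ℂ := fun y => Complex.exp (((-α : ℝ) : ℂ) * y) * w y with hφ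
  have hw1 : ∀ y ∈ H, HasDerivAt w (deriv w y) y := fun y hy =>
    (hwd.differentiableAt (hHr.isOpen.mem_nhds hy)).hasDerivAt
  have hw2 : ∀ y ∈ H, HasDerivAt (deriv w) (deriv (deriv w) y) y := fun y hy =>
    ((hwd.deriv hHr.isOpen).differentiableAt (hHr.isOpen.mem_nhds hy)).hasDerivAt
  have hφ1 : ∀ y ∈ H, HasDerivAt φ
      (Complex.exp (((-α : ℝ) : ℂ) * y) * (deriv w y - α * w y)) y := fun y hy => by
    refine ((hd (-α) y).fun_mul (hw1 y hy)).congr_deriv ?_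
    push_cast
    ring
  have hφ2 : ∀ y ∈ H, deriv (deriv φ) y = Complex.exp (((-α : ℝ) : ℂ) * y)
      * (deriv (deriv w) y - 2 * α * deriv w y + (α : ℂ) ^ 2 * w y) := fun y hy => by
    have hev : deriv φ =ᶠ[𝓝 y]
        fun y => Complex.exp (((-α : ℝ) : ℂ) * y) * (deriv w y - α * w y) := by
      filter_upwards [hHr.isOpen.mem_nhds hy] with z hz using (hφ1 z hz).deriv
    rw [hev.deriv_eq, ((hd (-α) y).fun_mul
      ((hw2 y hy).fun_sub ((hw1 y hy).const_mul (α : ℂ)))).deriv]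
    push_cast
    ring
  refine ⟨φ, fun y hy => (hφ1 y hy).differentiableAt.differentiableWithinAt, fun y hy => ?_,
    fun y hy => ?_⟩
  · have h1 := hode y hy
    have h2 : Complex.exp (((-α : ℝ) : ℂ) * y) * Complex.exp ((α : ℂ) * y) = 1 := by
      rw [← Complex.exp_add]
      push_cast
      simp
    rw [hφ2 y hy]
    simp only [hφ]
    push_cast at h1 h2 ⊢
    linear_combination Complex.exp (-(α : ℂ) * y) * h1 + g y * h2
  · have h1 := hwb y hy
    have h2 : Real.exp (-δ * y.re) / δ ≤ 1 / δ := by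
      gcongr
      refine Real.exp_le_one_iff.2 ?_
      have : 0 < y.re := hM.trans_lt hy.1
      nlinarith
    have h3 : 2 / (2 * α) * (N * (Real.exp (-δ * y.re) / δ)
        * Real.exp (2 * K / (2 * α) * (Real.exp (-δ * y.re) / δ)))
        ≤ 2 / (2 * α) * (N * (1 / δ) * Real.exp (2 * K / (2 * α) * (1 / δ))) := by gcongr
    rw [hφ, norm_mul, hexp]
    calc _ ≤ Real.exp (-α * y.re) * (2 / (2 * α) * (N * (1 / δ)
          * Real.exp (2 * K / (2 * α) * (1 / δ)))) := by
          gcongr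
          exact h1.trans h3
      _ = _ := by ring

section Linear

variable {β₀ β₁ ρ M N : ℝ} {yc A c : ℂ} {U f g : ℂ → ℂ} {a b a' b' : ℕ → ℂ} {α : ℝ}

theorem hasLogForm_add_const_mul (hρ : 0 < ρ) (ha : SeriesBound ρ a N) (hb : SeriesBound ρ b N)
    (ha' : SeriesBound ρ a' M) (hb' : SeriesBound ρ b' M) (hf : HasLogForm β₀ β₁ yc f a b)
    (hg : HasLogForm β₀ β₁ yc g a' b') (A : ℂ) :
    HasLogForm β₀ β₁ yc (fun y => f y + A * g y) (fun n => a n + A * a' n)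
      (fun n => b n + A * b' n) := by
  rw [hasLogForm_iff] at hf hg ⊢
  filter_upwards [hf, hg, nhdsWithin_le_nhds (Metric.ball_mem_nhds yc hρ)] with y h1 h2 h3
  have hy : ‖y - yc‖ ≤ ρ := (mem_ball_iff_norm.1 h3).le
  have hA : ∀ x : ℕ → ℂ, powerSum (fun n => A * x n) (y - yc) = A * powerSum x (y - yc) :=
    fun x => by
      unfold powerSum
      simp_rw [mul_assoc]
      exact tsum_mul_left
  rw [h1, h2]
  unfold logSum
  rw [ha.powerSum_add (ha'.const_mul A) hy, hb.powerSum_add (hb'.const_mul A) hy, hA, hA]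
  ring

theorem rayleigh_add_const_mul {y : ℂ} (hf : AnalyticAt ℂ f y) (hg : AnalyticAt ℂ g y) (A : ℂ) :
    rayleigh U α c (fun y => f y + A * g y) y = rayleigh U α c f y + A * rayleigh U α c g y := by
  unfold rayleigh vorticityTerm
  have h1 : AnalyticAt ℂ (fun y => A * g y) y := analyticAt_const.mul hg
  rw [iteratedDeriv_two_eq (fun y => f y + A * g y), deriv_deriv_add hf h1,
    deriv_deriv_const_mul A hg, iteratedDeriv_two_eq f, iteratedDeriv_two_eq g]
  ring

theorem deriv_deriv_eq_of_rayleigh_eq {φ : ℂ → ℂ} {y : ℂ} (hUc : U y - c ≠ 0)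
    (h : rayleigh U α c φ y = f y) : deriv (deriv φ) y
      = ((α : ℂ) ^ 2 + iteratedDeriv 2 U y / (U y - c)) * φ y + f y / (U y - c) := by
  unfold rayleigh vorticityTerm at h
  rw [iteratedDeriv_two_eq φ] at h
  field_simp
  linear_combination h

/-- Letting t tend to 0 along a single ray isolates a₀. With the next lemma this gives the
independence of the two homogeneous solutions. -/
theorem coeff_zero_eq_zero_of_logSum_eventually_eq_zero (hρ : 0 < ρ) (ha : SeriesBound ρ a N)
    (hb : SeriesBound ρ b N) {Y : ℂ} (hY : Y ∈ slitDomain)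
    (h : ∀ᶠ t : ℝ in 𝓝[>] 0, logSum a b (t * Y) = 0) : a 0 = 0 := by
  have hlim : Tendsto (fun t : ℝ => N / ρ * ‖(t : ℂ) * Y‖
      + 7 * N * (√‖(t : ℂ) * Y‖ + ‖(t : ℂ) * Y‖ ^ 2)) (𝓝[>] 0) (𝓝 0) := by
    have hc : Continuous fun t : ℝ => N / ρ * ‖(t : ℂ) * Y‖
        + 7 * N * (√‖(t : ℂ) * Y‖ + ‖(t : ℂ) * Y‖ ^ 2) := by fun_prop
    have := (hc.tendsto 0).mono_left (nhdsWithin_le_nhds (s := Set.Ioi 0))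
    simpa using this
  have hsmall : ∀ᶠ t : ℝ in 𝓝[>] 0, ‖(t : ℂ) * Y‖ < ρ := by
    have hc : Continuous fun t : ℝ => ‖(t : ℂ) * Y‖ := by fun_prop
    refine nhdsWithin_le_nhds (hc.continuousAt.eventually (gt_mem_nhds ?_))
    simpa using hρ
  have : ‖a 0‖ ≤ 0 := by
    refine ge_of_tendsto hlim ?_
    filter_upwards [h, hsmall, self_mem_nhdsWithin] with t h1 h2 h3
    have := norm_logSum_sub_le hρ ha hb (mul_mem_slitDomain hY h3) h2.le
    rwa [h1, zero_sub, norm_neg] at this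
  exact norm_le_zero_iff.1 this

/-- Once a₀ = b₀ = 0 the singular part is a₁ Y alone; dividing by |Y| leaves an error tending to 0.
Without b₀ = 0 the term Y log Y would dominate. -/
theorem coeff_one_eq_zero_of_logSum_eventually_eq_zero (hρ : 0 < ρ) (ha : SeriesBound ρ a N)
    (hb : SeriesBound ρ b N) {Y : ℂ} (hY : Y ∈ slitDomain)
    (h : ∀ᶠ t : ℝ in 𝓝[>] 0, logSum a b (t * Y) = 0) (ha0 : a 0 = 0) (hb0 : b 0 = 0) :
    a 1 = 0 := by
  set cst := N / ρ / ρ + 7 * (N / ρ) with hcst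
  have hlim : Tendsto (fun t : ℝ => cst * (√‖(t : ℂ) * Y‖ + ‖(t : ℂ) * Y‖ ^ 2)) (𝓝[>] 0)
      (𝓝 0) := by
    have hc : Continuous fun t : ℝ => cst * (√‖(t : ℂ) * Y‖ + ‖(t : ℂ) * Y‖ ^ 2) := by fun_prop
    have := (hc.tendsto 0).mono_left (nhdsWithin_le_nhds (s := Set.Ioi 0))
    simpa using this
  have hsmall : ∀ᶠ t : ℝ in 𝓝[>] 0, ‖(t : ℂ) * Y‖ < ρ := by
    have hc : Continuous fun t : ℝ => ‖(t : ℂ) * Y‖ := by fun_prop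
    refine nhdsWithin_le_nhds (hc.continuousAt.eventually (gt_mem_nhds ?_))
    simpa using hρ
  have : ‖a 1‖ ≤ 0 := by
    refine ge_of_tendsto hlim ?_
    filter_upwards [h, hsmall, self_mem_nhdsWithin] with t h1 h2 h3
    have hmem := mul_mem_slitDomain hY h3
    have hpos : 0 < ‖(t : ℂ) * Y‖ := norm_pos_iff.2 (ne_zero_of_mem_slitDomain hmem)
    have := norm_logSum_sub_singularPart_le hρ ha hb hmem h2.le
    rw [h1, ha0, hb0, singularPart, zero_sub, norm_neg, zero_add, zero_mul, add_zero,
      norm_mul, ← hcst] at this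
    refine le_of_mul_le_mul_right ?_ hpos
    linarith
  exact norm_le_zero_iff.1 this

end Linear

end

/-! ### Matching the solution at the critical point with the decaying one -/

section

open Filter

theorem exists_linear_combination_eq {u₁ u₂ v₁ v₂ e₁ e₂ : ℂ} (hΔ : u₁ * v₂ - u₂ * v₁ ≠ 0)
    {E : ℝ} (h₁ : ‖e₁‖ ≤ E) (h₂ : ‖e₂‖ ≤ E) :
    ∃ A B : ℂ, A * u₁ + B * u₂ = e₁ ∧ A * v₁ + B * v₂ = e₂ ∧
      ‖A‖ ≤ (‖u₁‖ + ‖u₂‖ + ‖v₁‖ + ‖v₂‖) / ‖u₁ * v₂ - u₂ * v₁‖ * E ∧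
      ‖B‖ ≤ (‖u₁‖ + ‖u₂‖ + ‖v₁‖ + ‖v₂‖) / ‖u₁ * v₂ - u₂ * v₁‖ * E := by
  have hE : 0 ≤ E := (norm_nonneg _).trans h₁
  refine ⟨(e₁ * v₂ - e₂ * u₂) / (u₁ * v₂ - u₂ * v₁), (e₂ * u₁ - e₁ * v₁) / (u₁ * v₂ - u₂ * v₁),
    ?_, ?_, ?_, ?_⟩
  · rw [div_mul_eq_mul_div, div_mul_eq_mul_div, ← add_div, div_eq_iff hΔ]
    ring
  · rw [div_mul_eq_mul_div, div_mul_eq_mul_div, ← add_div, div_eq_iff hΔ]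
    ring
  · rw [norm_div, div_mul_eq_mul_div]
    gcongr
    refine (norm_sub_le _ _).trans ?_
    rw [norm_mul, norm_mul]
    nlinarith [norm_nonneg u₁, norm_nonneg u₂, norm_nonneg v₁, norm_nonneg v₂]
  · rw [norm_div, div_mul_eq_mul_div]
    gcongr
    refine (norm_sub_le _ _).trans ?_
    rw [norm_mul, norm_mul]
    nlinarith [norm_nonneg u₁, norm_nonneg u₂, norm_nonneg v₁, norm_nonneg v₂]

/-- If the determinant vanished, both columns of the adjugate would lie in the trivial kernel, so
all entries would be 0, and then the kernel would be everything. -/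
theorem det_ne_zero_of_forall {u₁ u₂ v₁ v₂ : ℂ}
    (h : ∀ A B : ℂ, A * u₁ + B * u₂ = 0 → A * v₁ + B * v₂ = 0 → A = 0 ∧ B = 0) :
    u₁ * v₂ - u₂ * v₁ ≠ 0 := by
  intro hdet
  obtain ⟨h1, h2⟩ := h v₂ (-v₁) (by linear_combination hdet) (by ring)
  obtain ⟨h3, h4⟩ := h (-u₂) u₁ (by ring) (by linear_combination hdet)
  have h5 := h 1 0 (by rw [h4]; ring) (by rw [neg_eq_zero.1 h2]; ring)
  exact one_ne_zero h5.1

section Matching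

variable {β₀ β₁ : ℝ} {U : ℂ → ℂ} {Uplus β : ℝ} {c yc : ℂ}

theorem norm_deriv_le_of_halfStrip {φ : ℂ → ℂ} {M B : ℝ} {z : ℂ} {r : ℝ} (hr : 0 < r)
    (hball : Metric.closedBall z r ⊆ halfStrip β₁ M) (hφ : AnalyticOnNhd ℂ φ (halfStrip β₁ M))
    (hB : ∀ y ∈ Metric.closedBall z r, ‖φ y‖ ≤ B) : ‖deriv φ z‖ ≤ B / r :=
  Complex.norm_deriv_le_of_forall_mem_sphere_norm_le hr
    ((hφ.differentiableOn.mono hball).diffContOnCl_ball le_rfl) fun y hy =>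
      hB y (Metric.sphere_subset_closedBall hy)

set_option maxHeartbeats 1600000 in
/-- The decaying solution of the Rayleigh equation on the slit pencil. -/
theorem exists_decaying_rayleigh_solution (hβ₀ : 0 < β₀) (hβ₁ : 0 < β₁)
    (hU : IsShearProfile β₀ β₁ U Uplus β) (hyc : yc ∈ pencil β₀ β₁)
    (hcrit : ∀ y ∈ pencil β₀ β₁, U y = c ↔ y = yc) (hsimple : deriv U yc ≠ 0)
    (hc : c ≠ (Uplus : ℂ)) {α σ : ℝ} (hα : 0 < α) (hσ : α < σ) :
    ∃ ρ₀ : ℝ, 0 < ρ₀ ∧ ∀ ρ : ℝ, 0 < ρ → ρ < ρ₀ →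
      (∃ (u : ℕ → ℂ) (M : ℝ), SeriesBound ρ u M ∧
        ∀ Y, ‖Y‖ < ρ → iteratedDeriv 2 U (yc + Y) = powerSum u Y) ∧
      ∃ C : ℝ, 0 < C ∧ ∀ (f : ℂ → ℂ) (N : ℝ) (a b : ℕ → ℂ), 0 < N →
        AnalyticOnNhd ℂ f (slitPencil β₀ β₁ yc) →
        (∀ y ∈ slitPencil β₀ β₁ yc, ‖f y‖ ≤ N * Real.exp (-σ * y.re)) →
        HasLogForm β₀ β₁ yc f a b → SeriesBound ρ a N → SeriesBound ρ b N →
        ∃ (φ : ℂ → ℂ) (p q : ℕ → ℂ), AnalyticOnNhd ℂ φ (slitPencil β₀ β₁ yc) ∧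
          (∀ y ∈ slitPencil β₀ β₁ yc, rayleigh U α c φ y = f y) ∧
          HasLogForm β₀ β₁ yc φ p q ∧ SeriesBound ρ p (C * N) ∧ SeriesBound ρ q (C * N) ∧
          ∀ y ∈ slitPencil β₀ β₁ yc, ‖φ y‖ ≤ C * N * Real.exp (-α * y.re) := by
  obtain ⟨ρ₀, hρ₀, hcenter⟩ :=
    exists_rayleigh_solution_from_center hβ₀ hβ₁ hU hyc hcrit hsimple hc α
  refine ⟨ρ₀, hρ₀, fun ρ hρ hρlt => ?_⟩
  obtain ⟨hu, hcen⟩ := hcenter ρ hρ hρlt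
  refine ⟨hu, ?_⟩
  obtain ⟨M₁, c₁, hc₁, hM₁⟩ := hU.exists_le_norm_sub hβ₀ hβ₁ hc
  obtain ⟨C₀, hC₀⟩ := hU.decay
  have hβ := hU.rate_pos
  have hC₀0 : 0 ≤ C₀ := (norm_nonneg _).trans (norm_le_of_decay hβ hC₀ hyc)
  set P := slitPencil β₀ β₁ yc with hP
  -- To the right of M, U - c is bounded below, the strip |Im y| < β₁ lies in the pencil, and the
  -- slit has been passed.
  set M := max (max M₁ (β₁ / β₀)) yc.re with hM
  have hMM₁ : M₁ ≤ M := (le_max_left _ _).trans (le_max_left _ _)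
  have hMβ : β₁ / β₀ ≤ M := (le_max_right _ _).trans (le_max_left _ _)
  have hMyc : yc.re ≤ M := le_max_right _ _
  have hM0 : 0 ≤ M := (by positivity : (0 : ℝ) ≤ β₁ / β₀).trans hMβ
  set H := halfStrip β₁ M with hH
  have hHo : IsOpen H := (isRightInvariant_halfStrip β₁ M).isOpen
  have hHpen : H ⊆ pencil β₀ β₁ := fun y hy => by
    refine ⟨le_min ?_ hy.2.le, hM0.trans hy.1.le⟩
    refine hy.2.le.trans ?_
    have := hMβ.trans hy.1.le
    rwa [div_le_iff₀ hβ₀, mul_comm] at this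
  have hPre : ∀ y : ℂ, M < y.re → y ∉ downRay yc := fun y hy => by
    rw [notMem_downRay_iff]
    left
    rw [Complex.sub_re]
    linarith
  have hHP : H ⊆ P := fun y hy => ⟨hHpen hy, hPre y hy.1⟩
  -- The matching point; r is chosen so that its disc stays in the half strip, which gives Cauchy
  -- bounds for derivatives at z₀.
  set z₀ : ℂ := ((M + 1 : ℝ) : ℂ) with hz₀
  set r : ℝ := min (1 / 2) (β₁ / 2) with hr
  have hr0 : 0 < r := by positivity
  have hr1 : r ≤ 1 / 2 := min_le_left _ _
  have hr2 : r ≤ β₁ / 2 := min_le_right _ _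
  have hballre : ∀ y ∈ Metric.closedBall z₀ r, M < y.re ∧ y.re ≤ M + 2 ∧ |y.im| < β₁ := by
    intro y hy
    have h1 := (Complex.abs_re_le_norm (y - z₀)).trans (mem_closedBall_iff_norm.1 hy)
    have h2 := (Complex.abs_im_le_norm (y - z₀)).trans (mem_closedBall_iff_norm.1 hy)
    rw [Complex.sub_re, hz₀, Complex.ofReal_re] at h1
    rw [Complex.sub_im, hz₀, Complex.ofReal_im, sub_zero] at h2
    have h3 := abs_le.1 h1
    exact ⟨by linarith, by linarith, by linarith⟩
  have hballH : Metric.closedBall z₀ r ⊆ H := fun y hy =>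
    ⟨(hballre y hy).1, (hballre y hy).2.2⟩
  have hz₀H : z₀ ∈ H := hballH (Metric.mem_closedBall_self hr0.le)
  have hz₀P : z₀ ∈ P := hHP hz₀H
  set L := M + 2 + 2 * β₁ with hL
  have hnear : ∀ y ∈ P, y.re ≤ M + 2 → ‖y - yc‖ ≤ L := by
    intro y hy hyM
    refine (Complex.norm_le_abs_re_add_abs_im _).trans ?_
    rw [Complex.sub_re, Complex.sub_im]
    have h1 : |y.re - yc.re| ≤ M + 2 :=
      abs_le.2 ⟨by linarith [hy.1.2], by linarith [hyc.2]⟩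
    have h2 := abs_sub y.im yc.im
    have h3 := hy.1.1.trans (min_le_right _ _)
    have h4 := hyc.1.trans (min_le_right _ _)
    rw [hL]
    linarith
  obtain ⟨C, hC, hsol⟩ := hcen L
  have hUc : ∀ y ∈ H, c₁ ≤ ‖U y - c‖ := fun y hy => hM₁ y (hHpen hy) (hMM₁.trans hy.1.le)
  have hUc0 : ∀ y ∈ H, U y - c ≠ 0 := fun y hy =>
    norm_pos_iff.1 (hc₁.trans_le (hUc y hy))
  set V : ℂ → ℂ := fun y => iteratedDeriv 2 U y / (U y - c) with hV
  have hUa : ∀ y ∈ H, AnalyticAt ℂ (fun y => U y - c) y := fun y hy =>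
    (hU.analytic y (hHpen hy)).sub analyticAt_const
  have hVa : ∀ y ∈ H, AnalyticAt ℂ V y := fun y hy => by
    refine AnalyticAt.div ?_ (hUa y hy) (hUc0 y hy)
    rw [iteratedDeriv_two_eq]
    exact (hU.analytic y (hHpen hy)).deriv.deriv
  have hVK : ∀ y ∈ H, ‖V y‖ ≤ C₀ / c₁ * Real.exp (-β * y.re) := fun y hy => by
    rw [hV, norm_div, div_mul_eq_mul_div]
    exact div_le_div₀ (by positivity) (hC₀ y (hHpen hy)) hc₁ (hUc y hy)
  obtain ⟨Ci, hCi, hinf⟩ := exists_solution_on_halfStrip hα hσ hβ hM0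
    (by positivity : 0 ≤ C₀ / c₁)
    (fun y hy => (hVa y hy).differentiableAt.differentiableWithinAt) hVK
  have hzero : HasLogForm β₀ β₁ yc (fun _ => 0) (fun _ => 0) (fun _ => 0) :=
    Eventually.of_forall fun y => by simp
  have hzs : SeriesBound ρ (fun _ => 0) 1 := by simp [SeriesBound, summable_zero]
  -- Homogeneous solutions with (p₀, p₁) = (0, 1) and (1, 0). The first has no logarithm at leading
  -- order.
  obtain ⟨ψ₁, pa, qa, hψ₁, hray₁, hlog₁, hpa0, hpa1, hqa0, hpa, hqa, hb₁⟩ :=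
    hsol (fun _ => 0) 1 _ _ one_pos analyticOnNhd_const (by simp) hzero hzs hzs 0 1 (by simp)
      (by simp)
  obtain ⟨ψ₂, pb, qb, hψ₂, hray₂, hlog₂, hpb0, hpb1, -, hpb, hqb, hb₂⟩ :=
    hsol (fun _ => 0) 1 _ _ one_pos analyticOnNhd_const (by simp) hzero hzs hzs 1 0 (by simp)
      (by simp)
  have hqa0 := hqa0 rfl rfl
  have hcomb : ∀ (φ g : ℂ → ℂ) (p q : ℕ → ℂ) (K : ℝ), AnalyticOnNhd ℂ φ P →
      (∀ y ∈ P, rayleigh U α c φ y = g y) → HasLogForm β₀ β₁ yc φ p q → SeriesBound ρ p K →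
      SeriesBound ρ q K → ∀ A B : ℂ,
      AnalyticOnNhd ℂ (fun y => (φ y + A * ψ₁ y) + B * ψ₂ y) P ∧
      (∀ y ∈ P, rayleigh U α c (fun y => (φ y + A * ψ₁ y) + B * ψ₂ y) y = g y) ∧
      HasLogForm β₀ β₁ yc (fun y => (φ y + A * ψ₁ y) + B * ψ₂ y)
        (fun n => p n + A * pa n + B * pb n) (fun n => q n + A * qa n + B * qb n) ∧
      SeriesBound ρ (fun n => p n + A * pa n + B * pb n)
        (K + ‖A‖ * (C * 1) + ‖B‖ * (C * 1)) ∧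
      SeriesBound ρ (fun n => q n + A * qa n + B * qb n)
        (K + ‖A‖ * (C * 1) + ‖B‖ * (C * 1)) := by
    intro φ g p q K hφ hr hl hp hq A B
    have hA : ∀ y ∈ P, AnalyticAt ℂ (fun y => φ y + A * ψ₁ y) y := fun y hy =>
      (hφ y hy).add (analyticAt_const.mul (hψ₁ y hy))
    have hp1 := hp.add (hpa.const_mul A) hρ.le
    have hq1 := hq.add (hqa.const_mul A) hρ.le
    refine ⟨fun y hy => (hA y hy).add (analyticAt_const.mul (hψ₂ y hy)), fun y hy => ?_,
      hasLogForm_add_const_mul hρ hp1 hq1 hpb hqb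
        (hasLogForm_add_const_mul hρ hp hq hpa hqa hl hlog₁ A) hlog₂ B,
      hp1.add (hpb.const_mul B) hρ.le, hq1.add (hqb.const_mul B) hρ.le⟩
    rw [rayleigh_add_const_mul (hA y hy) (hψ₂ y hy),
      rayleigh_add_const_mul (hφ y hy) (hψ₁ y hy), hr y hy, hray₁ y hy, hray₂ y hy]
    ring
  have hcombd : ∀ φ : ℂ → ℂ, AnalyticOnNhd ℂ φ P → ∀ A B : ℂ,
      deriv (fun y => (φ y + A * ψ₁ y) + B * ψ₂ y) z₀
        = deriv φ z₀ + A * deriv ψ₁ z₀ + B * deriv ψ₂ z₀ := by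
    intro φ hφ A B
    exact (((hφ z₀ hz₀P).differentiableAt.hasDerivAt.fun_add
      ((hψ₁ z₀ hz₀P).differentiableAt.hasDerivAt.const_mul A)).fun_add
      ((hψ₂ z₀ hz₀P).differentiableAt.hasDerivAt.const_mul B)).deriv
  have hVcont : ContinuousAt (fun y => (α : ℂ) ^ 2 + V y) z₀ :=
    continuousAt_const.add (hVa z₀ hz₀H).continuousAt
  -- A combination with zero Cauchy data at z₀ vanishes along the segment towards yc. There the
  -- constant coefficient gives B = 0; this removes the leading logarithm, and the linear
  -- coefficient gives A = 0.
  have hdet : ψ₁ z₀ * deriv ψ₂ z₀ - ψ₂ z₀ * deriv ψ₁ z₀ ≠ 0 := by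
    refine det_ne_zero_of_forall fun A B h1 h2 => ?_
    obtain ⟨hha, hhray, hhlog, hhp, hhq⟩ := hcomb (fun _ => 0) (fun _ => 0) _ _ 1
      analyticOnNhd_const (by simp [rayleigh, vorticityTerm, iteratedDeriv_two_eq]) hzero hzs hzs
      A B
    have hd := hcombd (fun _ => 0) analyticOnNhd_const A B
    set h : ℂ → ℂ := fun y => (0 + A * ψ₁ y) + B * ψ₂ y with hh
    set S : Set ℂ := (fun t : ℝ => yc + (t : ℂ) * (z₀ - yc)) '' Set.Ioc 0 1 with hS
    have hSP : S ⊆ P := by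
      rintro _ ⟨t, ht, rfl⟩
      exact slitPencil_star hyc (by rwa [add_sub_cancel]) ht.1 ht.2
    have hSc : IsPreconnected S := isPreconnected_Ioc.image _ (by fun_prop)
    have hS0 : z₀ ∈ S := ⟨1, by simp, by simp⟩
    have hzeroS := eqOn_zero_of_cauchy_data hSc hS0 (hha.mono hSP) hVcont
      (by
        filter_upwards [hHo.mem_nhds hz₀H] with z hz
        have := deriv_deriv_eq_of_rayleigh_eq (f := fun _ => 0) (hUc0 z hz) (hhray z (hHP hz))
        rw [this, zero_div, add_zero])
      (by rw [hh]; simpa using h1) (by rw [hd]; simpa using h2)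
    have hY : z₀ - yc ∈ slitDomain := notMem_downRay_iff.1 hz₀P.2
    have htend : Tendsto (fun t : ℝ => yc + (t : ℂ) * (z₀ - yc)) (𝓝[>] 0) (𝓝[P] yc) := by
      refine tendsto_nhdsWithin_iff.2 ⟨?_, ?_⟩
      · have hcont : Continuous fun t : ℝ => yc + (t : ℂ) * (z₀ - yc) := by fun_prop
        have := (hcont.tendsto 0).mono_left (nhdsWithin_le_nhds (s := Set.Ioi 0))
        simpa using this
      · filter_upwards [Ioc_mem_nhdsGT (zero_lt_one' ℝ)] with t ht
        exact hSP ⟨t, ht, rfl⟩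
    have hev : ∀ᶠ t : ℝ in 𝓝[>] 0, logSum (fun n => 0 + A * pa n + B * pb n)
        (fun n => 0 + A * qa n + B * qb n) ((t : ℂ) * (z₀ - yc)) = 0 := by
      filter_upwards [htend.eventually (hasLogForm_iff.1 hhlog),
        Ioc_mem_nhdsGT (zero_lt_one' ℝ)] with t h3 h4
      rw [add_sub_cancel_left] at h3
      rw [← h3]
      exact hzeroS ⟨t, h4, rfl⟩
    have hp0 := coeff_zero_eq_zero_of_logSum_eventually_eq_zero hρ hhp hhq hY hev
    have hB : B = 0 := by simpa [hpa0, hpb0] using hp0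
    have hp1 := coeff_one_eq_zero_of_logSum_eventually_eq_zero hρ hhp hhq hY hev hp0
      (by simp [hqa0, hB])
    exact ⟨by simpa [hpa1, hB] using hp1, hB⟩
  set S := (‖ψ₁ z₀‖ + ‖ψ₂ z₀‖ + ‖deriv ψ₁ z₀‖ + ‖deriv ψ₂ z₀‖)
    / ‖ψ₁ z₀ * deriv ψ₂ z₀ - ψ₂ z₀ * deriv ψ₁ z₀‖ with hSdef
  have hS0 : 0 ≤ S := by positivity
  set E₀ := C + Ci / c₁ with hE₀
  have hE₀0 : 0 < E₀ := by positivity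
  -- Bounds both the value and, through the Cauchy estimate of radius r < 1, the derivative mismatch
  -- at z₀.
  set E := E₀ / r with hE
  have hE0 : 0 < E := by positivity
  have hEE : E₀ ≤ E := by
    rw [hE, le_div_iff₀ hr0]
    exact mul_le_of_le_one_right hE₀0.le (by linarith)
  set C₂ := C + 2 * (S * E * C) with hC₂
  have hC₂0 : 0 < C₂ := by positivity
  have hexp1 : 1 ≤ Real.exp (α * (M + 1)) := Real.one_le_exp (by positivity)
  have hC₂3 : C₂ ≤ C₂ * Real.exp (α * (M + 1)) + Ci / c₁ := by
    have := le_mul_of_one_le_right hC₂0.le hexp1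
    have : 0 < Ci / c₁ := by positivity
    linarith
  refine ⟨C₂ * Real.exp (α * (M + 1)) + Ci / c₁, by positivity,
    fun f N a b hN hf hfN hflog ha hb => ?_⟩
  obtain ⟨φp, p, q, hφp, hrayp, hlogp, -, -, -, hp, hq, hbp⟩ :=
    hsol f N a b hN hf (fun y hy => (hfN y hy).trans (mul_le_of_le_one_right hN.le
      (Real.exp_le_one_iff.2 (by nlinarith [hy.1.2])))) hflog ha hb 0 0 (by simpa using hN.le)
      (by simpa using hN.le)
  obtain ⟨φi, hφi, hodei, hbi⟩ := hinf (fun y => f y / (U y - c)) (N / c₁) (by positivity)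
    (fun y hy => ((hf y (hHP hy)).div (hUa y hy)
      (hUc0 y hy)).differentiableAt.differentiableWithinAt) fun y hy => by
        rw [norm_div, div_mul_eq_mul_div]
        exact div_le_div₀ (by positivity) (hfN y (hHP hy)) hc₁ (hUc y hy)
  have hφia : AnalyticOnNhd ℂ φi H := hφi.analyticOnNhd hHo
  have hbp' : ∀ y ∈ Metric.closedBall z₀ r, ‖φp y‖ ≤ C * N := fun y hy =>
    hbp y (hHP (hballH hy)) (hnear y (hHP (hballH hy)) (hballre y hy).2.1)
  have hbi' : ∀ y ∈ Metric.closedBall z₀ r, ‖φi y‖ ≤ Ci / c₁ * N := fun y hy => by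
    refine (hbi y (hballH hy)).trans ?_
    calc Ci * (N / c₁) * Real.exp (-α * y.re) ≤ Ci * (N / c₁) * 1 := by
          gcongr
          exact Real.exp_le_one_iff.2 (by nlinarith [(hballre y hy).1])
      _ = _ := by ring
  have hmem := Metric.mem_closedBall_self (x := z₀) hr0.le
  have he₁ : ‖φi z₀ - φp z₀‖ ≤ E * N := by
    calc _ ≤ ‖φi z₀‖ + ‖φp z₀‖ := norm_sub_le _ _
      _ ≤ Ci / c₁ * N + C * N := add_le_add (hbi' _ hmem) (hbp' _ hmem)
      _ = E₀ * N := by rw [hE₀]; ring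
      _ ≤ E * N := by gcongr
  have he₂ : ‖deriv φi z₀ - deriv φp z₀‖ ≤ E * N := by
    calc _ ≤ ‖deriv φi z₀‖ + ‖deriv φp z₀‖ := norm_sub_le _ _
      _ ≤ Ci / c₁ * N / r + C * N / r := add_le_add
          (norm_deriv_le_of_halfStrip hr0 hballH hφia hbi')
          (norm_deriv_le_of_halfStrip hr0 hballH (hφp.mono hHP) hbp')
      _ = E * N := by rw [hE, hE₀]; ring
  obtain ⟨A, B, hAB₁, hAB₂, hA, hB⟩ := exists_linear_combination_eq hdet he₁ he₂
  obtain ⟨hφ, hray, hlog, hps, hqs⟩ := hcomb φp f p q (C * N) hφp hrayp hlogp hp hq A B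
  have hder := hcombd φp hφp A B
  have hbd : C * N + ‖A‖ * (C * 1) + ‖B‖ * (C * 1) ≤ C₂ * N := by
    calc _ ≤ C * N + S * (E * N) * (C * 1) + S * (E * N) * (C * 1) := by gcongr
      _ = _ := by rw [hC₂]; ring
  have hbd' : C * N + ‖A‖ * (C * 1) + ‖B‖ * (C * 1)
      ≤ (C₂ * Real.exp (α * (M + 1)) + Ci / c₁) * N :=
    hbd.trans (by gcongr)
  refine ⟨_, _, _, hφ, hray, hlog, hps.mono hbd', hqs.mono hbd', ?_⟩
  have hφbd : ∀ y ∈ P, ‖y - yc‖ ≤ L → ‖(φp y + A * ψ₁ y) + B * ψ₂ y‖ ≤ C₂ * N := by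
    intro y hy hyL
    refine le_trans ?_ hbd
    refine (norm_add₃_le).trans ?_
    rw [norm_mul, norm_mul]
    gcongr
    · exact hbp y hy hyL
    · exact hb₁ y hy hyL
    · exact hb₂ y hy hyL
  set φ : ℂ → ℂ := fun y => (φp y + A * ψ₁ y) + B * ψ₂ y with hφdef
  -- Equal Cauchy data at z₀ force agreement on the whole half strip, so the solution from yc
  -- inherits the decay.
  have heq : Set.EqOn (fun y => φ y - φi y) 0 H := by
    refine eqOn_zero_of_cauchy_data (convex_halfStrip β₁ M).isPreconnected hz₀H
      (fun y hy => (hφ y (hHP hy)).sub (hφia y hy)) hVcont ?_ ?_ ?_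
    · filter_upwards [hHo.mem_nhds hz₀H] with z hz
      rw [deriv_deriv_sub (hφ z (hHP hz)) (hφia z hz), hodei z hz,
        deriv_deriv_eq_of_rayleigh_eq (hUc0 z hz) (hray z (hHP hz))]
      ring
    · rw [hφdef]
      linear_combination hAB₁
    · rw [((hφ z₀ hz₀P).differentiableAt.hasDerivAt.fun_sub
        (hφia z₀ hz₀H).differentiableAt.hasDerivAt).deriv, hder]
      linear_combination hAB₂
  have hbH : ∀ y ∈ H, ‖φ y‖ ≤ Ci / c₁ * N * Real.exp (-α * y.re) := fun y hy => by
    rw [sub_eq_zero.1 (heq hy)]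
    refine (hbi y hy).trans_eq ?_
    ring
  intro y hy
  rcases le_or_gt y.re (M + 1) with hyM | hyM
  · have h1 : 1 ≤ Real.exp (α * (M + 1)) * Real.exp (-α * y.re) := by
      rw [← Real.exp_add]
      exact Real.one_le_exp (by nlinarith)
    calc ‖φ y‖ ≤ C₂ * N * 1 := by
          rw [mul_one]
          exact hφbd y hy (hnear y hy (by linarith))
      _ ≤ C₂ * N * (Real.exp (α * (M + 1)) * Real.exp (-α * y.re)) := by gcongr
      _ = C₂ * Real.exp (α * (M + 1)) * N * Real.exp (-α * y.re) := by ring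
      _ ≤ _ := by
          gcongr
          have : 0 < Ci / c₁ := by positivity
          linarith
  · set γ : ℝ → ℂ := fun s => (y.re : ℂ) + (s : ℂ) * ((y.im : ℂ) * Complex.I) with hγ
    have hγ1 : γ 1 = y := by simp [hγ, Complex.re_add_im]
    have hγre : ∀ s, (γ s).re = y.re := fun s => by simp [hγ]
    have hγim : ∀ s, (γ s).im = s * y.im := fun s => by simp [hγ]
    have hγc : Continuous γ := by fun_prop
    have hlim : Tendsto (fun s => ‖φ (γ s)‖) (𝓝[<] 1) (𝓝 ‖φ y‖) := by
      have h1 : Tendsto γ (𝓝[<] 1) (𝓝 y) := by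
        have := (hγc.tendsto 1).mono_left (nhdsWithin_le_nhds (s := Set.Iio 1))
        rwa [hγ1] at this
      exact ((hφ y hy).continuousAt.tendsto.comp h1).norm
    have hle : ‖φ y‖ ≤ Ci / c₁ * N * Real.exp (-α * y.re) := by
      refine le_of_tendsto hlim ?_
      filter_upwards [Ioo_mem_nhdsLT (zero_lt_one' ℝ)] with s hs
      rw [← hγre s]
      refine hbH _ ⟨by rw [hγre]; linarith, ?_⟩
      rw [hγim, abs_mul, abs_of_pos hs.1]
      have h3 := hy.1.1.trans (min_le_right _ _)
      have h4 := hs.2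
      have h5 := abs_nonneg y.im
      calc s * |y.im| ≤ s * β₁ := mul_le_mul_of_nonneg_left h3 hs.1.le
        _ < 1 * β₁ := mul_lt_mul_of_pos_right h4 hβ₁
        _ = β₁ := one_mul _
    refine hle.trans ?_
    gcongr
    have : 0 < C₂ * Real.exp (α * (M + 1)) := by positivity
    linarith

end Matching

end

section

open Filter

section Norms

variable {β₀ β₁ ρ σ : ℝ} {yc : ℂ} {f : ℂ → ℂ} {a b : ℕ → ℂ}

theorem seriesNorm_eq (hρ : 0 ≤ ρ) (a : ℕ → ℂ) :
    seriesNorm ρ a = ∑' n, ENNReal.ofReal (‖a n‖ * ρ ^ n) := by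
  unfold seriesNorm
  congr 1
  ext1 n
  rw [ENNReal.ofReal_mul (norm_nonneg _), ENNReal.ofReal_pow hρ, ofReal_norm]

theorem seriesNorm_le_ofReal_iff (hρ : 0 ≤ ρ) {N : ℝ} (hN : 0 ≤ N) :
    seriesNorm ρ a ≤ ENNReal.ofReal N ↔ SeriesBound ρ a N := by
  have hnn : ∀ n, 0 ≤ ‖a n‖ * ρ ^ n := fun n => by positivity
  rw [seriesNorm_eq hρ]
  constructor
  · intro h
    have hs : Summable fun n => ‖a n‖ * ρ ^ n := by
      have := ENNReal.summable_toReal (h.trans_lt ENNReal.ofReal_lt_top).ne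
      simpa only [ENNReal.toReal_ofReal (hnn _)] using this
    rw [← ENNReal.ofReal_tsum_of_nonneg hnn hs, ENNReal.ofReal_le_ofReal_iff hN] at h
    exact ⟨hs, h⟩
  · intro h
    rw [← ENNReal.ofReal_tsum_of_nonneg hnn h.1]
    exact ENNReal.ofReal_le_ofReal h.2

theorem weightedSupNorm_le_ofReal_iff {N : ℝ} (hN : 0 ≤ N) :
    weightedSupNorm β₀ β₁ yc σ f ≤ ENNReal.ofReal N ↔
      ∀ y ∈ slitPencil β₀ β₁ yc, ‖f y‖ ≤ N * Real.exp (-σ * y.re) := by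
  unfold weightedSupNorm
  rw [iSup₂_le_iff]
  refine forall₂_congr fun y _ => ?_
  rw [← ofReal_norm, ENNReal.ofReal_le_ofReal_iff hN, norm_mul, Complex.norm_exp,
    Complex.re_ofReal_mul, neg_mul, Real.exp_neg, ← div_eq_mul_inv,
    le_div_iff₀ (Real.exp_pos _)]

theorem yNorm_le_ofReal {N : ℝ} (hρ : 0 ≤ ρ) (hN : 0 ≤ N)
    (hf : ∀ y ∈ slitPencil β₀ β₁ yc, ‖f y‖ ≤ N * Real.exp (-σ * y.re))
    (hlog : HasLogForm β₀ β₁ yc f a b) (ha : SeriesBound ρ a N) (hb : SeriesBound ρ b N) :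
    yNorm β₀ β₁ yc ρ σ f ≤ ENNReal.ofReal (3 * N) := by
  have h3 : ENNReal.ofReal (3 * N) = ENNReal.ofReal N + (ENNReal.ofReal N + ENNReal.ofReal N) := by
    rw [← ENNReal.ofReal_add hN hN, ← ENNReal.ofReal_add hN (by positivity)]
    ring_nf
  refine le_trans ?_ h3.ge
  unfold yNorm
  refine add_le_add ((weightedSupNorm_le_ofReal_iff hN).2 hf)
    (iInf_le_of_le a (iInf_le_of_le b (iInf_le_of_le hlog ?_)))
  exact add_le_add ((seriesNorm_le_ofReal_iff hρ hN).2 ha) ((seriesNorm_le_ofReal_iff hρ hN).2 hb)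

theorem exists_bounds_of_yNorm_lt {N : ℝ} (hρ : 0 ≤ ρ)
    (h : yNorm β₀ β₁ yc ρ σ f < ENNReal.ofReal N) :
    (∀ y ∈ slitPencil β₀ β₁ yc, ‖f y‖ ≤ N * Real.exp (-σ * y.re)) ∧
      ∃ a b : ℕ → ℂ, HasLogForm β₀ β₁ yc f a b ∧ SeriesBound ρ a N ∧ SeriesBound ρ b N := by
  have hN : 0 ≤ N := (ENNReal.ofReal_pos.1 (bot_le.trans_lt h)).le
  refine ⟨(weightedSupNorm_le_ofReal_iff hN).1 (le_self_add.trans h.le), ?_⟩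
  obtain ⟨a, ha⟩ := iInf_lt_iff.1 (le_add_self.trans_lt h)
  obtain ⟨b, hb⟩ := iInf_lt_iff.1 ha
  obtain ⟨hlog, hlt⟩ := iInf_lt_iff.1 hb
  exact ⟨a, b, hlog, (seriesNorm_le_ofReal_iff hρ hN).1 (le_self_add.trans hlt.le),
    (seriesNorm_le_ofReal_iff hρ hN).1 (le_add_self.trans hlt.le)⟩

theorem eq_zero_of_yNorm_eq_zero (h : yNorm β₀ β₁ yc ρ σ f = 0) {y : ℂ}
    (hy : y ∈ slitPencil β₀ β₁ yc) : f y = 0 := by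
  have h1 : weightedSupNorm β₀ β₁ yc σ f ≤ ENNReal.ofReal 0 := by
    rw [ENNReal.ofReal_zero, ← h]
    exact le_self_add
  simpa using (weightedSupNorm_le_ofReal_iff le_rfl).1 h1 y hy

theorem yNorm_zero (hρ : 0 ≤ ρ) : yNorm β₀ β₁ yc ρ σ (fun _ => 0) = 0 := by
  have hzs : SeriesBound ρ (fun _ => 0) 0 := by simp [SeriesBound, summable_zero]
  simpa using yNorm_le_ofReal (β₀ := β₀) (β₁ := β₁) (yc := yc) (σ := σ) (f := fun _ => 0) hρ
    le_rfl (by simp) (Eventually.of_forall fun y => by simp) hzs hzs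

end Norms

section Vorticity

variable {β₀ β₁ ρ α β σ : ℝ} {yc c : ℂ} {U f φ : ℂ → ℂ}

theorem hasLogForm_vorticityTerm {a b p q u : ℕ → ℂ} {M N K : ℝ} (hρ : 0 < ρ)
    (hray : ∀ y ∈ slitPencil β₀ β₁ yc, rayleigh U α c φ y = f y)
    (hu : SeriesBound ρ u M) (hU : ∀ Y, ‖Y‖ < ρ → iteratedDeriv 2 U (yc + Y) = powerSum u Y)
    (ha : SeriesBound ρ a N) (hb : SeriesBound ρ b N) (hp : SeriesBound ρ p K)
    (hq : SeriesBound ρ q K) (hf : HasLogForm β₀ β₁ yc f a b) (hφ : HasLogForm β₀ β₁ yc φ p q) :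
    HasLogForm β₀ β₁ yc (vorticityTerm U α c φ) (fun n => a n + cauchyProd u p n)
      (fun n => b n + cauchyProd u q n) := by
  rw [hasLogForm_iff] at hf hφ ⊢
  filter_upwards [hf, hφ, nhdsWithin_le_nhds (Metric.ball_mem_nhds yc hρ), self_mem_nhdsWithin]
    with y h1 h2 h3 h4
  have hy : ‖y - yc‖ < ρ := mem_ball_iff_norm.1 h3
  have h5 := hU _ hy
  rw [add_sub_cancel] at h5
  have h6 : vorticityTerm U α c φ y = f y + iteratedDeriv 2 U y * φ y := by
    rw [← hray y h4, rayleigh]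
    ring
  rw [h6, h1, h2, h5]
  unfold logSum
  rw [ha.powerSum_add (hu.cauchyProd hp hρ.le) hy.le, hb.powerSum_add (hu.cauchyProd hq hρ.le) hy.le,
    hu.powerSum_cauchyProd hp hy.le, hu.powerSum_cauchyProd hq hy.le]
  ring

theorem analyticOnNhd_vorticityTerm (hU : AnalyticOnNhd ℂ U (slitPencil β₀ β₁ yc))
    (hφ : AnalyticOnNhd ℂ φ (slitPencil β₀ β₁ yc)) :
    AnalyticOnNhd ℂ (vorticityTerm U α c φ) (slitPencil β₀ β₁ yc) := by
  intro y hy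
  unfold vorticityTerm
  rw [iteratedDeriv_two_eq]
  exact ((hU y hy).sub analyticAt_const).mul
    ((hφ y hy).deriv.deriv.sub (analyticAt_const.mul (hφ y hy)))

theorem norm_vorticityTerm_le {C₀ N K : ℝ} {y : ℂ} (hα : 0 < α) (hσβ : σ < β) (hy : 0 ≤ y.re)
    (hray : rayleigh U α c φ y = f y) (hU : ‖iteratedDeriv 2 U y‖ ≤ C₀ * Real.exp (-β * y.re))
    (hf : ‖f y‖ ≤ N * Real.exp (-σ * y.re)) (hφ : ‖φ y‖ ≤ K * Real.exp (-α * y.re)) :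
    ‖vorticityTerm U α c φ y‖ ≤ (N + C₀ * K) * Real.exp (-σ * y.re) := by
  have hvort : vorticityTerm U α c φ y = f y + iteratedDeriv 2 U y * φ y := by
    rw [← hray, rayleigh]
    ring
  have hC₀ : 0 ≤ C₀ := nonneg_of_mul_nonneg_left ((norm_nonneg _).trans hU) (Real.exp_pos _)
  have hK : 0 ≤ K := nonneg_of_mul_nonneg_left ((norm_nonneg _).trans hφ) (Real.exp_pos _)
  have hle : Real.exp (-β * y.re) * Real.exp (-α * y.re) ≤ Real.exp (-σ * y.re) := by
    rw [← Real.exp_add]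
    exact Real.exp_le_exp.2 (by nlinarith)
  rw [hvort]
  calc _ ≤ ‖f y‖ + ‖iteratedDeriv 2 U y‖ * ‖φ y‖ := (norm_add_le _ _).trans_eq (by rw [norm_mul])
    _ ≤ N * Real.exp (-σ * y.re)
        + C₀ * Real.exp (-β * y.re) * (K * Real.exp (-α * y.re)) := by gcongr
    _ = N * Real.exp (-σ * y.re)
        + C₀ * K * (Real.exp (-β * y.re) * Real.exp (-α * y.re)) := by ring
    _ ≤ N * Real.exp (-σ * y.re) + C₀ * K * Real.exp (-σ * y.re) := by gcongr
    _ = _ := by ring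

end Vorticity

end

theorem mainTheorem10
    (β₀ β₁ : ℝ) (hβ₀ : 0 < β₀) (hβ₁ : 0 < β₁)
    (U : ℂ → ℂ) (Uplus β : ℝ) (hU : IsShearProfile β₀ β₁ U Uplus β)
    (c yc : ℂ) (hyc : yc ∈ pencil β₀ β₁)
    (hcrit : ∀ y ∈ pencil β₀ β₁, U y = c ↔ y = yc)
    (hsimple : deriv U yc ≠ 0) (hc : c ≠ (Uplus : ℂ))
    (α σ : ℝ) (hα : 0 < α) (hσ : α < σ) :
    ∃ ρ₀ : ℝ, 0 < ρ₀ ∧ ∀ ρ : ℝ, 0 < ρ → ρ < ρ₀ →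
      ∃ C : ℝ≥0, ∀ f : ℂ → ℂ, MemY β₀ β₁ yc ρ σ f →
        ∃ φ : ℂ → ℂ, MemY β₀ β₁ yc ρ α φ ∧
          (∀ y ∈ slitPencil β₀ β₁ yc, rayleigh U α c φ y = f y) ∧
          yNorm β₀ β₁ yc ρ α φ ≤ (C : ℝ≥0∞) * yNorm β₀ β₁ yc ρ σ f ∧
          (σ < β →
            MemY β₀ β₁ yc ρ σ (vorticityTerm U α c φ) ∧
            yNorm β₀ β₁ yc ρ σ (vorticityTerm U α c φ)
              ≤ (C : ℝ≥0∞) * yNorm β₀ β₁ yc ρ σ f) := by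
  obtain ⟨ρ₀, hρ₀, hmain⟩ :=
    exists_decaying_rayleigh_solution hβ₀ hβ₁ hU hyc hcrit hsimple hc hα hσ
  refine ⟨ρ₀, hρ₀, fun ρ hρ hρlt => ?_⟩
  obtain ⟨⟨u, M, hu, hUu⟩, C₁, hC₁, hsol⟩ := hmain ρ hρ hρlt
  obtain ⟨C₀, hC₀⟩ := hU.decay
  have hC₀0 : 0 ≤ C₀ := (norm_nonneg _).trans (norm_le_of_decay hU.rate_pos hC₀ hyc)
  have hM0 : 0 ≤ M := hu.nonneg hρ.le
  set C₂ := max C₁ (1 + (C₀ + M) * C₁) with hC₂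
  have hC₂0 : 0 < C₂ := hC₁.trans_le (le_max_left _ _)
  refine ⟨(6 * C₂).toNNReal, fun f hf => ?_⟩
  rcases eq_or_ne (yNorm β₀ β₁ yc ρ σ f) 0 with h0 | h0
  · have hv : vorticityTerm U α c (fun _ => 0) = fun _ => 0 := by
      ext y
      simp [vorticityTerm]
    have hmem : ∀ τ, MemY β₀ β₁ yc ρ τ (fun _ => 0) := fun τ =>
      ⟨analyticOnNhd_const, by rw [yNorm_zero hρ.le]; exact ENNReal.zero_lt_top⟩
    refine ⟨fun _ => 0, hmem α, fun y hy => ?_, by rw [yNorm_zero hρ.le]; exact zero_le,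
      fun _ => ?_⟩
    · rw [eq_zero_of_yNorm_eq_zero h0 hy, rayleigh, hv]
      simp
    · rw [hv]
      exact ⟨hmem σ, by rw [yNorm_zero hρ.le]; exact zero_le⟩
  set n := (yNorm β₀ β₁ yc ρ σ f).toReal with hn
  have hn0 : 0 < n := ENNReal.toReal_pos h0 hf.2.ne
  have hnf : ENNReal.ofReal n = yNorm β₀ β₁ yc ρ σ f := ENNReal.ofReal_toReal hf.2.ne
  have hlt : yNorm β₀ β₁ yc ρ σ f < ENNReal.ofReal (2 * n) := by
    rw [← hnf]
    exact (ENNReal.ofReal_lt_ofReal_iff (by positivity)).2 (by linarith)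
  have hfin : ENNReal.ofReal (3 * (C₂ * (2 * n)))
      = ((6 * C₂).toNNReal : ℝ≥0∞) * yNorm β₀ β₁ yc ρ σ f := by
    rw [← hnf, ← ENNReal.ofReal, ← ENNReal.ofReal_mul (by positivity)]
    ring_nf
  obtain ⟨hfb, a, b, hlog, ha, hb⟩ := exists_bounds_of_yNorm_lt hρ.le hlt
  obtain ⟨φ, p, q, hφ, hray, hφlog, hp, hq, hφb⟩ :=
    hsol f (2 * n) a b (by positivity) hf.1 hfb hlog ha hb
  have hle : C₁ * (2 * n) ≤ C₂ * (2 * n) := by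
    gcongr
    exact le_max_left _ _
  have hφn := yNorm_le_ofReal (σ := α) hρ.le (by positivity : 0 ≤ C₂ * (2 * n))
    (fun y hy => (hφb y hy).trans (by gcongr)) hφlog (hp.mono hle) (hq.mono hle)
  refine ⟨φ, ⟨hφ, hφn.trans_lt ENNReal.ofReal_lt_top⟩, hray, hfin ▸ hφn, fun hσβ => ?_⟩
  have hle₀ : 2 * n + C₀ * (C₁ * (2 * n)) ≤ C₂ * (2 * n) := by
    have h1 : (1 + (C₀ + M) * C₁) * (2 * n) ≤ C₂ * (2 * n) := by
      gcongr
      exact le_max_right _ _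
    have h2 : 0 ≤ M * C₁ * (2 * n) := by positivity
    linarith
  have hleM : 2 * n + M * (C₁ * (2 * n)) ≤ C₂ * (2 * n) := by
    have h1 : (1 + (C₀ + M) * C₁) * (2 * n) ≤ C₂ * (2 * n) := by
      gcongr
      exact le_max_right _ _
    have h2 : 0 ≤ C₀ * C₁ * (2 * n) := by positivity
    linarith
  have hvn := yNorm_le_ofReal (σ := σ) hρ.le (by positivity : 0 ≤ C₂ * (2 * n))
    (fun y hy => (norm_vorticityTerm_le hα hσβ hy.1.2 (hray y hy) (hC₀ y hy.1) (hfb y hy)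
      (hφb y hy)).trans (by gcongr))
    (hasLogForm_vorticityTerm hρ hray hu hUu ha hb hp hq hlog hφlog)
    ((ha.add (hu.cauchyProd hp hρ.le) hρ.le).mono hleM)
    ((hb.add (hu.cauchyProd hq hρ.le) hρ.le).mono hleM)
  exact ⟨⟨analyticOnNhd_vorticityTerm (fun y hy => hU.analytic y hy.1) hφ,
    hvn.trans_lt ENNReal.ofReal_lt_top⟩, hfin ▸ hvn⟩
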